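/- **Setting.** An *arena* $\mathcal A=(V_0,V_1,E)$ consists of disjoint finite sets $V_0,V_1$, $V=V_0\cup V_1$ nonempty, and a set $E\subseteq V_0\times V_1\cup V_1\times V_0$ of directed edges such that each $v\in V$ has an outgoing edge. A *coloured Muller game* $\mathcal G=(\mathcal A,c,(\mathcal F_0,\mathcal F_1))$ consists of an arena, a map $c:V\to C$ into a set of colours with $|C|\le|V|$, and a partition $\mathcal F_0\cup\mathcal F_1=2^C$, $\mathcal F_0\cap\mathcal F_1=\emptyset$. Player $\sigma\in\{0,1\}$ moves from the positions in $V_\sigma$ and wins an infinite play $\rho$ if $c(\mathsf{Inf}(\rho))\in\mathcal F_\sigma$, where $\mathsf{Inf}(\rho)$ is the set of positions occurring infinitely often in $\rho$. $Win_\sigma(\mathcal G)$ is the set of positions from which Player $\sigma$ has a winning strategy, and Player $\sigma$ *fully wins* $\mathcal G$ if $Win_\sigma(\mathcal G)=V$. For $X\subseteq V$ let $\mathcal A(X)=(V_0\cap X,V_1\cap X,E\cap(X\times X))$; if this is an arena, $\mathcal G(X)$ is the game played on it with the same colouring and winning conditions. A subarena $\mathcal A(X)$ is a *$1$-trap* if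 every position in $X\cap V_0$ has a successor in $X$ and all successors of positions in $X\cap V_1$ are in $X$. Let $P_0$, $P_1$, $Q$ be the collections of nonempty $X\subseteq V$ such that $\mathcal A(X)$ is an arena and, in $\mathcal G(X)$, respectively Player 0 fully wins, Player 1 fully wins, or no player fully wins. The game is given explicitly by listing $V_0$, $V_1$, $E$, $c$, $\mathcal F_0$, $\mathcal F_1$, with $V$ and $C$ numbered, and $|\mathcal G|=|V|+|E|+\sum_{S\in\mathcal F_0\cup\mathcal F_1}|S|$. The computation model is a random access machine with unit-cost instructions (constants, addition, truncated subtraction, indirect load and store, comparison); it runs in space $B$ if only memory cells with addresses below $B$ are accessed and all numbers computed or loaded are below $B$. **Theorem.** There is an algorithm that decides coloured Muller games, i.e. that computes from $\mathcal G$ the partition of $V$ into $Win_0(\mathcal G)$ and $Win_1(\mathcal G)$, in time $O(2^{|V|}|V||E|)$ and space $O(|\mathcal G|+2^{|V|})$. Within the same bounds the algorithm also classifies all subgames, i.e. it computes, as a table indexed by the nonempty subsets of $V$, the collections $P_0$, $P_1$ and $Q$. Moreover, the winning regions can be read off from $P_0$: if no $X\in P_0$ determines a $1$-trap, then $Win_0(\mathcal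 G)=\emptyset$ and $Win_1(\mathcal G)=V$; otherwise there is a largest $S_{\max}\in P_0$ (with respect to inclusion) that determines a $1$-trap, and $Win_0(\mathcal G)=S_{\max}$, $Win_1(\mathcal G)=V\setminus S_{\max}$. -/

import Mathlib

namespace RegularGames

/-! ## Arenas, subarenas, traps -/

/-- A pseudo-arena: the positions `pos σ` of the two players `σ = 0, 1`, which are finite subsets
of an ambient type `U`, and a finite set of directed edges. -/
structure PseudoArena (U : Type) where
  pos : Fin 2 → Finset U
  E : Finset (U × U)

namespace PseudoArena

variable {U : Type} [DecidableEq U]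

/-- The set of all positions. -/
def V (A : PseudoArena U) : Finset U := A.pos 0 ∪ A.pos 1

/-- An arena: the players' positions are disjoint, the graph is bipartite, and each position has
an outgoing edge. -/
def IsArena (A : PseudoArena U) : Prop :=
  Disjoint (A.pos 0) (A.pos 1) ∧
  A.E ⊆ (A.pos 0 ×ˢ A.pos 1) ∪ (A.pos 1 ×ˢ A.pos 0) ∧
  ∀ v ∈ A.V, ∃ u, (v, u) ∈ A.E

/-- The pseudo-arena `A(X)` determined by `X`. -/
def restrict (A : PseudoArena U) (X : Finset U) : PseudoArena U where
  pos σ := A.pos σ ∩ X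
  E := A.E ∩ (X ×ˢ X)

/-- `A(X)` is a `σ`-trap: it is a subarena, the opponent `1 - σ` can always stay in `X`, and
Player `σ` cannot leave `X`. -/
def IsTrap (A : PseudoArena U) (σ : Fin 2) (X : Finset U) : Prop :=
  X ⊆ A.V ∧ (A.restrict X).IsArena ∧
  (∀ x ∈ X ∩ A.pos (1 - σ), ∃ y ∈ X ∩ A.pos σ, (x, y) ∈ A.E) ∧
  (∀ x ∈ X ∩ A.pos σ, ∀ y, (x, y) ∈ A.E → y ∈ X)

/-- `ρ` is a play starting at `v`. -/
def IsPlay (A : PseudoArena U) (v : U) (ρ : ℕ → U) : Prop :=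
  v ∈ A.V ∧ ρ 0 = v ∧ ∀ i, (ρ i, ρ (i + 1)) ∈ A.E

/-- A strategy for Player `σ` takes the list of the positions visited before and the current
position; at positions of Player `σ` it has to answer with a successor of the current position. -/
def IsStrategy (A : PseudoArena U) (σ : Fin 2) (s : List U → U → U) : Prop :=
  ∀ (past : List U), ∀ v ∈ A.pos σ, (v, s past v) ∈ A.E

/-- In the play `ρ`, all moves of Player `σ` are made according to `s`. -/
def Consistent (A : PseudoArena U) (σ : Fin 2) (s : List U → U → U) (ρ : ℕ → U) : Prop :=
  ∀ i, ρ i ∈ A.pos σ → ρ (i + 1) = s ((List.range i).map ρ) (ρ i)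

end PseudoArena

/-- The set of positions that occur infinitely often in `ρ`. -/
def infinitySet {U : Type} (ρ : ℕ → U) : Set U := {v | {i | ρ i = v}.Infinite}

/-! ## Coloured Muller games -/

/-- A coloured Muller game on a pseudo-arena; `F 0` and `F 1` partition the power set of the
set `C` of colours. (It is a game proper if `A` is an arena.) -/
structure ColouredMullerGame (U C : Type) [Fintype C] [DecidableEq C] where
  A : PseudoArena U
  c : U → C
  F : Fin 2 → Finset (Finset C)
  union_eq : F 0 ∪ F 1 = Finset.univ
  inter_eq : F 0 ∩ F 1 = ∅

namespace ColouredMullerGame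

variable {U C : Type} [DecidableEq U] [Fintype C] [DecidableEq C]

/-- The game `G(X)` played on `A(X)`. -/
def restrict (G : ColouredMullerGame U C) (X : Finset U) : ColouredMullerGame U C :=
  { G with A := G.A.restrict X }

/-- Player `σ` wins the play `ρ`: the set of colours seen infinitely often belongs to `F σ`. -/
def WinsPlay (G : ColouredMullerGame U C) (σ : Fin 2) (ρ : ℕ → U) : Prop :=
  ∃ S ∈ G.F σ, (S : Set C) = G.c '' infinitySet ρ

/-- The winning region of Player `σ`: the positions from which Player `σ` has a strategy that
wins every play consistent with it. -/
def Win (G : ColouredMullerGame U C) (σ : Fin 2) : Set U :=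
  {v | v ∈ G.A.V ∧ ∃ s, G.A.IsStrategy σ s ∧
    ∀ ρ, G.A.IsPlay v ρ → G.A.Consistent σ s ρ → G.WinsPlay σ ρ}

/-- Player `σ` fully wins the game. -/
def FullyWins (G : ColouredMullerGame U C) (σ : Fin 2) : Prop := G.Win σ = G.A.V

/-- The nonempty `X ⊆ V` for which `A(X)` is a subarena. -/
def IsSubgame (G : ColouredMullerGame U C) (X : Finset U) : Prop :=
  X.Nonempty ∧ X ⊆ G.A.V ∧ (G.restrict X).A.IsArena

/-- The collection `P σ` of the subgames that Player `σ` fully wins. -/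
def P (G : ColouredMullerGame U C) (σ : Fin 2) : Set (Finset U) :=
  {X | G.IsSubgame X ∧ (G.restrict X).FullyWins σ}

/-- The collection `Q` of the subgames that no player fully wins. -/
def Q (G : ColouredMullerGame U C) : Set (Finset U) :=
  {X | G.IsSubgame X ∧ ∀ σ, ¬ (G.restrict X).FullyWins σ}

/-- The size `|G|` of the explicit representation: number of positions, plus number of edges,
plus total size of the listed sets of the winning conditions. -/
def size (G : ColouredMullerGame U C) : ℕ :=
  G.A.V.card + G.A.E.card + ∑ σ, ∑ S ∈ G.F σ, S.card

end ColouredMullerGame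

/-! ## Random access machines

A machine has registers and a random access memory; programs are built from the unit-cost
instructions of a RAM (constants, addition, truncated subtraction, indirect load and store) with
structured control flow. -/

/-- Programs. Arguments named `x y z` are registers. -/
inductive Prog where
  /-- do nothing -/
  | skip
  /-- `x := a` -/
  | const (x a : ℕ)
  /-- `x := y + z` -/
  | add (x y z : ℕ)
  /-- `x := y - z` (truncated) -/
  | sub (x y z : ℕ)
  /-- `x := mem[y]` -/
  | load (x y : ℕ)
  /-- `mem[x] := y` -/
  | store (x y : ℕ)
  /-- first `p`, then `q` -/
  | seq (p q : Prog)
  /-- if `x < y` then `p` else `q` -/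
  | ite (x y : ℕ) (p q : Prog)
  /-- while `x < y` do `p` -/
  | loop (x y : ℕ) (p : Prog)

/-- Contents of the registers and of the memory. -/
structure State where
  reg : ℕ → ℕ
  mem : ℕ → ℕ

/-- `Exec B p s s' t`: started in state `s`, the program `p` halts in state `s'` after `t` unit-cost
steps (instructions and tests), and it runs within space `B`: only memory cells with addresses
below `B` are read or written, and only numbers below `B` are ever computed or loaded. A run that
would exceed the bound has no derivation, so a program cannot take any advantage of `B`. -/
inductive Exec (B : ℕ) : Prog → State → State → ℕ → Prop where
  | skip (s : State) : Exec B .skip s s 1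
  | const (s : State) (x a : ℕ) (h : a < B) :
      Exec B (.const x a) s ⟨Function.update s.reg x a, s.mem⟩ 1
  | add (s : State) (x y z : ℕ) (h : s.reg y + s.reg z < B) :
      Exec B (.add x y z) s ⟨Function.update s.reg x (s.reg y + s.reg z), s.mem⟩ 1
  | sub (s : State) (x y z : ℕ) (h : s.reg y - s.reg z < B) :
      Exec B (.sub x y z) s ⟨Function.update s.reg x (s.reg y - s.reg z), s.mem⟩ 1
  | load (s : State) (x y : ℕ) (h : s.reg y < B) (h' : s.mem (s.reg y) < B) :
      Exec B (.load x y) s ⟨Function.update s.reg x (s.mem (s.reg y)), s.mem⟩ 1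
  | store (s : State) (x y : ℕ) (h : s.reg x < B) (h' : s.reg y < B) :
      Exec B (.store x y) s ⟨s.reg, Function.update s.mem (s.reg x) (s.reg y)⟩ 1
  | seq (p q : Prog) (s s' s'' : State) (t t' : ℕ)
      (hp : Exec B p s s' t) (hq : Exec B q s' s'' t') : Exec B (.seq p q) s s'' (t + t')
  | ite_true (x y : ℕ) (p q : Prog) (s s' : State) (t : ℕ) (h : s.reg x < s.reg y)
      (hp : Exec B p s s' t) : Exec B (.ite x y p q) s s' (1 + t)
  | ite_false (x y : ℕ) (p q : Prog) (s s' : State) (t : ℕ) (h : ¬ s.reg x < s.reg y)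
      (hq : Exec B q s s' t) : Exec B (.ite x y p q) s s' (1 + t)
  | loop_true (x y : ℕ) (p : Prog) (s s' s'' : State) (t t' : ℕ) (h : s.reg x < s.reg y)
      (hp : Exec B p s s' t) (hl : Exec B (.loop x y p) s' s'' t') :
      Exec B (.loop x y p) s s'' (1 + t + t')
  | loop_false (x y : ℕ) (p : Prog) (s : State) (h : ¬ s.reg x < s.reg y) :
      Exec B (.loop x y p) s s 1

/-- The initial state: the input word is in the cells `0, 1, …`; everything else is `0`. -/
def State.init (w : List ℕ) : State := ⟨fun _ => 0, fun i => w.getD i 0⟩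

/-! ## Presentation of games to machines

Positions are numbered `0, …, n - 1` and colours are numbered `0, …, k - 1`. -/

/-- `L` lists the members of `F` without repetition, each as a repetition-free list of colours. -/
def ListsFamily {k : ℕ} (L : List (List (Fin k))) (F : Finset (Finset (Fin k))) : Prop :=
  (∀ S ∈ L, S.Nodup) ∧ (L.map List.toFinset).Nodup ∧ (L.map List.toFinset).toFinset = F

/-- The word for a list of sets: the number of sets, then for each set its size and its members. -/
def familyWord {k : ℕ} (L : List (List (Fin k))) : List ℕ :=
  L.length :: L.flatMap fun S => S.length :: S.map Fin.val

/-- `w` is an explicit presentation of `G`: the numbers of positions, of colours and of edges; the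
owner of each position; the colour of each position; the edges, in any order; the members of `F 0`,
in any order; the members of `F 1`, in any order. -/
def IsPresentation {n k : ℕ} (G : ColouredMullerGame (Fin n) (Fin k)) (w : List ℕ) : Prop :=
  ∃ (edges : List (Fin n × Fin n)) (L₀ L₁ : List (List (Fin k))),
    edges.Nodup ∧ edges.toFinset = G.A.E ∧ ListsFamily L₀ (G.F 0) ∧ ListsFamily L₁ (G.F 1) ∧
    w = [n, k, edges.length] ++
      (List.finRange n).map (fun v => if v ∈ G.A.pos 1 then 1 else 0) ++
      (List.finRange n).map (fun v => (G.c v : ℕ)) ++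
      edges.flatMap (fun e => [(e.1 : ℕ), (e.2 : ℕ)]) ++
      familyWord L₀ ++ familyWord L₁

/-- The number whose `j`-th binary digit is `1` if and only if `j ∈ X`. -/
def code {n : ℕ} (X : Finset (Fin n)) : ℕ := ∑ j ∈ X, 2 ^ (j : ℕ)

/-- The output at address `b` is the partition of the positions into the winning regions: the cell
of each position holds the player who wins from there. -/
def OutputsWinners {n k : ℕ} (G : ColouredMullerGame (Fin n) (Fin k)) (s : State) (b : ℕ) : Prop :=
  ∀ v : Fin n, (s.mem (b + v) = 0 ∨ s.mem (b + v) = 1) ∧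
    ∀ σ : Fin 2, v ∈ G.Win σ ↔ s.mem (b + v) = σ

/-- The output at address `b` is the partition of the subgames: the cell of each nonempty set `X` of
positions holds `0`, `1` or `2` according to whether `X` is in `P 0`, in `P 1` or in `Q`
(and something else if `X` does not determine a subgame). -/
def OutputsPartition {n k : ℕ} (G : ColouredMullerGame (Fin n) (Fin k)) (s : State) (b : ℕ) :
    Prop :=
  ∀ X : Finset (Fin n), X.Nonempty →
    (∀ σ : Fin 2, X ∈ G.P σ ↔ s.mem (b + code X) = σ) ∧ (X ∈ G.Q ↔ s.mem (b + code X) = 2)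

end RegularGames

open RegularGames

/-!
The winning regions of the subgames `G(X)` are computed by dynamic programming over all sets `X` of
positions, in the order of their numbers `code X`; proper subsets of `X` have smaller numbers, so
their results are available in a table when `X` is treated.

The recursion is a variant of Zielonka's. Let Player `σ` be the one who likes the set of all
colours of `X`. For each `v ∈ X`, remove from `X` the attractor of `{v}` for Player `σ`.

* If the opponent wins nowhere in any of the remaining subgames, then Player `σ` wins `G(X)` from
  everywhere, by aiming at all positions in turn: either all positions are visited infinitely
  often, or the play finally stays in one of the remaining subgames
  (`PseudoArena.Enforces.cycle`, `ColouredMullerGame.winSet_eq_self_of_forall`).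
* Otherwise, let `T` be a nonempty winning region of the opponent in one of the remaining subgames.
  The opponent wins `G(X)` from `T`, and the winning region of Player `σ` in `G(X)` is that in the
  subgame without the attractor `Z` of `T` for the opponent (`ColouredMullerGame.winSet_eq_sdiff`).

In both cases the answer is found in the table. There are at most `n + 1` attractor computations
for each of the `2 ^ n` sets, each by a breadth-first search in linear time; as `n ≤ |E|`, this
gives `O(2 ^ n * n * |E|)` steps. Since the regions are represented by their numbers, a constant
number of tables with `2 ^ n` entries suffices. The same induction yields determinacy
(`ColouredMullerGame.mem_Win_or`). That the winning region of Player `0` is the largest trap for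
Player `1` which Player `0` fully wins is shown directly by manipulation of strategies
(`ColouredMullerGame.exists_isGreatest_trap`).

The algorithm is written in a small language with variables and arrays (`Cmd`). Its programs are
verified by weakest preconditions (`Cmd.wp`) that also count the steps, and `Cmd.exec_compile`
transfers the result to the random access machine with a constant factor in time. The memory is
divided into `15` blocks of equal length, one for each array; since the length of the blocks has to
be computed from the input first, the program begins with a phase in which the whole memory
is regarded as a single array (`wp_initialise`, `exec_setBases`). The parts of the main phase are
the preparation of tables (`wp_sortEdges`, `wp_tabulateFamily`), the attractors (`wp_attract`), and
the recursion (`wp_testAll`, `wp_finish`, `wp_solveAll`).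
-/

namespace RegularGames

/-! ### Switching between strategies -/

namespace PseudoArena

section Switching

variable {U : Type} {A : PseudoArena U} {σ : Fin 2}

open Classical in
/-- The index of the current stage and the time at which it began, when the stage `j` ends as soon
as the play enters `T j` after the beginning of the stage. -/
noncomputable def stage (T : ℕ → Set U) (ρ : ℕ → U) : ℕ → ℕ × ℕ
  | 0 => (0, 0)
  | i + 1 => if ρ (i + 1) ∈ T (stage T ρ i).1 then ((stage T ρ i).1 + 1, i + 1) else stage T ρ i

open Classical in
/-- The memory `m` holds the stage and the positions visited in this stage before the current
position `v`; if `v` ends the stage, then a new stage begins at `v`. -/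
noncomputable def resolveStage (T : ℕ → Set U) (m : ℕ × List U) (v : U) : ℕ × List U :=
  if m.2 ≠ [] ∧ v ∈ T m.1 then (m.1 + 1, []) else m

/-- The stage and the positions visited in this stage, after the positions `past`. -/
noncomputable def stageMemory (T : ℕ → Set U) (past : List U) : ℕ × List U :=
  past.foldl (fun m v => ((resolveStage T m v).1, (resolveStage T m v).2 ++ [v])) (0, [])

/-- Plays `C j u` in the stage `j` if this stage began at the position `u`. -/
noncomputable def switchStrategy (T : ℕ → Set U) (C : ℕ → U → List U → U → U)
    (past : List U) (v : U) : U :=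
  let r := resolveStage T (stageMemory T past) v
  C r.1 (r.2.headD v) r.2 v

theorem stage_snd_le (T : ℕ → Set U) (ρ : ℕ → U) (i : ℕ) : (stage T ρ i).2 ≤ i := by
  induction i with
  | zero => simp [stage]
  | succ i ih =>
    rw [stage]
    split_ifs
    · exact le_rfl
    · exact ih.trans (Nat.le_succ i)

/-- The strategy can determine the current stage from the past. -/
theorem resolveStage_stageMemory (T : ℕ → Set U) (ρ : ℕ → U) (i : ℕ) :
    resolveStage T (stageMemory T ((List.range i).map ρ)) (ρ i) =
      ((stage T ρ i).1, (List.range (i - (stage T ρ i).2)).map fun t => ρ ((stage T ρ i).2 + t)) := by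
  induction i with
  | zero => simp [stageMemory, resolveStage, stage]
  | succ i ih =>
    have hle := stage_snd_le T ρ i
    have hm : stageMemory T ((List.range (i + 1)).map ρ) = ((stage T ρ i).1,
        (List.range (i + 1 - (stage T ρ i).2)).map fun t => ρ ((stage T ρ i).2 + t)) := by
      rw [List.range_succ, List.map_append, stageMemory, List.foldl_append]
      change ((resolveStage T (stageMemory T ((List.range i).map ρ)) (ρ i)).1,
        (resolveStage T (stageMemory T ((List.range i).map ρ)) (ρ i)).2 ++ [ρ i]) = _
      rw [ih, Nat.sub_add_comm hle, List.range_succ]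
      simp [Nat.add_sub_cancel' hle]
    rw [hm, resolveStage]
    have hne : (List.range (i + 1 - (stage T ρ i).2)).map
        (fun t => ρ ((stage T ρ i).2 + t)) ≠ [] := by
      simp; omega
    by_cases hT : ρ (i + 1) ∈ T (stage T ρ i).1
    · rw [if_pos ⟨hne, hT⟩, stage, if_pos hT]
      simp
    · rw [if_neg fun h => hT h.2, stage, if_neg hT]

theorem switchStrategy_play (T : ℕ → Set U) (C : ℕ → U → List U → U → U) (ρ : ℕ → U) (i : ℕ) :
    switchStrategy T C ((List.range i).map ρ) (ρ i) =
      C (stage T ρ i).1 (ρ (stage T ρ i).2)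
        ((List.range (i - (stage T ρ i).2)).map fun t => ρ ((stage T ρ i).2 + t)) (ρ i) := by
  have hle := stage_snd_le T ρ i
  simp only [switchStrategy, resolveStage_stageMemory]
  congr 1
  rcases Nat.eq_zero_or_pos (i - (stage T ρ i).2) with h | h
  · have : (stage T ρ i).2 = i := by omega
    simp [this]
  · obtain ⟨k, hk⟩ := Nat.exists_eq_succ_of_ne_zero h.ne'
    simp [hk, List.range_succ_eq_map]

theorem stage_mono (T : ℕ → Set U) (ρ : ℕ → U) : Monotone fun i => (stage T ρ i).1 := by
  refine monotone_nat_of_le_succ fun i => ?_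
  simp only [stage]
  split_ifs <;> simp

/-- A play of the switching strategy either stays in some stage for ever, or passes through all
stages. -/
theorem switchStrategy_outcome (T : ℕ → Set U) (C : ℕ → U → List U → U → U) {ρ : ℕ → U}
    (hρ : A.Consistent σ (switchStrategy T C) ρ) :
    (∃ j a, (j = 0 ∧ a = 0 ∨ ∃ j', j = j' + 1 ∧ ρ a ∈ T j') ∧
      A.Consistent σ (C j (ρ a)) (fun i => ρ (a + i)) ∧ ∀ i > 0, ρ (a + i) ∉ T j) ∨
    ∃ f : ℕ → ℕ, StrictMono f ∧ ∀ j, ρ (f (j + 1)) ∈ T j := by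
  classical
  have start : ∀ j, (h : ∃ i, (stage T ρ i).1 = j) → (stage T ρ (Nat.find h)).2 = Nat.find h ∧
      (j = 0 ∧ Nat.find h = 0 ∨ ∃ j', j = j' + 1 ∧ ρ (Nat.find h) ∈ T j') := by
    intro j h
    have hs := Nat.find_spec h
    rcases hi : Nat.find h with _ | i
    · rw [hi] at hs
      simp only [stage] at hs ⊢
      exact ⟨trivial, Or.inl ⟨hs.symm, trivial⟩⟩
    · have hmin := Nat.find_min h (m := i) (by omega)
      rw [hi] at hs
      simp only [stage] at hs ⊢
      split_ifs at hs ⊢ with hT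
      · exact ⟨rfl, Or.inr ⟨_, hs.symm, hT⟩⟩
      · exact absurd hs hmin
  by_cases hall : ∀ j, ∃ i, (stage T ρ i).1 = j
  · right
    refine ⟨fun j => Nat.find (hall j), strictMono_nat_of_lt_succ fun j => ?_, fun j => ?_⟩
    · by_contra hlt
      have := stage_mono T ρ (not_lt.1 hlt)
      simp only [Nat.find_spec (hall j), Nat.find_spec (hall (j + 1))] at this
      omega
    · obtain ⟨-, h | ⟨j', h, h'⟩⟩ := start (j + 1) (hall (j + 1))
      · omega
      · obtain rfl : j = j' := by omega
        exact h'
  · left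
    push Not at hall
    have hb : ∃ j, (∃ i, (stage T ρ i).1 = j) ∧ ∀ i, (stage T ρ i).1 ≠ j + 1 := by
      by_contra hcon
      push Not at hcon
      obtain ⟨j, hj⟩ := hall
      have : ∀ j, ∃ i, (stage T ρ i).1 = j := by
        intro j
        induction j with
        | zero => exact ⟨0, rfl⟩
        | succ j ih =>
          obtain ⟨i, hi⟩ := ih
          exact hcon j ⟨i, hi⟩
      obtain ⟨i, hi⟩ := this j
      exact hj i hi
    obtain ⟨j, hj, hjn⟩ := hb
    obtain ⟨h1, h2⟩ := start j hj
    have hspec := Nat.find_spec hj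
    set a := Nat.find hj
    have hconst : ∀ i, stage T ρ (a + i) = (j, a) := by
      intro i
      induction i with
      | zero => exact Prod.ext hspec h1
      | succ i ih =>
        have hn := hjn (a + (i + 1))
        rw [← add_assoc] at hn ⊢
        rw [stage, ih] at hn ⊢
        split_ifs at hn ⊢ with hT
        · simp at hn
        · rfl
    refine ⟨j, a, h2, fun i hi => ?_, fun i hi hT => ?_⟩
    · have := hρ (a + i) hi
      rw [switchStrategy_play, hconst] at this
      simpa [add_assoc] using this
    · obtain ⟨i, rfl⟩ : ∃ i', i = i' + 1 := ⟨i - 1, by omega⟩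
      have hn := hjn (a + (i + 1))
      rw [← add_assoc] at hn hT
      rw [stage, hconst] at hn
      simp [hT] at hn

theorem isStrategy_switchStrategy (T : ℕ → Set U) {C : ℕ → U → List U → U → U}
    (hC : ∀ j u, A.IsStrategy σ (C j u)) : A.IsStrategy σ (switchStrategy T C) :=
  fun _ v hv => hC _ _ _ v hv

end Switching

/-! ### Enforcing properties of plays -/

variable {U : Type} [DecidableEq U] {A : PseudoArena U} {σ : Fin 2}

theorem mem_V_iff (σ : Fin 2) {v : U} : v ∈ A.V ↔ v ∈ A.pos σ ∨ v ∈ A.pos (1 - σ) := by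
  fin_cases σ <;> simp [V, or_comm]

theorem mem_V_of_mem_pos {v : U} (h : v ∈ A.pos σ) : v ∈ A.V := (mem_V_iff σ).2 (Or.inl h)

theorem IsArena.notMem_opponent (hA : A.IsArena) {v : U} (h : v ∈ A.pos σ) :
    v ∉ A.pos (1 - σ) := by
  have := Finset.disjoint_left.1 hA.1
  have h' := Finset.disjoint_right.1 hA.1
  fin_cases σ
  · exact this h
  · exact h' h

theorem IsArena.edge_mem (hA : A.IsArena) {u v : U} (h : (u, v) ∈ A.E) : u ∈ A.V ∧ v ∈ A.V := by
  have := hA.2.1 h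
  simp only [Finset.mem_union, Finset.mem_product] at this
  simp only [V, Finset.mem_union]
  tauto

theorem IsArena.edge_ne (hA : A.IsArena) {u v : U} (h : (u, v) ∈ A.E) : u ≠ v := by
  rintro rfl
  have := hA.2.1 h
  simp only [Finset.mem_union, Finset.mem_product] at this
  have h1 : u ∈ A.pos 0 → u ∉ A.pos 1 := fun h => Finset.disjoint_left.1 hA.1 h
  tauto

theorem IsArena.edge_pos (hA : A.IsArena) {u v : U} (h : (u, v) ∈ A.E) (hu : u ∈ A.pos σ) :
    v ∈ A.pos (1 - σ) := by
  have := hA.2.1 h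
  simp only [Finset.mem_union, Finset.mem_product] at this
  have h1 : u ∈ A.pos 0 → u ∉ A.pos 1 := fun h => Finset.disjoint_left.1 hA.1 h
  fin_cases σ
  · change u ∈ A.pos 0 at hu
    change v ∈ A.pos 1
    tauto
  · change u ∈ A.pos 1 at hu
    change v ∈ A.pos 0
    tauto

theorem IsArena.exists_strategy (hA : A.IsArena) :
    ∃ d : U → U, ∀ v ∈ A.V, (v, d v) ∈ A.E := by
  classical
  choose! d hd using hA.2.2
  exact ⟨d, hd⟩

/-- From the position `v`, Player `σ` has a strategy all of whose plays have the property `Φ`. -/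
def Enforces (A : PseudoArena U) (σ : Fin 2) (v : U) (Φ : (ℕ → U) → Prop) : Prop :=
  v ∈ A.V ∧ ∃ s, A.IsStrategy σ s ∧ ∀ ρ, A.IsPlay v ρ → A.Consistent σ s ρ → Φ ρ

theorem Enforces.mono {v : U} {Φ Ψ : (ℕ → U) → Prop} (h : A.Enforces σ v Φ)
    (hΦ : ∀ ρ, A.IsPlay v ρ → Φ ρ → Ψ ρ) : A.Enforces σ v Ψ := by
  obtain ⟨hv, s, hs, h⟩ := h
  exact ⟨hv, s, hs, fun ρ hρ hc => hΦ ρ hρ (h ρ hρ hc)⟩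

theorem IsPlay.mem (hA : A.IsArena) {v : U} {ρ : ℕ → U} (h : A.IsPlay v ρ) (i : ℕ) :
    ρ i ∈ A.V := (hA.edge_mem (h.2.2 i)).1

theorem IsPlay.shift (hA : A.IsArena) {v : U} {ρ : ℕ → U} (h : A.IsPlay v ρ) (a : ℕ) :
    A.IsPlay (ρ a) (fun i => ρ (a + i)) :=
  ⟨h.mem hA a, rfl, fun i => h.2.2 (a + i)⟩

/-- Sequential composition: enforce a visit to `T`, and then enforce `Ψ`. -/
theorem Enforces.seq (hA : A.IsArena) {v : U} {Φ Ψ : (ℕ → U) → Prop} {T : Set U}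
    (hshift : ∀ ρ a, Ψ (fun i => ρ (a + i)) → Ψ ρ) (h : A.Enforces σ v Φ)
    (hΦ : ∀ ρ, A.IsPlay v ρ → Φ ρ → Ψ ρ ∨ ∃ i, ρ i ∈ T) (hT : ∀ u ∈ T, A.Enforces σ u Ψ) :
    A.Enforces σ v Ψ := by
  classical
  by_cases hvT : v ∈ T
  · exact hT v hvT
  obtain ⟨d, hd⟩ := hA.exists_strategy
  obtain ⟨hv, s, hs, hsΦ⟩ := h
  have hT' : ∀ u, ∃ s', A.IsStrategy σ s' ∧
      (u ∈ T → ∀ ρ, A.IsPlay u ρ → A.Consistent σ s' ρ → Ψ ρ) := by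
    intro u
    by_cases hu : u ∈ T
    · obtain ⟨-, s', hs', h'⟩ := hT u hu
      exact ⟨s', hs', fun _ => h'⟩
    · exact ⟨fun _ v => d v, fun _ v hv => hd v (mem_V_of_mem_pos hv), fun h => absurd h hu⟩
  choose s' hs' hs'Ψ using hT'
  let C : ℕ → U → List U → U → U := fun j u => if j = 0 then s else s' u
  let T' : ℕ → Set U := fun j => if j = 0 then T else ∅
  have hC : ∀ j u, A.IsStrategy σ (C j u) := by
    intro j u
    by_cases hj : j = 0
    · simpa [C, hj] using hs
    · simpa [C, hj] using hs' u
  refine ⟨hv, switchStrategy T' C, isStrategy_switchStrategy T' hC, fun ρ hρ hcons => ?_⟩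
  rcases switchStrategy_outcome T' C hcons with ⟨j, a, hja, hc, hno⟩ | ⟨f, -, hf⟩
  · rcases hja with ⟨rfl, rfl⟩ | ⟨j', rfl, ha⟩
    · simp only [zero_add] at hc hno
      rcases hΦ ρ hρ (hsΦ ρ hρ (by simpa [C] using hc)) with h | ⟨i, hi⟩
      · exact h
      · rcases Nat.eq_zero_or_pos i with rfl | hi0
        · rw [hρ.2.1] at hi
          exact absurd hi hvT
        · exact absurd (by simpa [T'] using hi) (hno i hi0)
    · by_cases hj' : j' = 0
      · subst hj'
        have hc' : A.Consistent σ (s' (ρ a)) (fun i => ρ (a + i)) := by simpa [C] using hc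
        exact hshift ρ a (hs'Ψ _ (by simpa [T'] using ha) _ (hρ.shift hA a) hc')
      · simp [T', hj'] at ha
  · simpa [T'] using hf 1

/-- If Player `σ` can, from everywhere and for every position `u`, enforce `Ψ` or a visit to `u`,
and the plays that visit all positions infinitely often satisfy `Ψ`, then Player `σ` can enforce
`Ψ` by aiming at all positions in turn. -/
theorem Enforces.cycle (hA : A.IsArena) {Ψ : (ℕ → U) → Prop}
    (hshift : ∀ ρ a, Ψ (fun i => ρ (a + i)) → Ψ ρ)
    (h : ∀ v ∈ A.V, ∀ u ∈ A.V, A.Enforces σ v fun ρ => Ψ ρ ∨ ∃ i, ρ i = u)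
    (hall : ∀ v ρ, A.IsPlay v ρ → infinitySet ρ = A.V → Ψ ρ) {v : U} (hv : v ∈ A.V) :
    A.Enforces σ v Ψ := by
  classical
  -- An enumeration `e` of the positions; consecutive targets are distinct, as there are at least
  -- two positions.
  set N := A.V.card with hN
  let e : Fin N ≃ A.V := A.V.equivFin.symm
  have hN2 : 1 < N := by
    obtain ⟨u, hu⟩ := hA.2.2 v hv
    exact Finset.one_lt_card.2 ⟨v, hv, u, (hA.edge_mem hu).2, hA.edge_ne hu⟩
  let g : ℕ → U := fun j => e ⟨j % N, Nat.mod_lt _ (by omega)⟩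
  have hgV : ∀ j, g j ∈ A.V := fun j => (e _).2
  have hg : ∀ j, g j ≠ g (j + 1) := by
    intro j hj
    have := e.injective (Subtype.ext hj)
    simp only [Fin.mk.injEq] at this
    have h2 : (j + 1) % N = j % N := this.symm
    have h3 : (j + 1) ≡ j + 0 [MOD N] := h2
    have h4 : 1 ≡ 0 [MOD N] := Nat.ModEq.add_left_cancel' j h3
    have h5 : N ∣ 1 := (Nat.modEq_zero_iff_dvd).1 h4
    have := Nat.le_of_dvd one_pos h5
    omega
  have key : A.Enforces σ (g 0) Ψ := by
    choose! s hs hsΨ using fun j => (h (g j) (hgV j) (g (j + 1)) (hgV (j + 1))).2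
    let C : ℕ → U → List U → U → U := fun j _ => s j
    let T : ℕ → Set U := fun j => {g (j + 1)}
    refine ⟨hgV 0, switchStrategy T C, isStrategy_switchStrategy T fun j _ => hs j,
      fun ρ hρ hcons => ?_⟩
    rcases switchStrategy_outcome T C hcons with ⟨j, a, hja, hc, hno⟩ | ⟨f, hfm, hf⟩
    · have ha : ρ a = g j := by
        rcases hja with ⟨rfl, rfl⟩ | ⟨j', rfl, ha⟩
        · exact hρ.2.1
        · exact ha
      have hp := hρ.shift hA a
      rw [ha] at hp
      rcases hsΨ j _ hp hc with h | ⟨i, hi⟩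
      · exact hshift ρ a h
      · rcases Nat.eq_zero_or_pos i with rfl | hi0
        · exact absurd (ha.symm.trans hi) (hg j)
        · exact absurd hi (hno i hi0)
    · refine hall _ ρ hρ (Set.ext fun u => ⟨fun hu => ?_, fun hu => ?_⟩)
      · obtain ⟨i, hi⟩ := hu.nonempty
        rw [← hi]
        exact hρ.mem hA i
      · have hinj : Function.Injective fun q : ℕ => f ((e.symm ⟨u, hu⟩ : ℕ) + N * (q + 1)) := by
          refine hfm.injective.comp fun a b hab => ?_
          have := Nat.eq_of_mul_eq_mul_left (by omega : 0 < N) (Nat.add_left_cancel hab)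
          omega
        refine Set.Infinite.mono ?_ (Set.infinite_range_of_injective hinj)
        rintro _ ⟨q, rfl⟩
        have hpos : (e.symm ⟨u, hu⟩ : ℕ) + N * (q + 1) =
            ((e.symm ⟨u, hu⟩ : ℕ) + N * (q + 1) - 1) + 1 := by
          have : 0 < N * (q + 1) := by positivity
          omega
        have h1 := hf ((e.symm ⟨u, hu⟩ : ℕ) + N * (q + 1) - 1)
        simp only [T, Set.mem_singleton_iff] at h1
        rw [← hpos] at h1
        change ρ _ = u
        rw [h1]
        simp only [g]
        have hmod : ((e.symm ⟨u, hu⟩ : ℕ) + N * (q + 1)) % N = e.symm ⟨u, hu⟩ := by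
          rw [Nat.add_mul_mod_self_left, Nat.mod_eq_of_lt (e.symm ⟨u, hu⟩).2]
        simp only [hmod, Fin.eta, Equiv.apply_symm_apply]
  refine Enforces.seq hA (T := {g 0}) hshift (h v hv (g 0) (hgV 0)) (fun ρ _ h => h) ?_
  rintro u rfl
  exact key

/-! ### Subarenas and attractors -/

theorem V_restrict (X : Finset U) : (A.restrict X).V = A.V ∩ X := by
  simp [V, restrict, Finset.union_inter_distrib_right]

theorem restrict_restrict {X Y : Finset U} (h : Y ⊆ X) :
    (A.restrict X).restrict Y = A.restrict Y := by
  simp only [restrict, PseudoArena.mk.injEq]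
  refine ⟨funext fun σ => by rw [Finset.inter_assoc, Finset.inter_eq_right.2 h], ?_⟩
  rw [Finset.inter_assoc, Finset.inter_eq_right.2 (Finset.product_subset_product h h)]

theorem restrict_V (hA : A.IsArena) : A.restrict A.V = A := by
  cases A with
  | mk pos E =>
    simp only [restrict, PseudoArena.mk.injEq]
    refine ⟨funext fun σ => Finset.inter_eq_left.2 fun v hv => mem_V_of_mem_pos hv, ?_⟩
    refine Finset.inter_eq_left.2 ?_
    rintro ⟨u, v⟩ he
    exact Finset.mem_product.2 (hA.edge_mem he)

theorem mem_pos_restrict {X : Finset U} {v : U} :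
    v ∈ (A.restrict X).pos σ ↔ v ∈ A.pos σ ∧ v ∈ X := by simp [restrict]

theorem mem_E_restrict {X : Finset U} {u v : U} :
    (u, v) ∈ (A.restrict X).E ↔ (u, v) ∈ A.E ∧ u ∈ X ∧ v ∈ X := by simp [restrict]

theorem IsArena.restrict (hA : A.IsArena) {X : Finset U}
    (h : ∀ v ∈ A.V, v ∈ X → ∃ u ∈ X, (v, u) ∈ A.E) : (A.restrict X).IsArena := by
  refine ⟨?_, ?_, ?_⟩
  · exact hA.1.mono Finset.inter_subset_left Finset.inter_subset_left
  · rintro ⟨u, v⟩ he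
    rw [mem_E_restrict] at he
    have := hA.2.1 he.1
    simp only [Finset.mem_union, Finset.mem_product, mem_pos_restrict] at this ⊢
    tauto
  · intro v hv
    rw [V_restrict, Finset.mem_inter] at hv
    obtain ⟨u, hu, he⟩ := h v hv.1 hv.2
    exact ⟨u, mem_E_restrict.2 ⟨he, hv.2, hu⟩⟩

/-- A strategy for a subarena can be played in the whole arena, until the opponent leaves the
subarena. -/
theorem Enforces.of_restrict (hA : A.IsArena) {X : Finset U} {v : U} {Φ : (ℕ → U) → Prop}
    (h : (A.restrict X).Enforces σ v Φ) :
    A.Enforces σ v fun ρ => Φ ρ ∨ ∃ i, ρ i ∈ X ∧ ρ i ∈ A.pos (1 - σ) ∧ ρ (i + 1) ∉ X := by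
  classical
  obtain ⟨hv, s, hs, h⟩ := h
  rw [V_restrict, Finset.mem_inter] at hv
  obtain ⟨d, hd⟩ := hA.exists_strategy
  let s' : List U → U → U := fun past u => if u ∈ X then s past u else d u
  refine ⟨hv.1, s', fun past u hu => ?_, fun ρ hρ hc => ?_⟩
  · by_cases huX : u ∈ X
    · simp only [s', huX, if_true]
      exact (mem_E_restrict.1 (hs past u (mem_pos_restrict.2 ⟨hu, huX⟩))).1
    · simp only [s', huX, if_false]
      exact hd u (mem_V_of_mem_pos hu)
  · by_contra hcon
    push Not at hcon
    obtain ⟨hΦ, hex⟩ := hcon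
    have hmove : ∀ i, ρ i ∈ X → ρ i ∈ A.pos σ →
        ρ (i + 1) = s ((List.range i).map ρ) (ρ i) := by
      intro i hX hσ
      rw [hc i hσ]
      simp [s', hX]
    have hin : ∀ i, ρ i ∈ X := by
      intro i
      induction i with
      | zero => rw [hρ.2.1]; exact hv.2
      | succ i ih =>
        rcases (mem_V_iff σ).1 (hρ.mem hA i) with hi | hi
        · rw [hmove i ih hi]
          exact (mem_E_restrict.1 (hs _ _ (mem_pos_restrict.2 ⟨hi, ih⟩))).2.2
        · exact hex i ih hi
    refine hΦ (h ρ ⟨?_, hρ.2.1, fun i => mem_E_restrict.2 ⟨hρ.2.2 i, hin _, hin _⟩⟩ ?_)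
    · rw [V_restrict]; exact Finset.mem_inter.2 hv
    · exact fun i hi => hmove i (hin i) (mem_pos_restrict.1 hi).1

/-- `Y` consists of `T` and of positions from which Player `σ` can enforce a visit to `T` (as the
ranks show), and from outside `Y` Player `σ` cannot enforce a visit to `Y`. -/
structure IsAttractor (A : PseudoArena U) (σ : Fin 2) (T Y : Finset U) : Prop where
  subset : T ⊆ Y
  subset_V : Y ⊆ A.V
  rank : ∃ r : U → ℕ, ∀ u ∈ Y, u ∉ T →
    (u ∈ A.pos σ → ∃ y ∈ Y, (u, y) ∈ A.E ∧ r y < r u) ∧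
    (u ∈ A.pos (1 - σ) → ∀ y, (u, y) ∈ A.E → y ∈ Y ∧ r y < r u)
  closed_own : ∀ u ∈ A.pos σ, u ∉ Y → ∀ y, (u, y) ∈ A.E → y ∉ Y
  closed_opponent : ∀ u ∈ A.pos (1 - σ), u ∉ Y → ∃ y, (u, y) ∈ A.E ∧ y ∉ Y

theorem IsAttractor.enforces (hA : A.IsArena) {T Y : Finset U} (hY : A.IsAttractor σ T Y) {v : U}
    (hv : v ∈ Y) : A.Enforces σ v fun ρ => ∃ i, ρ i ∈ (T : Set U) := by
  classical
  obtain ⟨d, hd⟩ := hA.exists_strategy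
  obtain ⟨r, hr⟩ := hY.rank
  have hm : ∀ u, ∃ w, (u ∈ A.V → (u, w) ∈ A.E) ∧
      (u ∈ Y → u ∉ T → u ∈ A.pos σ → w ∈ Y ∧ r w < r u) := by
    intro u
    by_cases hu : u ∈ Y ∧ u ∉ T ∧ u ∈ A.pos σ
    · obtain ⟨w, hw, he, hlt⟩ := (hr u hu.1 hu.2.1).1 hu.2.2
      exact ⟨w, fun _ => he, fun _ _ _ => ⟨hw, hlt⟩⟩
    · exact ⟨d u, hd u, fun h1 h2 h3 => absurd ⟨h1, h2, h3⟩ hu⟩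
  choose m hmE hmr using hm
  refine ⟨hY.subset_V hv, fun _ u => m u, fun _ u hu => hmE u (mem_V_of_mem_pos hu),
    fun ρ hρ hc => ?_⟩
  have key : ∀ k i, ρ i ∈ Y → r (ρ i) = k → ∃ i, ρ i ∈ T := by
    intro k
    induction k using Nat.strong_induction_on with
    | _ k ih =>
      intro i hi hk
      by_cases hT : ρ i ∈ T
      · exact ⟨i, hT⟩
      have : ρ (i + 1) ∈ Y ∧ r (ρ (i + 1)) < r (ρ i) := by
        rcases (mem_V_iff σ).1 (hρ.mem hA i) with hp | hp
        · rw [hc i hp]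
          exact hmr _ hi hT hp
        · exact (hr _ hi hT).2 hp _ (hρ.2.2 i)
      exact ih _ (hk ▸ this.2) (i + 1) this.1 rfl
  exact key _ 0 (hρ.2.1 ▸ hv) rfl

theorem IsAttractor.isArena_restrict (hA : A.IsArena) {T Y : Finset U}
    (hY : A.IsAttractor σ T Y) : (A.restrict (A.V \ Y)).IsArena := by
  refine hA.restrict fun v hv hvX => ?_
  rw [Finset.mem_sdiff] at hvX
  rcases (mem_V_iff σ).1 hv with hp | hp
  · obtain ⟨u, hu⟩ := hA.2.2 v hv
    exact ⟨u, Finset.mem_sdiff.2 ⟨(hA.edge_mem hu).2, hY.closed_own v hp hvX.2 u hu⟩, hu⟩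
  · obtain ⟨u, hu, hn⟩ := hY.closed_opponent v hp hvX.2
    exact ⟨u, Finset.mem_sdiff.2 ⟨(hA.edge_mem hu).2, hn⟩, hu⟩

/-- A maximal set with suitable ranks is an attractor. -/
theorem exists_isAttractor (σ : Fin 2) {T : Finset U} (hT : T ⊆ A.V) (hA : A.IsArena) :
    ∃ Y, A.IsAttractor σ T Y := by
  classical
  let S : Finset (Finset U) := A.V.powerset.filter fun Y => T ⊆ Y ∧
    ∃ r : U → ℕ, ∀ u ∈ Y, u ∉ T →
      (u ∈ A.pos σ → ∃ y ∈ Y, (u, y) ∈ A.E ∧ r y < r u) ∧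
      (u ∈ A.pos (1 - σ) → ∀ y, (u, y) ∈ A.E → y ∈ Y ∧ r y < r u)
  have hS : S.Nonempty := ⟨T, by
    simp only [S, Finset.mem_filter, Finset.mem_powerset]
    exact ⟨hT, subset_rfl, fun _ => 0, fun u hu hn => absurd hu hn⟩⟩
  obtain ⟨Y, hYS, hmax⟩ := S.exists_max_image Finset.card hS
  simp only [S, Finset.mem_filter, Finset.mem_powerset] at hYS hmax
  obtain ⟨hYV, hTY, r, hr⟩ := hYS
  have hext : ∀ u ∈ A.V, u ∉ Y → (u ∈ A.pos σ → ∃ y ∈ Y, (u, y) ∈ A.E) →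
      (u ∈ A.pos (1 - σ) → ∀ y, (u, y) ∈ A.E → y ∈ Y) → False := by
    intro u huV huY h1 h2
    have hle := hmax (insert u Y) ⟨Finset.insert_subset huV hYV,
      hTY.trans (Finset.subset_insert _ _), Function.update r u (Y.sup r + 1), ?_⟩
    · rw [Finset.card_insert_of_notMem huY] at hle
      omega
    have hne : ∀ y ∈ Y, y ≠ u := fun y hy h => huY (h ▸ hy)
    have hsup : ∀ y ∈ Y, r y < Y.sup r + 1 := fun y hy => Nat.lt_succ_of_le (Finset.le_sup hy)
    intro w hw hwT
    rcases Finset.mem_insert.1 hw with rfl | hwY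
    · refine ⟨fun hp => ?_, fun hp y hy => ?_⟩
      · obtain ⟨y, hy, he⟩ := h1 hp
        exact ⟨y, Finset.mem_insert_of_mem hy, he, by
          simpa [Function.update_of_ne (hne y hy)] using Finset.le_sup hy⟩
      · have hyY := h2 hp y hy
        exact ⟨Finset.mem_insert_of_mem hyY, by
          simpa [Function.update_of_ne (hne y hyY)] using Finset.le_sup hyY⟩
    · refine ⟨fun hp => ?_, fun hp y hy => ?_⟩
      · obtain ⟨y, hy, he, hlt⟩ := (hr w hwY hwT).1 hp
        exact ⟨y, Finset.mem_insert_of_mem hy, he, by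
          simpa [Function.update_of_ne (hne y hy), Function.update_of_ne (hne w hwY)] using hlt⟩
      · obtain ⟨hyY, hlt⟩ := (hr w hwY hwT).2 hp y hy
        exact ⟨Finset.mem_insert_of_mem hyY, by
          simpa [Function.update_of_ne (hne y hyY), Function.update_of_ne (hne w hwY)] using hlt⟩
  refine ⟨Y, hTY, hYV, ⟨r, hr⟩, fun u hu huY y he hy => ?_, fun u hu huY => ?_⟩
  · exact hext u (mem_V_of_mem_pos hu) huY (fun _ => ⟨y, hy, he⟩)
      fun h => absurd h (hA.notMem_opponent hu)
  · by_contra hcon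
    push Not at hcon
    exact hext u ((mem_V_iff σ).2 (Or.inr hu)) huY
      (fun h => absurd hu (hA.notMem_opponent h)) fun _ => hcon

end PseudoArena

/-! ### Winning regions -/

section InfinitySet

variable {U : Type}

theorem infinitySet_shift (ρ : ℕ → U) (a : ℕ) :
    infinitySet (fun i => ρ (a + i)) = infinitySet ρ := by
  ext v
  simp only [infinitySet, Set.mem_ofPred_eq]
  constructor
  · intro h
    refine (h.image (f := fun i => a + i) (add_right_injective a).injOn).mono ?_
    rintro _ ⟨i, hi, rfl⟩
    exact hi
  · intro h hfin
    refine h (((hfin.image fun i => a + i).union (Set.finite_lt_nat a)).subset fun i hi => ?_)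
    rcases lt_or_ge i a with hlt | hge
    · exact Or.inr hlt
    · refine Or.inl ⟨i - a, ?_, by simp; omega⟩
      simpa [Nat.add_sub_cancel' hge] using hi

end InfinitySet

theorem PseudoArena.exists_play {U : Type} [DecidableEq U] {A : PseudoArena U} (σ : Fin 2)
    {s s' : List U → U → U} (hA : A.IsArena) (hs : A.IsStrategy σ s)
    (hs' : A.IsStrategy (1 - σ) s') {v : U} (hv : v ∈ A.V) :
    ∃ ρ, A.IsPlay v ρ ∧ A.Consistent σ s ρ ∧ A.Consistent (1 - σ) s' ρ := by
  classical
  let hist : ℕ → List U × U := fun i => Nat.rec ([], v)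
    (fun _ p => (p.1 ++ [p.2], if p.2 ∈ A.pos σ then s p.1 p.2 else s' p.1 p.2)) i
  have hpast : ∀ i, (hist i).1 = (List.range i).map fun i => (hist i).2 := by
    intro i
    induction i with
    | zero => rfl
    | succ i ih =>
      rw [List.range_succ, List.map_append, ← ih]
      rfl
  have hsucc : ∀ i, (hist (i + 1)).2 = if (hist i).2 ∈ A.pos σ then
      s ((List.range i).map fun i => (hist i).2) (hist i).2 else
      s' ((List.range i).map fun i => (hist i).2) (hist i).2 := by
    intro i
    rw [← hpast]
  have hstep : ∀ i, (hist i).2 ∈ A.V → ((hist i).2, (hist (i + 1)).2) ∈ A.E := by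
    intro i hi
    rw [hsucc]
    split_ifs with h
    · exact hs _ _ h
    · exact hs' _ _ (((mem_V_iff σ).1 hi).resolve_left h)
  have hV : ∀ i, (hist i).2 ∈ A.V := by
    intro i
    induction i with
    | zero => exact hv
    | succ i ih => exact (hA.edge_mem (hstep i ih)).2
  refine ⟨fun i => (hist i).2, ⟨hv, rfl, fun i => hstep i (hV i)⟩, fun i hi => ?_, fun i hi => ?_⟩
  · change (hist (i + 1)).2 = _
    rw [hsucc, if_pos hi]
  · change (hist (i + 1)).2 = _
    rw [hsucc, if_neg fun h => hA.notMem_opponent h hi]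

namespace ColouredMullerGame

variable {U C : Type} [Fintype C] [DecidableEq C] {G : ColouredMullerGame U C} {σ : Fin 2}

theorem winsPlay_shift {ρ : ℕ → U} {a : ℕ} :
    G.WinsPlay σ (fun i => ρ (a + i)) ↔ G.WinsPlay σ ρ := by
  simp only [WinsPlay, infinitySet_shift]

theorem WinsPlay.not_opponent {ρ : ℕ → U} (h : G.WinsPlay σ ρ) : ¬ G.WinsPlay (1 - σ) ρ := by
  rintro ⟨S', hS', hS'ρ⟩
  obtain ⟨S, hS, hSρ⟩ := h
  obtain rfl : S = S' := Finset.coe_injective (hSρ.trans hS'ρ.symm)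
  have : S ∈ G.F 0 ∩ G.F 1 := by
    fin_cases σ
    · exact Finset.mem_inter.2 ⟨hS, hS'⟩
    · exact Finset.mem_inter.2 ⟨hS', hS⟩
  rw [G.inter_eq] at this
  exact Finset.notMem_empty _ this

theorem exists_mem_F (S : Finset C) : ∃ σ, S ∈ G.F σ := by
  have : S ∈ G.F 0 ∪ G.F 1 := by rw [G.union_eq]; exact Finset.mem_univ S
  rcases Finset.mem_union.1 this with h | h
  exacts [⟨0, h⟩, ⟨1, h⟩]

variable [DecidableEq U]

theorem Win_subset : G.Win σ ⊆ G.A.V := fun _ h => h.1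

theorem notMem_Win_opponent (hA : G.A.IsArena) {v : U} (h : v ∈ G.Win σ) :
    v ∉ G.Win (1 - σ) := by
  rintro ⟨-, s', hs', h'⟩
  obtain ⟨hv, s, hs, h⟩ := h
  obtain ⟨ρ, hρ, hc, hc'⟩ := PseudoArena.exists_play σ hA hs hs' hv
  exact (h ρ hρ hc).not_opponent (h' ρ hρ hc')

theorem restrict_restrict {X Y : Finset U} (h : Y ⊆ X) :
    (G.restrict X).restrict Y = G.restrict Y := by
  simp only [restrict, PseudoArena.restrict_restrict h]

theorem restrict_V (hA : G.A.IsArena) : G.restrict G.A.V = G := by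
  simp only [restrict, PseudoArena.restrict_V hA]

theorem V_restrict {X : Finset U} : (G.restrict X).A.V = G.A.V ∩ X := PseudoArena.V_restrict X

/-- If the opponent cannot leave `X`, then a winning strategy in the subgame `G(X)` wins `G`. -/
theorem Win_restrict_subset (hA : G.A.IsArena) {X : Finset U}
    (hX : ∀ u ∈ G.A.pos (1 - σ), u ∈ X → ∀ y, (u, y) ∈ G.A.E → y ∈ X) :
    (G.restrict X).Win σ ⊆ G.Win σ := by
  intro v hv
  refine (PseudoArena.Enforces.of_restrict hA hv).mono fun ρ hρ h => ?_
  rcases h with h | ⟨i, hi, hp, hn⟩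
  · exact h
  · exact absurd (hX _ hp hi _ (hρ.2.2 i)) hn

/-- It suffices to enforce a visit to the winning region, since winning does not depend on a finite
prefix of the play. -/
theorem mem_Win_of_enforces (hA : G.A.IsArena) {v : U}
    (h : G.A.Enforces σ v fun ρ => G.WinsPlay σ ρ ∨ ∃ i, ρ i ∈ G.Win σ) : v ∈ G.Win σ :=
  h.seq hA (T := G.Win σ) (fun _ _ => winsPlay_shift.1) (fun _ _ h => h) fun _ hu => hu

theorem attractor_subset_Win (hA : G.A.IsArena) {T Y : Finset U}
    (hY : G.A.IsAttractor σ T Y) (hT : (T : Set U) ⊆ G.Win σ) : (Y : Set U) ⊆ G.Win σ :=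
  fun _ hv => mem_Win_of_enforces hA <| (hY.enforces hA hv).mono
    fun _ _ ⟨i, hi⟩ => Or.inr ⟨i, hT hi⟩

/-- If Player `σ` wins from `T`, then the winning strategies in the game without the attractor of
`T` win the whole game: when the opponent enters the attractor, `T` can be reached. -/
theorem Win_restrict_sdiff_subset (hA : G.A.IsArena) {T Y : Finset U}
    (hY : G.A.IsAttractor σ T Y) (hT : (T : Set U) ⊆ G.Win σ) :
    (G.restrict (G.A.V \ Y)).Win σ ⊆ G.Win σ := by
  intro v hv
  refine mem_Win_of_enforces hA ((PseudoArena.Enforces.of_restrict hA hv).mono fun ρ hρ h => ?_)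
  rcases h with h | ⟨i, -, -, hn⟩
  · exact Or.inl h
  · refine Or.inr ⟨i + 1, attractor_subset_Win hA hY hT ?_⟩
    by_contra hY'
    exact hn (Finset.mem_sdiff.2 ⟨hρ.mem hA _, hY'⟩)

/-- The complement of an attractor of Player `σ` cannot be left by Player `σ`. -/
theorem Win_opponent_restrict_sdiff_subset (hA : G.A.IsArena) {T Y : Finset U}
    (hY : G.A.IsAttractor σ T Y) :
    (G.restrict (G.A.V \ Y)).Win (1 - σ) ⊆ G.Win (1 - σ) := by
  refine Win_restrict_subset hA fun u hu huX y he => ?_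
  rw [sub_sub_cancel] at hu
  exact Finset.mem_sdiff.2 ⟨(hA.edge_mem he).2, hY.closed_own u hu (Finset.mem_sdiff.1 huX).2 y he⟩

/-- The case of the recursion in which the player who likes the set of all colours wins
everywhere. -/
theorem Win_eq_of_forall_attractor (hA : G.A.IsArena) (hc : G.A.V.image G.c ∈ G.F σ)
    (h : ∀ v ∈ G.A.V, ∃ Y, G.A.IsAttractor σ {v} Y ∧
      (G.restrict (G.A.V \ Y)).Win σ = ((G.A.V \ Y : Finset U) : Set U)) :
    G.Win σ = G.A.V := by
  refine Set.Subset.antisymm Win_subset fun v hv => ?_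
  refine PseudoArena.Enforces.cycle hA (fun _ _ => winsPlay_shift.1) (fun v hv u hu => ?_)
    (fun v ρ hρ hinf => ⟨_, hc, by rw [hinf, Finset.coe_image]⟩) hv
  obtain ⟨Y, hY, hR⟩ := h u hu
  have key : ∀ v ∈ Y, G.A.Enforces σ v fun ρ => G.WinsPlay σ ρ ∨ ∃ i, ρ i = u := fun v hv =>
    (hY.enforces hA hv).mono fun ρ _ ⟨i, hi⟩ => Or.inr ⟨i, by simpa using hi⟩
  by_cases hvY : v ∈ Y
  · exact key v hvY
  · have hvR : v ∈ (G.restrict (G.A.V \ Y)).Win σ := by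
      rw [hR]
      exact Finset.mem_coe.2 (Finset.mem_sdiff.2 ⟨hv, hvY⟩)
    refine (PseudoArena.Enforces.of_restrict hA hvR).seq hA (T := Y) ?_ (fun ρ hρ h => ?_) key
    · rintro ρ a (h | ⟨i, hi⟩)
      · exact Or.inl (winsPlay_shift.1 h)
      · exact Or.inr ⟨a + i, hi⟩
    · rcases h with h | ⟨i, -, -, hn⟩
      · exact Or.inl (Or.inl h)
      · refine Or.inr ⟨i + 1, ?_⟩
        by_contra hY'
        exact hn (Finset.mem_sdiff.2 ⟨hρ.mem hA _, hY'⟩)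

/-- Determinacy, by Zielonka's induction on the number of positions. -/
theorem mem_Win_or (hA : G.A.IsArena) (σ : Fin 2) {v : U} (hv : v ∈ G.A.V) :
    v ∈ G.Win σ ∨ v ∈ G.Win (1 - σ) := by
  obtain ⟨N, hN⟩ : ∃ N, G.A.V.card = N := ⟨_, rfl⟩
  induction N using Nat.strong_induction_on generalizing G σ v with
  | _ N ih =>
    -- Determinacy is symmetric, so that `σ` may be the player who likes the set of all colours.
    wlog hc : G.A.V.image G.c ∈ G.F σ generalizing σ
    · have hc' : G.A.V.image G.c ∈ G.F (1 - σ) := by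
        obtain ⟨τ, hτ⟩ := G.exists_mem_F (G.A.V.image G.c)
        have : τ = σ ∨ τ = 1 - σ := by clear * -; revert τ σ; decide
        rcases this with rfl | rfl
        exacts [absurd hτ hc, hτ]
      simpa [sub_sub_cancel, or_comm] using this (1 - σ) hc'
    have hlt : ∀ Y : Finset U, Y.Nonempty → Y ⊆ G.A.V →
        (G.restrict (G.A.V \ Y)).A.V.card < N := by
      intro Y hY hYV
      rw [V_restrict, Finset.inter_eq_right.2 Finset.sdiff_subset, ← hN]
      exact Finset.card_lt_card (Finset.sdiff_ssubset hYV hY)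
    by_cases hall : ∀ v ∈ G.A.V, ∃ Y, G.A.IsAttractor σ {v} Y ∧
        (G.restrict (G.A.V \ Y)).Win σ = ((G.A.V \ Y : Finset U) : Set U)
    · exact Or.inl ((Win_eq_of_forall_attractor hA hc hall).symm ▸ hv)
    · push Not at hall
      obtain ⟨u, hu, hall⟩ := hall
      obtain ⟨Y, hY⟩ := PseudoArena.exists_isAttractor σ (Finset.singleton_subset_iff.2 hu) hA
      have hYA := hY.isArena_restrict hA
      have hne : ∃ w, w ∈ (G.restrict (G.A.V \ Y)).Win (1 - σ) := by
        by_contra hcon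
        push Not at hcon
        refine hall Y hY (Set.Subset.antisymm (fun w hw => ?_) fun w hw => ?_)
        · have := Win_subset hw
          rw [V_restrict] at this
          exact (Finset.mem_inter.1 this).2
        · have hw' : w ∈ (G.restrict (G.A.V \ Y)).A.V := by
            rw [V_restrict, Finset.inter_eq_right.2 Finset.sdiff_subset]
            exact hw
          exact (ih _ (hlt Y ⟨u, hY.subset (Finset.mem_singleton_self u)⟩ hY.subset_V) hYA σ hw'
            rfl).resolve_right (hcon w)
      obtain ⟨w, hw⟩ := hne
      have hwin := Win_opponent_restrict_sdiff_subset hA hY hw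
      obtain ⟨Z, hZ⟩ := PseudoArena.exists_isAttractor (1 - σ)
        (Finset.singleton_subset_iff.2 hwin.1) hA
      have hTw : (({w} : Finset U) : Set U) ⊆ G.Win (1 - σ) := by simpa using hwin
      by_cases hvZ : v ∈ Z
      · exact Or.inr (attractor_subset_Win hA hZ hTw hvZ)
      · have hv' : v ∈ (G.restrict (G.A.V \ Z)).A.V := by
          rw [V_restrict, Finset.inter_eq_right.2 Finset.sdiff_subset]
          exact Finset.mem_sdiff.2 ⟨hv, hvZ⟩
        rcases ih _ (hlt Z ⟨w, hZ.subset (Finset.mem_singleton_self w)⟩ hZ.subset_V)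
          (hZ.isArena_restrict hA) σ hv' rfl with h | h
        · have := Win_opponent_restrict_sdiff_subset hA hZ
          rw [sub_sub_cancel] at this
          exact Or.inl (this h)
        · exact Or.inr (Win_restrict_sdiff_subset hA hZ hTw h)

/-- The recursion for the winning regions: `T` is a set on which the opponent of Player `σ`
wins. -/
theorem Win_eq_restrict_sdiff (hA : G.A.IsArena) {T Y : Finset U}
    (hY : G.A.IsAttractor (1 - σ) T Y) (hT : (T : Set U) ⊆ G.Win (1 - σ)) :
    G.Win σ = (G.restrict (G.A.V \ Y)).Win σ := by
  have h1 := Win_opponent_restrict_sdiff_subset hA hY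
  rw [sub_sub_cancel] at h1
  refine Set.Subset.antisymm (fun v hv => ?_) h1
  have hvn := notMem_Win_opponent hA hv
  have hvY : v ∉ Y := fun h => hvn (attractor_subset_Win hA hY hT h)
  have hv' : v ∈ (G.restrict (G.A.V \ Y)).A.V := by
    rw [V_restrict, Finset.inter_eq_right.2 Finset.sdiff_subset]
    exact Finset.mem_sdiff.2 ⟨hv.1, hvY⟩
  exact (mem_Win_or (hY.isArena_restrict hA) σ hv').resolve_right
    fun h => hvn (Win_restrict_sdiff_subset hA hY hT h)

/-! ### The winning region of Player 0 as a trap -/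

theorem mem_Win_of_edge_opponent (hA : G.A.IsArena) {u v : U} (hu : u ∈ G.Win σ)
    (hp : u ∈ G.A.pos (1 - σ)) (he : (u, v) ∈ G.A.E) : v ∈ G.Win σ := by
  by_contra hv
  have hv' := (mem_Win_or hA σ (hA.edge_mem he).2).resolve_left hv
  refine notMem_Win_opponent hA hu ?_
  obtain ⟨d, hd⟩ := hA.exists_strategy
  classical
  refine mem_Win_of_enforces hA ⟨hu.1, fun _ w => if w = u then v else d w,
    fun _ w hw => ?_, fun ρ hρ hc => Or.inr ⟨1, ?_⟩⟩
  · dsimp only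
    split_ifs with h
    · rwa [h]
    · exact hd w (PseudoArena.mem_V_of_mem_pos hw)
  · have := hc 0 (by rw [hρ.2.1]; exact hp)
    simp only [hρ.2.1, if_true] at this
    exact this ▸ hv'

/-- Along the plays of a winning strategy, all positions are winning. -/
theorem mem_Win_of_consistent (hA : G.A.IsArena) {v : U} {s : List U → U → U}
    (hs : G.A.IsStrategy σ s)
    (hwin : ∀ ρ, G.A.IsPlay v ρ → G.A.Consistent σ s ρ → G.WinsPlay σ ρ) {ρ : ℕ → U}
    (hρ : G.A.IsPlay v ρ) (N : ℕ)
    (hc : ∀ i < N, ρ i ∈ G.A.pos σ → ρ (i + 1) = s ((List.range i).map ρ) (ρ i)) :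
    ρ N ∈ G.Win σ := by
  -- After `N` moves, the strategy `s` is continued with the moves made so far put in front.
  refine ⟨hρ.mem hA N, fun past u => s ((List.range N).map ρ ++ past) u,
    fun past u hu => hs _ u hu, fun ρ' hρ' hc' => ?_⟩
  let π : ℕ → U := fun i => if i < N then ρ i else ρ' (i - N)
  have hπN : ∀ i, π (N + i) = ρ' i := fun i => by simp [π]
  have hπlt : ∀ i ≤ N, π i = ρ i := by
    intro i hi
    rcases hi.lt_or_eq with h | rfl
    · simp [π, h]
    · simpa [hρ'.2.1] using hπN 0
  have hpast : ∀ i ≤ N, (List.range i).map π = (List.range i).map ρ := by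
    intro i hi
    refine List.map_congr_left fun j hj => hπlt j ?_
    have := List.mem_range.1 hj
    omega
  have hπ : G.A.IsPlay v π := by
    refine ⟨hρ.1, by rw [hπlt 0 (Nat.zero_le _)]; exact hρ.2.1, fun i => ?_⟩
    rcases lt_or_ge i N with h | h
    · rw [hπlt i h.le, hπlt (i + 1) h]
      exact hρ.2.2 i
    · obtain ⟨j, rfl⟩ := Nat.exists_eq_add_of_le h
      rw [add_assoc, hπN, hπN]
      exact hρ'.2.2 j
  have hcons : G.A.Consistent σ s π := by
    intro i hi
    rcases lt_or_ge i N with h | h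
    · rw [hπlt i h.le] at hi ⊢
      rw [hπlt (i + 1) h, hpast i h.le]
      exact hc i h hi
    · obtain ⟨j, rfl⟩ := Nat.exists_eq_add_of_le h
      rw [add_assoc, hπN]
      rw [hπN] at hi ⊢
      rw [hc' j hi, List.range_add, List.map_append, hpast N le_rfl, List.map_map]
      congr 3
      exact funext fun t => (hπN t).symm
  have := hwin π hπ hcons
  rw [← winsPlay_shift (a := N)] at this
  simpa only [hπN] using this

/-- The winning region of Player `σ` is a trap for the opponent, and Player `σ` fully wins the game
on it. -/
theorem Win_isTrap (hA : G.A.IsArena) {S : Finset U} (hS : (S : Set U) = G.Win σ) :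
    (∀ u ∈ S, u ∈ G.A.pos σ → ∃ y ∈ S, (u, y) ∈ G.A.E) ∧
    (∀ u ∈ S, u ∈ G.A.pos (1 - σ) → ∀ y, (u, y) ∈ G.A.E → y ∈ S) ∧
    (G.restrict S).A.IsArena ∧ (G.restrict S).Win σ = S := by
  classical
  have hmem : ∀ u, u ∈ S ↔ u ∈ G.Win σ := fun u => by rw [← hS]; rfl
  have hown : ∀ u ∈ S, u ∈ G.A.pos σ → ∃ y ∈ S, (u, y) ∈ G.A.E := by
    intro u hu hp
    obtain ⟨hV, s, hs, hwin⟩ := (hmem u).1 hu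
    obtain ⟨d, hd⟩ := hA.exists_strategy
    obtain ⟨ρ, hρ, hc, -⟩ := PseudoArena.exists_play σ hA hs (s' := fun _ w => d w)
      (fun _ w hw => hd w (PseudoArena.mem_V_of_mem_pos hw)) hV
    refine ⟨ρ 1, (hmem _).2 (mem_Win_of_consistent hA hs hwin hρ 1 fun i _ => hc i), ?_⟩
    have := hρ.2.2 0
    rwa [hρ.2.1] at this
  have hopp : ∀ u ∈ S, u ∈ G.A.pos (1 - σ) → ∀ y, (u, y) ∈ G.A.E → y ∈ S :=
    fun u hu hp y he => (hmem y).2 (mem_Win_of_edge_opponent hA ((hmem u).1 hu) hp he)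
  have hSV : S ⊆ G.A.V := fun u hu => ((hmem u).1 hu).1
  have hSA : (G.restrict S).A.IsArena := by
    refine hA.restrict fun v hv hvS => ?_
    rcases (PseudoArena.mem_V_iff σ).1 hv with hp | hp
    · exact hown v hvS hp
    · obtain ⟨y, hy⟩ := hA.2.2 v hv
      exact ⟨y, hopp v hvS hp y hy, hy⟩
  refine ⟨hown, hopp, hSA, Set.Subset.antisymm (fun v hv => ?_) fun v hv => ?_⟩
  · have := Win_subset hv
    rw [V_restrict] at this
    exact (Finset.mem_inter.1 this).2
  -- A winning strategy for `G` is played in `G(S)`; where it would leave `S`, which happens only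
  -- outside its own plays, it is changed.
  · obtain ⟨hV, s, hs, hwin⟩ := (hmem v).1 hv
    obtain ⟨d, hd⟩ := hSA.exists_strategy
    refine ⟨by rw [V_restrict]; exact Finset.mem_inter.2 ⟨hV, hv⟩,
      fun past u => if s past u ∈ S then s past u else d u, fun past u hu => ?_,
      fun ρ hρ hc => ?_⟩
    · dsimp only
      split_ifs with h
      · replace hu := PseudoArena.mem_pos_restrict.1 hu
        exact PseudoArena.mem_E_restrict.2 ⟨hs past u hu.1, hu.2, h⟩
      · exact hd u (PseudoArena.mem_V_of_mem_pos hu)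
    · have hρ' : G.A.IsPlay v ρ :=
        ⟨hV, hρ.2.1, fun i => (PseudoArena.mem_E_restrict.1 (hρ.2.2 i)).1⟩
      have hρS : ∀ i, ρ i ∈ S := fun i => (PseudoArena.mem_E_restrict.1 (hρ.2.2 i)).2.1
      have hstep : ∀ N, ∀ i < N, ρ i ∈ G.A.pos σ →
          ρ (i + 1) = s ((List.range i).map ρ) (ρ i) := by
        intro N
        induction N with
        | zero => intro i hi; omega
        | succ N ih =>
          intro i hi hp
          rcases Nat.lt_succ_iff_lt_or_eq.1 hi with h | rfl
          · exact ih i h hp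
          · have hci := hc i (PseudoArena.mem_pos_restrict.2 ⟨hp, hρS i⟩)
            -- The play that agrees with `ρ` up to time `i` and then follows `s`.
            obtain ⟨d', hd'⟩ := hA.exists_strategy
            suffices hmemS : s ((List.range i).map ρ) (ρ i) ∈ S by
              rw [hci]; simp [hmemS]
            obtain ⟨π, hπ, hcπ, -⟩ := PseudoArena.exists_play σ hA hs
              (s' := fun _ w => d' w)
              (fun _ w hw => hd' w (PseudoArena.mem_V_of_mem_pos hw))
              (hA.edge_mem (hs ((List.range i).map ρ) (ρ i) hp)).2
            let ρ' : ℕ → U := fun j => if j ≤ i then ρ j else π (j - (i + 1))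
            have hlt : ∀ j ≤ i, ρ' j = ρ j := fun j hj => by simp [ρ', hj]
            have hgt : ∀ j, ρ' (i + 1 + j) = π j := fun j => by
              simp only [ρ']
              rw [if_neg (by omega)]
              congr 1
              omega
            have hnext : ρ' (i + 1) = s ((List.range i).map ρ) (ρ i) := by
              rw [← hπ.2.1]; exact hgt 0
            have hplay : G.A.IsPlay v ρ' := by
              refine ⟨hV, by rw [hlt 0 (Nat.zero_le _)]; exact hρ.2.1, fun j => ?_⟩
              rcases lt_trichotomy j i with h | rfl | h
              · rw [hlt j h.le, hlt (j + 1) h]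
                exact hρ'.2.2 j
              · rw [hlt j le_rfl, hnext]
                exact hs _ _ hp
              · obtain ⟨m, rfl⟩ := Nat.exists_eq_add_of_le (Nat.succ_le_of_lt h)
                rw [Nat.succ_eq_add_one, add_assoc (i + 1), hgt, hgt]
                exact hπ.2.2 m
            rw [← hnext]
            refine (hmem _).2 (mem_Win_of_consistent hA hs hwin hplay (i + 1) fun j hj hpj => ?_)
            have hpast : (List.range j).map ρ' = (List.range j).map ρ :=
              List.map_congr_left fun t ht => hlt t (by have := List.mem_range.1 ht; omega)
            rcases Nat.lt_succ_iff_lt_or_eq.1 hj with h | rfl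
            · rw [hlt j h.le] at hpj ⊢
              rw [hlt (j + 1) h, hpast]
              exact ih j h hpj
            · rw [hlt j le_rfl, hpast, hnext]
      exact hwin ρ hρ' fun i hi => hstep (i + 1) i (Nat.lt_succ_self i) hi

theorem subset_Win_of_trap (hA : G.A.IsArena) {X : Finset U}
    (hX : ∀ u ∈ G.A.pos (1 - σ), u ∈ X → ∀ y, (u, y) ∈ G.A.E → y ∈ X) (hXV : X ⊆ G.A.V)
    (hfull : (G.restrict X).FullyWins σ) : (X : Set U) ⊆ G.Win σ := by
  rw [FullyWins, V_restrict, Finset.inter_eq_right.2 hXV] at hfull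
  rw [← hfull]
  exact Win_restrict_subset hA hX

theorem Win_opponent_eq (hA : G.A.IsArena) : G.Win (1 - σ) = (G.A.V : Set U) \ G.Win σ := by
  ext v
  constructor
  · intro h
    exact ⟨Win_subset h, fun h' => notMem_Win_opponent hA h' h⟩
  · rintro ⟨hv, h⟩
    exact (mem_Win_or hA σ hv).resolve_left h

/-- The winning regions in terms of the largest fully won trap. -/
theorem exists_isGreatest_trap (hA : G.A.IsArena) :
    (¬ (∃ X ∈ G.P 0, G.A.IsTrap 1 X) ∧ G.Win 0 = ∅ ∧ G.Win 1 = G.A.V) ∨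
      ∃ S : Finset U, IsGreatest {X | X ∈ G.P 0 ∧ G.A.IsTrap 1 X} S ∧
        G.Win 0 = S ∧ G.Win 1 = (G.A.V : Set U) \ S := by
  classical
  have hopp : G.Win 1 = (G.A.V : Set U) \ G.Win 0 :=
    Win_opponent_eq (σ := 0) hA
  have hle : ∀ X ∈ G.P 0, G.A.IsTrap 1 X → (X : Set U) ⊆ G.Win 0 := fun X hX hT =>
    subset_Win_of_trap hA (fun u hu huX y he => hT.2.2.2 u (Finset.mem_inter.2 ⟨huX, hu⟩) y he)
      hT.1 hX.2
  obtain ⟨S, hS⟩ : ∃ S : Finset U, (S : Set U) = G.Win 0 :=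
    ⟨G.A.V.filter (· ∈ G.Win 0), by
      ext v; simpa using fun h => Win_subset h⟩
  rcases S.eq_empty_or_nonempty with rfl | hne
  · left
    rw [Finset.coe_empty] at hS
    refine ⟨?_, hS.symm, by rw [hopp, ← hS, Set.sdiff_empty]⟩
    rintro ⟨X, hX, hT⟩
    obtain ⟨u, hu⟩ := hX.1.1
    have := hle X hX hT hu
    rw [← hS] at this
    exact this
  · right
    obtain ⟨h1, h2, h3, h4⟩ := Win_isTrap hA hS
    have hSV : S ⊆ G.A.V := fun u hu => Win_subset (hS ▸ Finset.mem_coe.2 hu : u ∈ G.Win 0)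
    refine ⟨S, ⟨⟨⟨⟨hne, hSV, h3⟩, ?_⟩, hSV, h3, ?_, ?_⟩, ?_⟩, hS.symm, by rw [hopp, hS]⟩
    · rw [FullyWins, V_restrict, Finset.inter_eq_right.2 hSV, h4]
    · intro u hu
      rw [Finset.mem_inter] at hu
      obtain ⟨y, hy, he⟩ := h1 u hu.1 hu.2
      exact ⟨y, Finset.mem_inter.2 ⟨hy, hA.edge_pos he hu.2⟩, he⟩
    · intro u hu y he
      rw [Finset.mem_inter] at hu
      exact h2 u hu.1 hu.2 y he
    · rintro X ⟨hX, hT⟩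
      have := hle X hX hT
      rwa [← hS, Finset.coe_subset] at this

/-! ### The recursion for the winning regions of the subgames -/

open Classical in
/-- The winning region of Player `σ` in the subgame `G(X)`. -/
noncomputable def winSet (G : ColouredMullerGame U C) (σ : Fin 2) (X : Finset U) : Finset U :=
  X.filter (· ∈ (G.restrict X).Win σ)

theorem winSet_subset {X : Finset U} : G.winSet σ X ⊆ X := by
  classical
  exact Finset.filter_subset _ _

theorem winSet_empty : G.winSet σ ∅ = ∅ := Finset.subset_empty.1 winSet_subset

theorem coe_winSet {X : Finset U} : (G.winSet σ X : Set U) = (G.restrict X).Win σ := by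
  ext v
  simp only [winSet, Finset.coe_filter, Set.mem_ofPred_eq, and_iff_right_iff_imp]
  intro h
  have := Win_subset h
  rw [V_restrict] at this
  exact (Finset.mem_inter.1 this).2

theorem winSet_opponent {X : Finset U} (hX : X ⊆ G.A.V) (hXA : (G.restrict X).A.IsArena) :
    G.winSet (1 - σ) X = X \ G.winSet σ X := by
  apply Finset.coe_injective
  rw [coe_winSet, Win_opponent_eq hXA, Finset.coe_sdiff, coe_winSet, V_restrict,
    Finset.inter_eq_right.2 hX]

/-- The first case of the recursion: after the removal of the attractor of any position, the
opponent wins nowhere. -/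
theorem winSet_eq_self_of_forall {X : Finset U} (hX : X ⊆ G.A.V)
    (hXA : (G.restrict X).A.IsArena) (hc : X.image G.c ∈ G.F σ)
    (h : ∀ v ∈ X, ∃ Y, (G.restrict X).A.IsAttractor σ {v} Y ∧ G.winSet (1 - σ) (X \ Y) = ∅) :
    G.winSet σ X = X := by
  have hV : (G.restrict X).A.V = X := by rw [V_restrict, Finset.inter_eq_right.2 hX]
  apply Finset.coe_injective
  rw [coe_winSet, Win_eq_of_forall_attractor hXA (by rw [hV]; exact hc), hV]
  rw [hV]
  intro v hv
  obtain ⟨Y, hY, hYe⟩ := h v hv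
  refine ⟨Y, hY, ?_⟩
  have hA' := hY.isArena_restrict hXA
  have hcompl := winSet_opponent (G := G) (σ := σ) (X := X \ Y) (Finset.sdiff_subset.trans hX)
    (by rw [hV] at hA'; rwa [← restrict_restrict (G := G) (Finset.sdiff_subset (s := X) (t := Y))])
  rw [hYe] at hcompl
  rw [restrict_restrict Finset.sdiff_subset, ← coe_winSet]
  exact congrArg _ (winSet_subset.antisymm (Finset.sdiff_eq_empty_iff_subset.1 hcompl.symm))

/-- The second case of the recursion. The statement also holds if the opponent wins nowhere in the
subgame `G(X \ Y)`, but then `Z` may be empty and there is no progress. -/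
theorem winSet_eq_sdiff {X T Y Z : Finset U} (hX : X ⊆ G.A.V)
    (hXA : (G.restrict X).A.IsArena) (hY : (G.restrict X).A.IsAttractor σ T Y)
    (hZ : (G.restrict X).A.IsAttractor (1 - σ) (G.winSet (1 - σ) (X \ Y)) Z) :
    G.winSet σ X = G.winSet σ (X \ Z) := by
  have hV : (G.restrict X).A.V = X := by rw [V_restrict, Finset.inter_eq_right.2 hX]
  apply Finset.coe_injective
  have hsub := Win_opponent_restrict_sdiff_subset hXA hY
  rw [hV, restrict_restrict Finset.sdiff_subset, ← coe_winSet] at hsub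
  rw [coe_winSet, coe_winSet, Win_eq_restrict_sdiff hXA hZ hsub, hV,
    restrict_restrict Finset.sdiff_subset]

theorem isArena_restrict_sdiff {X T Y : Finset U} (hX : X ⊆ G.A.V)
    (hXA : (G.restrict X).A.IsArena) (hY : (G.restrict X).A.IsAttractor σ T Y) :
    (G.restrict (X \ Y)).A.IsArena := by
  have hV : (G.restrict X).A.V = X := by rw [V_restrict, Finset.inter_eq_right.2 hX]
  have hA' := hY.isArena_restrict hXA
  rw [hV] at hA'
  rwa [← restrict_restrict (G := G) (Finset.sdiff_subset (s := X) (t := Y))]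

theorem mem_P_iff {X : Finset U} (hX : X ⊆ G.A.V) :
    X ∈ G.P σ ↔ X.Nonempty ∧ (G.restrict X).A.IsArena ∧ G.winSet σ X = X := by
  have : (G.restrict X).FullyWins σ ↔ G.winSet σ X = X := by
    rw [FullyWins, ← coe_winSet, V_restrict, Finset.inter_eq_right.2 hX, Finset.coe_inj]
  simp only [P, IsSubgame, Set.mem_ofPred_eq, this]
  tauto

theorem mem_Q_iff {X : Finset U} (hX : X ⊆ G.A.V) :
    X ∈ G.Q ↔ X.Nonempty ∧ (G.restrict X).A.IsArena ∧ ∀ σ, G.winSet σ X ≠ X := by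
  have : ∀ σ, (G.restrict X).FullyWins σ ↔ G.winSet σ X = X := fun σ => by
    rw [FullyWins, ← coe_winSet, V_restrict, Finset.inter_eq_right.2 hX, Finset.coe_inj]
  simp only [Q, IsSubgame, Set.mem_ofPred_eq, this]
  tauto

end ColouredMullerGame

/-! ### A language with variables and arrays -/

/-- The variables of the algorithm. The numbers of positions, colours and edges are in `n`, `k` and
`m`, the number of sets of positions is in `pow`, and the length of the arrays is in `cap`. The
number of the current set of positions is in `cur`, `pl` is the player whose attractor is computed,
and `ownOff`, `oppOff` are the offsets, in the table of winning regions, of the player who likes the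
current set of colours and of the opponent. The other variables are local to parts of the
program. -/
inductive Var where
  | n | k | m | pow | cap | i | j | p | sz | acc | arg | res | pl | ownOff | oppOff
  | pos | e | hi | u | tail | goal | ok | cur
  deriving DecidableEq

/-- The arrays of the algorithm: the input; the table of the verdicts about the subgames; the table
of the numbers of the winning regions, at `code X` for Player `0` and at `code X + 2 ^ n` for Player
`1`; the winners of the whole game; the powers of `2`; the characteristic function of `F 0`; the
edges, sorted by targets; the characteristic functions of the current subgame and of the current
target set; the out-degrees in the subgame; the counters and the queue of the attractor search; and
the characteristic function of a set of colours. The input has to come first, as it is given at the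
address `0`. -/
inductive Arr where
  | input | table | win | winner | pw | fam | src | dst | start | inX | tgt | deg | cnt | queue
  | seen
  deriving DecidableEq

theorem Var.ctorIdx_injective : Function.Injective Var.ctorIdx :=
  Function.LeftInverse.injective (g := Var.ofNat) Var.ofNat_ctorIdx

theorem Arr.ctorIdx_injective : Function.Injective Arr.ctorIdx :=
  Function.LeftInverse.injective (g := Arr.ofNat) Arr.ofNat_ctorIdx

/-- Values of the variables and of the cells of the arrays, together with the number of steps made
so far. -/
structure Conf where
  v : Var → ℕ
  a : Arr → ℕ → ℕ
  t : ℕ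

namespace Conf

/-- Count one step. -/
def tick (h : Conf) : Conf := ⟨h.v, h.a, h.t + 1⟩

/-- Assign `c` to the variable `x`. -/
def setV (h : Conf) (x : Var) (c : ℕ) : Conf := ⟨Function.update h.v x c, h.a, h.t + 1⟩

/-- Write `c` to the cell `i` of the array `b`. -/
def setA (h : Conf) (b : Arr) (i c : ℕ) : Conf :=
  ⟨h.v, Function.update h.a b (Function.update (h.a b) i c), h.t + 1⟩

@[simp] theorem tick_v (h : Conf) : h.tick.v = h.v := rfl
@[simp] theorem tick_a (h : Conf) : h.tick.a = h.a := rfl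
@[simp] theorem tick_t (h : Conf) : h.tick.t = h.t + 1 := rfl
@[simp] theorem setV_a (h : Conf) (x c) : (h.setV x c).a = h.a := rfl
@[simp] theorem setV_t (h : Conf) (x c) : (h.setV x c).t = h.t + 1 := rfl
@[simp] theorem setV_same (h : Conf) (x c) : (h.setV x c).v x = c := Function.update_self ..
@[simp] theorem setV_of_ne (h : Conf) {x y : Var} (c) (hxy : y ≠ x) : (h.setV x c).v y = h.v y :=
  Function.update_of_ne hxy ..
@[simp] theorem setA_v (h : Conf) (b i c) : (h.setA b i c).v = h.v := rfl
@[simp] theorem setA_t (h : Conf) (b i c) : (h.setA b i c).t = h.t + 1 := rfl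
@[simp] theorem setA_same (h : Conf) (b i c) :
    (h.setA b i c).a b = Function.update (h.a b) i c := Function.update_self ..
@[simp] theorem setA_of_ne (h : Conf) {b b' : Arr} (i c) (hb : b' ≠ b) :
    (h.setA b i c).a b' = h.a b' := Function.update_of_ne hb ..

end Conf

/-- Expressions. -/
inductive Ex where
  | lit (c : ℕ)
  | var (x : Var)
  | add (e f : Ex)
  | sub (e f : Ex)
  | get (b : Arr) (e : Ex)

namespace Ex

/-- The value of an expression. -/
@[simp] def eval : Ex → Conf → ℕ
  | lit c, _ => c
  | var x, h => h.v x
  | add e f, h => e.eval h + f.eval h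
  | sub e f, h => e.eval h - f.eval h
  | get b e, h => h.a b (e.eval h)

/-- The evaluation of the expression computes no number `≥ B`, and it reads only cells with indices
`< cap` of the first `N` arrays. -/
@[simp] def Safe (N B cap : ℕ) : Ex → Conf → Prop
  | lit c, _ => c < B
  | var _, _ => True
  | add e f, h => Safe N B cap e h ∧ Safe N B cap f h ∧ e.eval h + f.eval h < B
  | sub e f, h => Safe N B cap e h ∧ Safe N B cap f h
  | get b e, h => Safe N B cap e h ∧ b.ctorIdx < N ∧ e.eval h < cap

/-- The instructions that compute the value of an expression in the register `3 * d + 1`, by means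
of the registers `3 * d' + 1` with `d ≤ d'`. -/
def compile : Ex → ℕ → Prog
  | lit c, d => .const (3 * d + 1) c
  | var x, d => .seq (.const (3 * d + 1) 0) (.add (3 * d + 1) (3 * x.ctorIdx) (3 * d + 1))
  | add e f, d => .seq (e.compile d) (.seq (f.compile (d + 1))
      (.add (3 * d + 1) (3 * d + 1) (3 * (d + 1) + 1)))
  | sub e f, d => .seq (e.compile d) (.seq (f.compile (d + 1))
      (.sub (3 * d + 1) (3 * d + 1) (3 * (d + 1) + 1)))
  | get b e, d => .seq (e.compile d) (.seq
      (.add (3 * d + 1) (3 * b.ctorIdx + 2) (3 * d + 1)) (.load (3 * d + 1) (3 * d + 1)))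

/-- The number of instructions. -/
def cost : Ex → ℕ
  | lit _ => 1
  | var _ => 2
  | add e f => e.cost + (f.cost + 1)
  | sub e f => e.cost + (f.cost + 1)
  | get _ e => e.cost + (1 + 1)

end Ex

/-- The state `s` of the machine represents the configuration `h`: the variable with number `x` is
in the register `3 * x`, the base address of the array with number `b` is in the register
`3 * b + 2`, and the first `N` arrays occupy consecutive blocks of `cap` cells. -/
structure Represents (N B cap : ℕ) (h : Conf) (s : State) : Prop where
  var_eq : ∀ x : Var, s.reg (3 * x.ctorIdx) = h.v x
  var_lt : ∀ x, h.v x < B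
  base : ∀ b : Arr, b.ctorIdx < N → s.reg (3 * b.ctorIdx + 2) = b.ctorIdx * cap
  arr_eq : ∀ b : Arr, b.ctorIdx < N → ∀ i < cap, s.mem (b.ctorIdx * cap + i) = h.a b i
  arr_lt : ∀ b : Arr, b.ctorIdx < N → ∀ i < cap, h.a b i < B
  space : N * cap ≤ B

section Compile

variable {N B cap : ℕ} {h : Conf} {s s' : State}

/-- The auxiliary registers `3 * d + 1` are irrelevant to the represented configuration. -/
theorem Represents.congr (hs : Represents N B cap h s) (hm : s'.mem = s.mem) {d : ℕ}
    (hr : ∀ r, (∀ d' ≥ d, r ≠ 3 * d' + 1) → s'.reg r = s.reg r) : Represents N B cap h s' where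
  var_eq x := by rw [hr _ (by omega), hs.var_eq]
  var_lt := hs.var_lt
  base b hb := by rw [hr _ (by omega), hs.base b hb]
  arr_eq b hb i hi := by rw [hm, hs.arr_eq b hb i hi]
  arr_lt := hs.arr_lt
  space := hs.space

theorem Represents.index_lt (hs : Represents N B cap h s) {b i : ℕ} (hb : b < N) (hi : i < cap) :
    b * cap + i < B := by
  have h1 : (b + 1) * cap ≤ N * cap := Nat.mul_le_mul_right _ hb
  have := hs.space
  rw [add_mul] at h1
  omega

/-- The value of an expression is computed in the register `3 * d + 1`; the registers `3 * d' + 1`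
with `d' < d` are preserved, since they may hold other intermediate results. -/
theorem Ex.exec_compile (e : Ex) (d : ℕ) (hs : Represents N B cap h s) (he : e.Safe N B cap h) :
    e.eval h < B ∧ ∃ s', Exec B (e.compile d) s s' e.cost ∧ s'.mem = s.mem ∧
      s'.reg (3 * d + 1) = e.eval h ∧
      ∀ r, (∀ d' ≥ d, r ≠ 3 * d' + 1) → s'.reg r = s.reg r := by
  induction e generalizing d s with
  | lit c =>
    refine ⟨he, _, Exec.const s _ c he, rfl, by simp [eval], fun r hr => ?_⟩
    exact Function.update_of_ne (hr d le_rfl) ..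
  | var x =>
    refine ⟨hs.var_lt x, _, Exec.seq _ _ _ _ _ _ _ (Exec.const s _ 0 ?_) (Exec.add _ _ _ _ ?_), rfl,
      ?_, fun r hr => ?_⟩
    · have := hs.var_lt x
      omega
    · have hne : 3 * x.ctorIdx ≠ 3 * d + 1 := by omega
      simp only [Function.update_self, Function.update_of_ne hne, hs.var_eq, add_zero]
      exact hs.var_lt x
    · have hne : 3 * x.ctorIdx ≠ 3 * d + 1 := by omega
      simp [Function.update_of_ne hne, hs.var_eq, eval]
    · simp [Function.update_of_ne (hr d le_rfl)]
  | add e f ihe ihf =>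
    obtain ⟨h1, h2, h3⟩ := he
    obtain ⟨-, s1, hx1, hm1, hv1, hr1⟩ := ihe d hs h1
    obtain ⟨-, s2, hx2, hm2, hv2, hr2⟩ := ihf (d + 1) (hs.congr hm1 hr1) h2
    have hv : s2.reg (3 * d + 1) = e.eval h := by rw [hr2 _ (by omega), hv1]
    refine ⟨h3, _, Exec.seq _ _ _ _ _ _ _ hx1 (Exec.seq _ _ _ _ _ _ _ hx2 (Exec.add _ _ _ _ ?_)),
      hm2.trans hm1, ?_, fun r hr => ?_⟩
    · rwa [hv, hv2]
    · simp [hv, hv2, eval]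
    · simp only [Function.update_of_ne (hr d le_rfl)]
      rw [hr2 r fun d' hd' => hr d' (by omega), hr1 r hr]
  | sub e f ihe ihf =>
    obtain ⟨h1, h2⟩ := he
    obtain ⟨h3, s1, hx1, hm1, hv1, hr1⟩ := ihe d hs h1
    obtain ⟨-, s2, hx2, hm2, hv2, hr2⟩ := ihf (d + 1) (hs.congr hm1 hr1) h2
    have hv : s2.reg (3 * d + 1) = e.eval h := by rw [hr2 _ (by omega), hv1]
    have h4 : e.eval h - f.eval h < B := by omega
    refine ⟨h4, _, Exec.seq _ _ _ _ _ _ _ hx1 (Exec.seq _ _ _ _ _ _ _ hx2 (Exec.sub _ _ _ _ ?_)),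
      hm2.trans hm1, ?_, fun r hr => ?_⟩
    · rwa [hv, hv2]
    · simp [hv, hv2, eval]
    · simp only [Function.update_of_ne (hr d le_rfl)]
      rw [hr2 r fun d' hd' => hr d' (by omega), hr1 r hr]
  | get b e ihe =>
    obtain ⟨h1, h2, h3⟩ := he
    obtain ⟨-, s1, hx1, hm1, hv1, hr1⟩ := ihe d hs h1
    have hb : s1.reg (3 * b.ctorIdx + 2) = b.ctorIdx * cap := by
      rw [hr1 _ (by omega), hs.base b h2]
    have hval := hs.arr_lt b h2 _ h3
    have hadd : s1.reg (3 * b.ctorIdx + 2) + s1.reg (3 * d + 1) = b.ctorIdx * cap + e.eval h := by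
      rw [hb, hv1]
    have hmem : s1.mem (b.ctorIdx * cap + e.eval h) = h.a b (e.eval h) := by
      rw [hm1, hs.arr_eq b h2 _ h3]
    refine ⟨hval, _, Exec.seq _ _ _ _ _ _ _ hx1 (Exec.seq _ _ _ _ _ _ _ (Exec.add _ _ _ _ ?_)
      (Exec.load _ _ _ ?_ ?_)), hm1, ?_, fun r hr => ?_⟩
    · rw [hadd]
      exact hs.index_lt h2 h3
    · simp only [Function.update_self, hadd]
      exact hs.index_lt h2 h3
    · simp only [Function.update_self, hadd, hmem]
      exact hval
    · simp only [Function.update_self, hadd, hmem, eval]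
    · simp only [Function.update_of_ne (hr d le_rfl)]
      rw [hr1 r hr]

end Compile

/-- Commands. -/
inductive Cmd where
  | skip
  | set (x : Var) (e : Ex)
  | put (b : Arr) (e f : Ex)
  | seq (p q : Cmd)
  | ite (e f : Ex) (p q : Cmd)
  /-- while `x < e`: do `p`, then increment `x` -/
  | loop (x : Var) (e : Ex) (p : Cmd)

namespace Cmd

/-- Evaluate `e` and `f` in the registers `1` and `4`. -/
def compileTest (e f : Ex) : Prog := .seq (e.compile 0) (f.compile 1)

/-- Move the value of `e` to the register of `x`. -/
def compileSet (x : Var) (e : Ex) : Prog :=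
  .seq (e.compile 0) (.seq (.const 4 0) (.add (3 * x.ctorIdx) 1 4))

/-- The translation of commands into programs of the machine. -/
def compile : Cmd → Prog
  | skip => .skip
  | set x e => compileSet x e
  | put b e f => .seq (compileTest e f) (.seq (.add 1 (3 * b.ctorIdx + 2) 1) (.store 1 4))
  | seq p q => .seq p.compile q.compile
  | ite e f p q => .seq (compileTest e f) (.ite 1 4 p.compile q.compile)
  | loop x e p => .seq (compileTest (.var x) e) (.loop 1 4 (.seq p.compile
      (.seq (compileSet x (.add (.var x) (.lit 1))) (compileTest (.var x) e))))

/-- A bound for the number of instructions that a single step of the command needs. In a loop, a step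
consists of a test, an increment and the next evaluation of the test, for which `e.cost + 20` is a
generous bound. -/
def cost : Cmd → ℕ
  | skip => 1
  | set _ e => e.cost + 2
  | put _ e f => e.cost + f.cost + 2
  | seq p q => max p.cost q.cost
  | ite e f p q => max (e.cost + f.cost + 1) (max p.cost q.cost)
  | loop _ e p => max (e.cost + 20) p.cost

/-- The weakest precondition: if `p.wp N B cap Q h` holds, then the execution of `p` from `h` is
within the bounds and leads to a configuration with the property `Q`. For a loop, an invariant `I`
has to be given that refers to the value of the loop variable; the bound of the loop has a fixed
value `l`. -/
def wp (N B cap : ℕ) : Cmd → (Conf → Prop) → Conf → Prop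
  | skip, Q, h => Q h.tick
  | set x e, Q, h => e.Safe N B cap h ∧ Q (h.setV x (e.eval h))
  | put b e f, Q, h => e.Safe N B cap h ∧ f.Safe N B cap h ∧ b.ctorIdx < N ∧ e.eval h < cap ∧
      Q (h.setA b (e.eval h) (f.eval h))
  | seq p q, Q, h => p.wp N B cap (q.wp N B cap Q) h
  | ite e f p q, Q, h => e.Safe N B cap h ∧ f.Safe N B cap h ∧
      (e.eval h < f.eval h → p.wp N B cap Q h.tick) ∧
      (¬ e.eval h < f.eval h → q.wp N B cap Q h.tick)
  | loop x e p, Q, h => ∃ (I : ℕ → Conf → Prop) (l : ℕ), h.v x ≤ l ∧ I (h.v x) h ∧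
      (∀ i h, i ≤ l → I i h → h.v x = i → e.Safe N B cap h ∧ e.eval h = l) ∧
      (∀ i h, i < l → I i h → h.v x = i →
        p.wp N B cap (fun h' => h'.v x = i ∧ I (i + 1) (h'.setV x (i + 1))) h) ∧
      ∀ h, I l h → h.v x = l → Q h.tick

section Wp

variable {N B cap : ℕ} {Q : Conf → Prop} {h : Conf}

@[simp] theorem wp_skip : skip.wp N B cap Q h ↔ Q h.tick := Iff.rfl

@[simp] theorem wp_set {x : Var} {e : Ex} :
    (set x e).wp N B cap Q h ↔ e.Safe N B cap h ∧ Q (h.setV x (e.eval h)) := Iff.rfl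

@[simp] theorem wp_put {b : Arr} {e f : Ex} :
    (put b e f).wp N B cap Q h ↔ e.Safe N B cap h ∧ f.Safe N B cap h ∧ b.ctorIdx < N ∧
      e.eval h < cap ∧ Q (h.setA b (e.eval h) (f.eval h)) := Iff.rfl

@[simp] theorem wp_seq {p q : Cmd} :
    (seq p q).wp N B cap Q h ↔ p.wp N B cap (q.wp N B cap Q) h := Iff.rfl

@[simp] theorem wp_ite {e f : Ex} {p q : Cmd} :
    (ite e f p q).wp N B cap Q h ↔ e.Safe N B cap h ∧ f.Safe N B cap h ∧
      (e.eval h < f.eval h → p.wp N B cap Q h.tick) ∧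
      (¬ e.eval h < f.eval h → q.wp N B cap Q h.tick) := Iff.rfl

end Wp

theorem wp_mono {N B cap : ℕ} {p : Cmd} {Q R : Conf → Prop} (hQR : ∀ h, Q h → R h) {h : Conf}
    (hp : p.wp N B cap Q h) : p.wp N B cap R h := by
  induction p generalizing Q R h with
  | skip => exact hQR _ hp
  | set x e => exact ⟨hp.1, hQR _ hp.2⟩
  | put b e f =>
    obtain ⟨h1, h2, h3, h4, h5⟩ := hp
    exact ⟨h1, h2, h3, h4, hQR _ h5⟩
  | seq p q ihp ihq => exact ihp (fun h hq => ihq hQR hq) hp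
  | ite e f p q ihp ihq =>
    obtain ⟨h1, h2, h3, h4⟩ := hp
    exact ⟨h1, h2, fun hlt => ihp hQR (h3 hlt), fun hlt => ihq hQR (h4 hlt)⟩
  | loop x e p ih =>
    obtain ⟨I, l, h1, h2, h3, h4, h5⟩ := hp
    exact ⟨I, l, h1, h2, h3, h4, fun h hI hx => hQR _ (h5 h hI hx)⟩

theorem wp_seq_of {N B cap : ℕ} {p q : Cmd} {R Q : Conf → Prop} {h : Conf}
    (hp : p.wp N B cap R h) (hq : ∀ h', R h' → q.wp N B cap Q h') : (seq p q).wp N B cap Q h :=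
  wp_mono hq hp

section Soundness

variable {N B cap : ℕ} {h : Conf} {s : State}

theorem exec_compileTest {e f : Ex} (hs : Represents N B cap h s) (he : e.Safe N B cap h)
    (hf : f.Safe N B cap h) :
    ∃ s', Exec B (compileTest e f) s s' (e.cost + f.cost) ∧ Represents N B cap h s' ∧
      s'.reg 1 = e.eval h ∧ s'.reg 4 = f.eval h := by
  obtain ⟨-, s1, hx1, hm1, hv1, hr1⟩ := e.exec_compile 0 hs he
  have hs1 := hs.congr hm1 hr1
  obtain ⟨-, s2, hx2, hm2, hv2, hr2⟩ := f.exec_compile 1 hs1 hf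
  exact ⟨s2, Exec.seq _ _ _ _ _ _ _ hx1 hx2, hs1.congr hm2 hr2,
    by rw [hr2 1 (by omega)]; exact hv1, hv2⟩

theorem exec_compileSet {x : Var} {e : Ex} (hs : Represents N B cap h s)
    (he : e.Safe N B cap h) :
    ∃ s', Exec B (compileSet x e) s s' (e.cost + 2) ∧
      Represents N B cap (h.setV x (e.eval h)) s' := by
  obtain ⟨hB, s1, hx1, hm1, hv1, hr1⟩ := e.exec_compile 0 hs he
  have hs1 := hs.congr hm1 hr1
  simp only [mul_zero, zero_add] at hv1
  refine ⟨_, Exec.seq _ _ _ _ _ _ _ hx1 (Exec.seq _ _ _ _ _ _ _ (Exec.const _ 4 0 (by omega))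
    (Exec.add _ _ _ _ ?_)), ?_⟩
  · simpa [hv1] using hB
  · constructor
    · intro y
      by_cases hxy : y = x
      · subst hxy
        simp [hv1]
      · have hne : 3 * y.ctorIdx ≠ 3 * x.ctorIdx := fun hc =>
          hxy (Var.ctorIdx_injective (by omega))
        have h4 : 3 * y.ctorIdx ≠ 4 := by omega
        simp [hxy, Function.update_of_ne hne, Function.update_of_ne h4, hs1.var_eq]
    · intro y
      by_cases hxy : y = x
      · subst hxy
        simpa using hB
      · simpa [hxy] using hs.var_lt y
    · intro b hb
      have hne : 3 * b.ctorIdx + 2 ≠ 3 * x.ctorIdx := by omega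
      have h4 : 3 * b.ctorIdx + 2 ≠ 4 := by omega
      simp [Function.update_of_ne hne, Function.update_of_ne h4, hs1.base b hb]
    · exact hs1.arr_eq
    · exact hs1.arr_lt
    · exact hs1.space

/-- The machine executes the translation of a command as the weakest precondition says, and the
number of instructions is proportional to the number of steps. -/
theorem exec_compile {p : Cmd} {K : ℕ} (hK : p.cost ≤ K) {Q : Conf → Prop}
    (hs : Represents N B cap h s) (hp : p.wp N B cap Q h) :
    ∃ s' t h', Exec B p.compile s s' t ∧ Represents N B cap h' s' ∧ Q h' ∧
      t + K * h.t ≤ K * h'.t := by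
  induction p generalizing Q h s with
  | skip =>
    refine ⟨s, 1, h.tick, Exec.skip s, ⟨hs.1, hs.2, hs.3, hs.4, hs.5, hs.6⟩, hp, ?_⟩
    simp only [cost, Conf.tick_t, mul_add] at *
    omega
  | set x e =>
    obtain ⟨s', hx, hs'⟩ := exec_compileSet (x := x) hs hp.1
    refine ⟨s', _, _, hx, hs', hp.2, ?_⟩
    simp only [cost, Conf.setV_t, mul_add] at *
    omega
  | put b e f =>
    obtain ⟨he, hf, hb, hi, hQ⟩ := hp
    obtain ⟨s1, hx1, hs1, hv1, hv2⟩ := exec_compileTest hs he hf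
    have hfB := (f.exec_compile 0 hs hf).1
    have hlt := hs1.index_lt hb hi
    have hreg : s1.reg (3 * b.ctorIdx + 2) + s1.reg 1 = b.ctorIdx * cap + e.eval h := by
      rw [hs1.base b hb, hv1]
    refine ⟨_, _, _, Exec.seq _ _ _ _ _ _ _ hx1 (Exec.seq _ _ _ _ _ _ _
      (Exec.add _ _ _ _ (by rwa [hreg])) (Exec.store _ _ _ ?_ ?_)), ?_, hQ, ?_⟩
    · simpa [hreg] using hlt
    · simpa [hv2] using hfB
    · constructor
      · intro y
        simp [hs1.var_eq]
      · exact hs.var_lt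
      · intro b' hb'
        simp [hs1.base b' hb']
      · intro b' hb' i hi'
        simp only [Function.update_self, hreg, hv2,
          Function.update_of_ne (by decide : (4 : ℕ) ≠ 1)]
        by_cases hbb : b' = b
        · subst hbb
          by_cases hii : i = e.eval h
          · subst hii
            simp
          · rw [Function.update_of_ne (by omega), Conf.setA_same, Function.update_of_ne hii,
              hs1.arr_eq b' hb' i hi']
        · rw [Conf.setA_of_ne _ _ _ hbb, ← hs1.arr_eq b' hb' i hi', Function.update_of_ne]
          -- The blocks of different arrays are disjoint.
          intro hc
          have hne : b'.ctorIdx ≠ b.ctorIdx := fun hc => hbb (Arr.ctorIdx_injective hc)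
          rcases Nat.lt_or_gt_of_ne hne with h1 | h1
          · have := Nat.mul_le_mul_right cap (Nat.succ_le_of_lt h1)
            rw [Nat.succ_mul] at this
            omega
          · have := Nat.mul_le_mul_right cap (Nat.succ_le_of_lt h1)
            rw [Nat.succ_mul] at this
            omega
      · intro b' hb' i hi'
        by_cases hbb : b' = b
        · subst hbb
          rw [Conf.setA_same, Function.update_apply]
          split_ifs
          · exact hfB
          · exact hs.arr_lt b' hb' i hi'
        · rw [Conf.setA_of_ne _ _ _ hbb]
          exact hs.arr_lt b' hb' i hi'
      · exact hs.space
    · simp only [cost, Conf.setA_t, mul_add] at *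
      omega
  | seq p q ihp ihq =>
    rw [cost, max_le_iff] at hK
    obtain ⟨s1, t1, h1, hx1, hs1, hq, ht1⟩ := ihp hK.1 hs hp
    obtain ⟨s2, t2, h2, hx2, hs2, hQ, ht2⟩ := ihq hK.2 hs1 hq
    exact ⟨s2, _, h2, Exec.seq _ _ _ _ _ _ _ hx1 hx2, hs2, hQ, by omega⟩
  | ite e f p q ihp ihq =>
    obtain ⟨he, hf, h1, h2⟩ := hp
    rw [cost, max_le_iff, max_le_iff] at hK
    obtain ⟨s1, hx1, hs1, hv1, hv2⟩ := exec_compileTest hs he hf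
    have hs1' : Represents N B cap h.tick s1 := ⟨hs1.1, hs1.2, hs1.3, hs1.4, hs1.5, hs1.6⟩
    by_cases hlt : e.eval h < f.eval h
    · obtain ⟨s2, t, h', hx, hs2, hQ, ht⟩ := ihp hK.2.1 hs1' (h1 hlt)
      refine ⟨s2, _, h', Exec.seq _ _ _ _ _ _ _ hx1 (Exec.ite_true _ _ _ _ _ _ _ ?_ hx), hs2, hQ,
        ?_⟩
      · rwa [hv1, hv2]
      · simp only [Conf.tick_t, mul_add] at ht
        omega
    · obtain ⟨s2, t, h', hx, hs2, hQ, ht⟩ := ihq hK.2.2 hs1' (h2 hlt)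
      refine ⟨s2, _, h', Exec.seq _ _ _ _ _ _ _ hx1 (Exec.ite_false _ _ _ _ _ _ _ ?_ hx), hs2, hQ,
        ?_⟩
      · rwa [hv1, hv2]
      · simp only [Conf.tick_t, mul_add] at ht
        omega
  | loop x e p ih =>
    obtain ⟨I, l, hxl, hI, hE, hbody, hexit⟩ := hp
    rw [cost, max_le_iff] at hK
    -- The loop proper, started after the evaluation of the test.
    have main : ∀ r h s, Represents N B cap h s → h.v x + r = l → I (h.v x) h →
        s.reg 1 = h.v x → s.reg 4 = l →
        ∃ s' t h', Exec B (.loop 1 4 (.seq p.compile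
          (.seq (compileSet x (.add (.var x) (.lit 1))) (compileTest (.var x) e)))) s s' t ∧
          Represents N B cap h' s' ∧ I l h' ∧ h'.v x = l ∧ t + K * h.t ≤ K * h'.t + 1 := by
      intro r
      induction r with
      | zero =>
        intro h s hs hr hI h1 h4
        obtain rfl : h.v x = l := by omega
        exact ⟨s, 1, h, Exec.loop_false _ _ _ _ (by omega), hs, hI, rfl, by omega⟩
      | succ r ihr =>
        intro h s hs hr hI h1 h4
        obtain ⟨s1, t1, h', hx1, hs1, ⟨hx', hI'⟩, ht1⟩ :=
          ih hK.2 hs (hbody _ h (by omega) hI rfl)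
        have hlB : l < B := by
          have hEl := hE _ h (by omega) hI rfl
          have := (e.exec_compile 0 hs hEl.1).1
          omega
        obtain ⟨s2, hx2, hs2⟩ := exec_compileSet (x := x) (e := .add (.var x) (.lit 1)) hs1
          ⟨trivial, show 1 < B by omega, by simp only [Ex.eval]; omega⟩
        have hval : Ex.eval (.add (.var x) (.lit 1)) h' = h.v x + 1 := by simp [Ex.eval, hx']
        rw [hval] at hs2
        have hE2 := hE (h.v x + 1) _ (by omega) hI' (by simp)
        obtain ⟨s3, hx3, hs3, hv1, hv4⟩ := exec_compileTest (e := .var x) hs2 trivial hE2.1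
        rw [hE2.2] at hv4
        obtain ⟨s4, t4, h4', hx4, hs4, hI4, hx4', ht4⟩ := ihr _ s3 hs3
          (by simp; omega) (by simpa using hI') hv1 hv4
        refine ⟨s4, _, h4', Exec.loop_true _ _ _ _ _ _ _ _ (by omega)
          (Exec.seq _ _ _ _ _ _ _ hx1 (Exec.seq _ _ _ _ _ _ _ hx2 hx3)) hx4, hs4, hI4, hx4', ?_⟩
        simp only [Conf.setV_t, mul_add, Ex.cost] at ht4 ⊢
        omega
    obtain ⟨hEs, hEl⟩ := hE _ h hxl hI rfl
    obtain ⟨s1, hx1, hs1, hv1, hv4⟩ := exec_compileTest (e := .var x) hs trivial hEs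
    obtain ⟨s2, t, h', hx2, hs2, hI2, hx', ht⟩ := main (l - h.v x) h s1 hs1 (by omega) hI hv1
      (hv4.trans hEl)
    refine ⟨s2, _, h'.tick, Exec.seq _ _ _ _ _ _ _ hx1 hx2,
      ⟨hs2.1, hs2.2, hs2.3, hs2.4, hs2.5, hs2.6⟩, hexit h' hI2 hx', ?_⟩
    simp only [Conf.tick_t, mul_add, Ex.cost]
    omega

end Soundness

end Cmd

/-! ### Numbers of sets -/

section Code

variable {n : ℕ}

theorem code_empty : code (∅ : Finset (Fin n)) = 0 := rfl

theorem code_singleton (v : Fin n) : code {v} = 2 ^ (v : ℕ) := Finset.sum_singleton _ _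

theorem code_sdiff_add {X Y : Finset (Fin n)} (h : Y ⊆ X) : code (X \ Y) + code Y = code X :=
  Finset.sum_sdiff h

/-- The contribution of the elements below `r` to the number of a set. -/
def lowCode (X : Finset (Fin n)) (r : ℕ) : ℕ := code (X.filter fun v => (v : ℕ) < r)

theorem lowCode_zero (X : Finset (Fin n)) : lowCode X 0 = 0 := by simp [lowCode, code]

theorem lowCode_self (X : Finset (Fin n)) : lowCode X n = code X := by simp [lowCode]

theorem lowCode_succ (X : Finset (Fin n)) {r : ℕ} (hr : r < n) :
    lowCode X (r + 1) = lowCode X r + if (⟨r, hr⟩ : Fin n) ∈ X then 2 ^ r else 0 := by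
  have hdisj : X.filter (fun v : Fin n => (v : ℕ) < r + 1) =
      X.filter (fun v : Fin n => (v : ℕ) < r) ∪ X.filter (fun v => v = ⟨r, hr⟩) := by
    ext v
    simp only [Finset.mem_filter, Finset.mem_union, Fin.ext_iff]
    by_cases hv : v ∈ X <;> simp [hv]
    omega
  rw [lowCode, hdisj, code, Finset.sum_union, ← code, ← lowCode, Finset.filter_eq']
  · congr 1
    split_ifs <;> simp
  · refine Finset.disjoint_filter.2 fun v _ h1 h2 => ?_
    rw [Fin.ext_iff] at h2
    simp at h2
    omega

theorem lowCode_lt (X : Finset (Fin n)) {r : ℕ} (hr : r ≤ n) : lowCode X r < 2 ^ r := by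
  induction r with
  | zero => simp [lowCode_zero]
  | succ r ih =>
    rw [lowCode_succ X hr, pow_succ]
    have := ih (by omega)
    split_ifs <;> omega

theorem code_lt (X : Finset (Fin n)) : code X < 2 ^ n := by
  rw [← lowCode_self]
  exact lowCode_lt X le_rfl

/-- The test that decodes a number: the digits are found in descending order. -/
theorem pow_le_lowCode_succ_iff (X : Finset (Fin n)) {r : ℕ} (hr : r < n) :
    2 ^ r ≤ lowCode X (r + 1) ↔ (⟨r, hr⟩ : Fin n) ∈ X := by
  have := lowCode_lt X hr.le
  rw [lowCode_succ X hr]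
  split_ifs with h <;> simp [h]
  exact this

theorem code_injective : Function.Injective (code : Finset (Fin n) → ℕ) := by
  intro X Y h
  have key : ∀ r ≤ n, lowCode X (n - r) = lowCode Y (n - r) ∧
      ∀ v : Fin n, n - r ≤ v → (v ∈ X ↔ v ∈ Y) := by
    intro r
    induction r with
    | zero => exact fun _ => ⟨by simpa [lowCode_self] using h, fun v hv => by omega⟩
    | succ r ih =>
      intro hr
      obtain ⟨h1, h2⟩ := ih (by omega)
      have hlt : n - (r + 1) < n := by omega
      have hs : n - r = n - (r + 1) + 1 := by omega
      rw [hs] at h1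
      have hiff : (⟨n - (r + 1), hlt⟩ : Fin n) ∈ X ↔ (⟨n - (r + 1), hlt⟩ : Fin n) ∈ Y := by
        rw [← pow_le_lowCode_succ_iff, ← pow_le_lowCode_succ_iff, h1]
      refine ⟨?_, fun v hv => ?_⟩
      · rw [lowCode_succ X hlt, lowCode_succ Y hlt] at h1
        simp only [hiff] at h1
        omega
      · rcases Nat.eq_or_lt_of_le hv with h | h
        · have : v = ⟨n - (r + 1), hlt⟩ := Fin.ext h.symm
          rw [this]
          exact hiff
        · exact h2 v (by omega)
  exact Finset.ext fun v => (key n le_rfl).2 v (by omega)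

theorem code_eq_zero {X : Finset (Fin n)} : code X = 0 ↔ X = ∅ := by
  rw [← code_empty (n := n)]
  exact code_injective.eq_iff

theorem exists_code_eq {c : ℕ} (hc : c < 2 ^ n) : ∃ X : Finset (Fin n), code X = c := by
  let f : Finset (Fin n) → Fin (2 ^ n) := fun X => ⟨code X, code_lt X⟩
  have hf : Function.Injective f := fun X Y h => code_injective (congrArg Fin.val h)
  have := (Fintype.bijective_iff_injective_and_card f).2 ⟨hf, by simp⟩
  obtain ⟨X, hX⟩ := this.2 ⟨c, hc⟩
  exact ⟨X, congrArg Fin.val hX⟩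

theorem code_univ : code (Finset.univ : Finset (Fin n)) = 2 ^ n - 1 := by
  obtain ⟨X, hX⟩ := exists_code_eq (n := n) (c := 2 ^ n - 1) (by have := Nat.two_pow_pos n; omega)
  have h1 := code_lt (Finset.univ : Finset (Fin n))
  have h2 := code_sdiff_add (Finset.subset_univ X)
  omega

end Code

/-! ### Auxiliary facts about configurations -/

@[simp] theorem Arr.ctorIdx_lt (b : Arr) : b.ctorIdx < 15 := by cases b <;> decide

namespace Conf

/-- Only the variables `xs` and the arrays `bs` are changed. -/
structure Frame (xs : List Var) (bs : List Arr) (h h' : Conf) : Prop where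
  var : ∀ x ∉ xs, h'.v x = h.v x
  arr : ∀ b ∉ bs, h'.a b = h.a b

variable {xs ys : List Var} {bs cs : List Arr} {h h' h'' : Conf}

theorem frame_refl (h : Conf) (xs : List Var) (bs : List Arr) : Frame xs bs h h :=
  ⟨fun _ _ => rfl, fun _ _ => rfl⟩

theorem Frame.trans (h1 : Frame xs bs h h') (h2 : Frame xs bs h' h'') : Frame xs bs h h'' :=
  ⟨fun x hx => (h2.var x hx).trans (h1.var x hx), fun b hb => (h2.arr b hb).trans (h1.arr b hb)⟩

theorem Frame.mono (h1 : Frame xs bs h h') (hx : xs ⊆ ys) (hb : bs ⊆ cs) : Frame ys cs h h' :=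
  ⟨fun x hy => h1.var x fun hc => hy (hx hc), fun b hc => h1.arr b fun hc' => hc (hb hc')⟩

@[simp] theorem frame_tick : Frame xs bs h h'.tick ↔ Frame xs bs h h' :=
  ⟨fun h1 => ⟨h1.1, h1.2⟩, fun h1 => ⟨h1.1, h1.2⟩⟩

@[simp] theorem frame_setV {x : Var} {c : ℕ} (hx : x ∈ xs) :
    Frame xs bs h (h'.setV x c) ↔ Frame xs bs h h' := by
  have hne : ∀ y ∉ xs, (h'.setV x c).v y = h'.v y := fun y hy =>
    setV_of_ne _ _ (by rintro rfl; exact hy hx)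
  exact ⟨fun h1 => ⟨fun y hy => (hne y hy).symm.trans (h1.1 y hy), h1.2⟩,
    fun h1 => ⟨fun y hy => (hne y hy).trans (h1.1 y hy), h1.2⟩⟩

@[simp] theorem frame_setA {b : Arr} {i c : ℕ} (hb : b ∈ bs) :
    Frame xs bs h (h'.setA b i c) ↔ Frame xs bs h h' := by
  have hne : ∀ d ∉ bs, (h'.setA b i c).a d = h'.a d := fun d hd =>
    setA_of_ne _ _ _ (by rintro rfl; exact hd hb)
  exact ⟨fun h1 => ⟨h1.1, fun d hd => (hne d hd).symm.trans (h1.2 d hd)⟩,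
    fun h1 => ⟨h1.1, fun d hd => (hne d hd).trans (h1.2 d hd)⟩⟩

end Conf

/-- Execute `p`, then `q`. -/
infixr:60 " ;; " => Cmd.seq

/-- The array `a` holds the characteristic function of `X`. -/
def IsBits {n : ℕ} (a : ℕ → ℕ) (X : Finset (Fin n)) : Prop :=
  ∀ v : Fin n, a v = if v ∈ X then 1 else 0

/-! ### Conversion between numbers and characteristic functions -/

/-- Write the characteristic function of the set with the number `arg` to the array `b`, by
comparison with the powers of `2` in descending order. -/
def decode (b : Arr) : Cmd :=
  .set .j (.lit 0) ;;
  .loop .j (.var .n) (.ite (.var .arg) (.get .pw (.sub (.sub (.var .n) (.lit 1)) (.var .j)))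
    (.put b (.sub (.sub (.var .n) (.lit 1)) (.var .j)) (.lit 0))
    (.put b (.sub (.sub (.var .n) (.lit 1)) (.var .j)) (.lit 1) ;;
      .set .arg (.sub (.var .arg) (.get .pw (.sub (.sub (.var .n) (.lit 1)) (.var .j))))))

/-- Compute in `res` the number of the set of the indices `< x` at which the array `b` is
positive. -/
def encode (b : Arr) (x : Var) : Cmd :=
  .set .res (.lit 0) ;; .set .j (.lit 0) ;;
  .loop .j (.var x) (.ite (.lit 0) (.get b (.var .j))
    (.set .res (.add (.var .res) (.get .pw (.var .j)))) .skip)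

section Conversion

variable {B cap n : ℕ} {h : Conf}

theorem wp_decode {b : Arr} {X : Finset (Fin n)} (hb : b ≠ .pw) (hn : h.v .n = n)
    (hpw : ∀ i < n, h.a .pw i = 2 ^ i) (harg : h.v .arg = code X) (hcap : n < cap) (hB : 1 < B) :
    (decode b).wp 15 B cap (fun h' => h.Frame [.j, .arg] [b] h' ∧ IsBits (h'.a b) X ∧
      h'.t ≤ h.t + (4 * n + 2)) h := by
  have hB0 : 0 < B := by omega
  refine ⟨hB0, fun j h' => h.Frame [.j, .arg] [b] h' ∧
    h'.v .arg = lowCode X (n - j) ∧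
    (∀ v : Fin n, n - j ≤ v → h'.a b v = if v ∈ X then 1 else 0) ∧
    h'.t ≤ h.t + (4 * j + 1), n, ?_, ?_, ?_, ?_, ?_⟩
  · simp
  · have := h.frame_refl [.j, .arg] [b]
    simp [this, harg, lowCode_self]
  · intro i h' _ hI _
    exact ⟨trivial, (hI.1.var .n (by simp)).trans hn⟩
  · rintro j h' hj ⟨hF, harg', hbits, ht⟩ hvj
    have hn' : h'.v .n = n := (hF.var .n (by simp)).trans hn
    have hpw' : h'.a .pw = h.a .pw := hF.arr .pw (by simpa using hb.symm)
    have hlt : n - 1 - j < n := by omega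
    have hs : n - j = n - 1 - j + 1 := by omega
    have hpv : h'.a .pw (n - 1 - j) = 2 ^ (n - 1 - j) := by rw [hpw', hpw _ hlt]
    have hmem := pow_le_lowCode_succ_iff X hlt
    have hle : n - (j + 1) = n - 1 - j := by omega
    have hcap' : n - 1 - j < cap := by omega
    have hnext : ∀ c, (c = if (⟨n - 1 - j, hlt⟩ : Fin n) ∈ X then 1 else 0) → ∀ v : Fin n,
        n ≤ v + (j + 1) → Function.update (h'.a b) (n - 1 - j) c v = if v ∈ X then 1 else 0 := by
      intro c hc v hv
      have hv : n - (j + 1) ≤ v := by omega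
      rcases Nat.eq_or_lt_of_le hv with h1 | h1
      · have hv1 : v = ⟨n - 1 - j, hlt⟩ := Fin.ext (by simp; omega)
        rw [hv1, hc, Function.update_self]
      · rw [Function.update_of_ne (by omega)]
        exact hbits v (by omega)
    have hsucc := lowCode_succ X hlt
    rw [← hs] at hmem hsucc
    by_cases hlow : lowCode X (n - j) < 2 ^ (n - 1 - j)
    · have hX : (⟨n - 1 - j, hlt⟩ : Fin n) ∉ X := by rw [← hmem]; omega
      rw [if_neg hX] at hsucc
      simp [hn', hvj, hpv, harg', hlow, hB, hB0, hcap', hF]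
      exact ⟨by rw [hle]; omega, hnext _ (by simp [hX]), by omega⟩
    · have hX : (⟨n - 1 - j, hlt⟩ : Fin n) ∈ X := by rw [← hmem]; omega
      rw [if_pos hX] at hsucc
      simp [hn', hvj, hpv, harg', hlow, hB, hB0, hcap', hF, hb.symm]
      exact ⟨by rw [hle]; omega, hnext _ (by simp [hX]), by omega⟩
  · rintro h' ⟨hF, -, hbits, ht⟩ -
    exact ⟨Conf.frame_tick.2 hF, fun v => hbits v (by omega), by simp; omega⟩

theorem wp_encode {b : Arr} {x : Var} (hx : x ≠ .res ∧ x ≠ .j) {X : Finset (Fin n)}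
    (hn : h.v x = n) (hpw : ∀ i < n, h.a .pw i = 2 ^ i) (hX : ∀ v : Fin n, 0 < h.a b v ↔ v ∈ X)
    (hcap : n < cap) (hB : 2 ^ n < B) :
    (encode b x).wp 15 B cap (fun h' => h.Frame [.j, .res] [] h' ∧ h'.v .res = code X ∧
      h'.t ≤ h.t + (3 * n + 3)) h := by
  have hB0 : 0 < B := by have := Nat.two_pow_pos n; omega
  refine ⟨hB0, hB0, fun j h' => h.Frame [.j, .res] [] h' ∧
    h'.v .res = lowCode X j ∧ h'.t ≤ h.t + (3 * j + 2), n, ?_, ?_, ?_, ?_, ?_⟩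
  · simp
  · have := h.frame_refl [.j, .res] []
    simp [this, lowCode_zero]
  · intro i h' _ hI _
    exact ⟨trivial, (hI.1.var x (by simp [hx])).trans hn⟩
  · rintro j h' hj ⟨hF, hres, ht⟩ hvj
    have hpv : h'.a .pw j = 2 ^ j := by rw [hF.arr .pw (by simp), hpw _ hj]
    have hsucc := lowCode_succ X hj
    have hlt := lowCode_lt X (r := j + 1) hj
    have hle : 2 ^ (j + 1) ≤ 2 ^ n := Nat.pow_le_pow_right (by omega) hj
    have hmem := hX ⟨j, hj⟩
    rw [← hF.arr b (by simp)] at hmem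
    have hcap' : j < cap := by omega
    by_cases hpos : 0 < h'.a b j
    · rw [if_pos (hmem.1 hpos)] at hsucc
      simp [hvj, hpv, hres, hF, hB0, hcap', hpos]
      omega
    · rw [if_neg fun hc => hpos (hmem.2 hc)] at hsucc
      simp [hvj, hres, hF, hB0, hcap', hpos]
      omega
  · rintro h' ⟨hF, hres, ht⟩ -
    exact ⟨Conf.frame_tick.2 hF, by rw [← lowCode_self]; exact hres, by simp; omega⟩

end Conversion

/-! ### Breadth-first computation of attractors -/

/-- The edges, numbered in the order of their targets: the edge `e` goes from `src e` to `dst e`,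
and the edges with target `v` are those with `start v ≤ e < start (v + 1)`. -/
structure IsEdgeTable {n : ℕ} (E : Finset (Fin n × Fin n)) (m : ℕ) (src dst start : ℕ → ℕ) :
    Prop where
  src_lt : ∀ e < m, src e < n
  dst_lt : ∀ e < m, dst e < n
  mem_iff : ∀ u v : Fin n, (u, v) ∈ E ↔ ∃ e < m, src e = u ∧ dst e = v
  dst_eq_iff : ∀ e < m, ∀ v < n, dst e = v ↔ start v ≤ e ∧ e < start (v + 1)
  start_le : ∀ v < n, start v ≤ start (v + 1)
  start_succ_le : ∀ v < n, start (v + 1) ≤ m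

/-- The number `c` is a position in `X`. -/
def InSet {n : ℕ} (X : Finset (Fin n)) (c : ℕ) : Prop := ∃ y ∈ X, (y : ℕ) = c

theorem inSet_val {n : ℕ} {X : Finset (Fin n)} {y : Fin n} : InSet X y ↔ y ∈ X :=
  ⟨fun ⟨_, hz, h⟩ => Fin.ext h ▸ hz, fun h => ⟨y, h, rfl⟩⟩

open Classical in
/-- The number of edges from the position `v` to positions in `X` that do not belong to `D`. -/
noncomputable def outDegree {n : ℕ} (m : ℕ) (src dst : ℕ → ℕ) (X : Finset (Fin n)) (D : Finset ℕ)
    (v : ℕ) : ℕ :=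
  ((Finset.range m).filter fun e => e ∉ D ∧ src e = v ∧ InSet X (dst e)).card

/-- The state of the search for the attractor of `T` in the arena `A(X)`: the list `qs` of the
positions found so far, the set `D` of the edges already examined, and for each position that has
not been found, the number `cnt` of edges that have to be examined before it is found. This number
is `1` for positions of Player `σ`, and the number of remaining edges for the other positions. -/
structure SearchState {n : ℕ} (A : PseudoArena (Fin n)) (σ : Fin 2) (X T : Finset (Fin n)) (m : ℕ)
    (src dst : ℕ → ℕ) (D : Finset ℕ) (cnt : ℕ → ℕ) (qs : List (Fin n)) : Prop where
  nodup : qs.Nodup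
  mem_X : ∀ v ∈ qs, v ∈ X
  cnt_eq_zero : ∀ v : Fin n, cnt v = 0 ↔ v ∉ X ∨ v ∈ qs
  target : ∀ v ∈ T, v ∈ qs
  own : ∀ v ∈ X, v ∉ qs → v ∈ A.pos σ → cnt v = 1 ∧ ∀ e ∈ D, src e ≠ v
  opponent : ∀ v ∈ X, v ∉ qs → v ∉ A.pos σ → cnt v = outDegree m src dst X D v
  rank : ∀ j, (hj : j < qs.length) → qs[j] ∉ T →
    (qs[j] ∈ A.pos σ → ∃ y ∈ qs.take j, (qs[j], y) ∈ A.E) ∧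
    (qs[j] ∉ A.pos σ → ∀ y ∈ X, (qs[j], y) ∈ A.E → y ∈ qs.take j)
  examined : ∀ e ∈ D, e < m ∧ ∃ y ∈ qs, dst e = y

section Search

variable {n m : ℕ} {A : PseudoArena (Fin n)} {σ : Fin 2} {X T : Finset (Fin n)}
  {src dst start cnt : ℕ → ℕ} {D : Finset ℕ} {qs : List (Fin n)}

theorem outDegree_insert {e v : ℕ} (he : e < m) (hD : e ∉ D) (hX : InSet X (dst e)) :
    outDegree m src dst X (insert e D) v + (if src e = v then 1 else 0) =
      outDegree m src dst X D v := by
  classical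
  unfold outDegree
  split_ifs with hv
  · have : ((Finset.range m).filter fun e' => e' ∉ D ∧ src e' = v ∧ InSet X (dst e')) =
        insert e ((Finset.range m).filter
          fun e' => e' ∉ insert e D ∧ src e' = v ∧ InSet X (dst e')) := by
      ext e'
      simp only [Finset.mem_filter, Finset.mem_range, Finset.mem_insert]
      by_cases h : e' = e
      · subst h
        simp [he, hD, hX, hv]
      · simp [h]
    rw [this, Finset.card_insert_of_notMem (by simp)]
  · rw [add_zero]
    congr 1
    ext e'
    simp only [Finset.mem_filter, Finset.mem_range, Finset.mem_insert]
    by_cases h : e' = e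
    · subst h
      simp [hv]
    · simp [h]

/-- Examination of an edge whose source is outside `X` or has already been found. -/
theorem SearchState.skip (h : SearchState A σ X T m src dst D cnt qs) {e : ℕ} {u x : Fin n}
    (he : e < m) (hD : e ∉ D) (hx : x ∈ qs) (hdst : dst e = x) (hsrc : src e = u)
    (hu : cnt u = 0) : SearchState A σ X T m src dst (insert e D) cnt qs := by
  have hX : InSet X (dst e) := hdst ▸ inSet_val.2 (h.mem_X x hx)
  have hne : ∀ v ∈ X, v ∉ qs → src e ≠ v := by
    intro v hv hvq hc
    have : v = u := Fin.ext (by omega)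
    subst this
    rcases (h.cnt_eq_zero v).1 hu with h' | h'
    exacts [h' hv, hvq h']
  refine ⟨h.nodup, h.mem_X, h.cnt_eq_zero, h.target, fun v hv hvq hp => ?_, fun v hv hvq hp => ?_,
    h.rank, fun e' he' => ?_⟩
  · refine ⟨(h.own v hv hvq hp).1, fun e' he' => ?_⟩
    rcases Finset.mem_insert.1 he' with rfl | he'
    exacts [hne v hv hvq, (h.own v hv hvq hp).2 e' he']
  · have := outDegree_insert (src := src) (v := v) he hD hX
    rw [if_neg (hne v hv hvq), add_zero] at this
    rw [this]
    exact h.opponent v hv hvq hp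
  · rcases Finset.mem_insert.1 he' with rfl | he'
    exacts [⟨he, x, hx, hdst⟩, h.examined e' he']

/-- Examination of an edge whose source needs the examination of further edges. -/
theorem SearchState.decrement (h : SearchState A σ X T m src dst D cnt qs) {e : ℕ} {u x : Fin n}
    (he : e < m) (hD : e ∉ D) (hx : x ∈ qs) (hdst : dst e = x) (hsrc : src e = u)
    (hu : 1 < cnt u) :
    SearchState A σ X T m src dst (insert e D) (Function.update cnt u (cnt u - 1)) qs := by
  have hX : InSet X (dst e) := hdst ▸ inSet_val.2 (h.mem_X x hx)
  have hupd : ∀ v : Fin n, v ≠ u → Function.update cnt u (cnt u - 1) v = cnt v := fun v hv =>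
    Function.update_of_ne (fun hc => hv (Fin.ext hc)) ..
  refine ⟨h.nodup, h.mem_X, fun v => ?_, h.target, fun v hv hvq hp => ?_, fun v hv hvq hp => ?_,
    h.rank, fun e' he' => ?_⟩
  · rw [← h.cnt_eq_zero]
    by_cases hv : v = u
    · subst hv
      rw [Function.update_self]
      omega
    · rw [hupd v hv]
  · obtain ⟨h1, h2⟩ := h.own v hv hvq hp
    have hvu : v ≠ u := by rintro rfl; omega
    refine ⟨by rw [hupd v hvu, h1], fun e' he' => ?_⟩
    rcases Finset.mem_insert.1 he' with rfl | he'
    · rw [hsrc]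
      exact fun hc => hvu (Fin.ext hc.symm)
    · exact h2 e' he'
  · have h1 := outDegree_insert (src := src) (v := v) he hD hX
    rw [← h.opponent v hv hvq hp] at h1
    by_cases hvu : v = u
    · subst hvu
      rw [if_pos hsrc] at h1
      rw [Function.update_self]
      omega
    · rw [if_neg (by rw [hsrc]; exact fun hc => hvu (Fin.ext hc.symm))] at h1
      rw [hupd v hvu]
      omega
  · rcases Finset.mem_insert.1 he' with rfl | he'
    exacts [⟨he, x, hx, hdst⟩, h.examined e' he']

/-- Examination of the edge by which its source is found. -/
theorem SearchState.push (hE : IsEdgeTable A.E m src dst start)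
    (h : SearchState A σ X T m src dst D cnt qs) {e : ℕ} {u x : Fin n}
    (he : e < m) (hD : e ∉ D) (hx : x ∈ qs) (hdst : dst e = x) (hsrc : src e = u)
    (hu : cnt u = 1) :
    SearchState A σ X T m src dst (insert e D) (Function.update cnt u 0) (qs ++ [u]) := by
  classical
  have hX : InSet X (dst e) := hdst ▸ inSet_val.2 (h.mem_X x hx)
  have hupd : ∀ v : Fin n, v ≠ u → Function.update cnt u 0 v = cnt v := fun v hv =>
    Function.update_of_ne (fun hc => hv (Fin.ext hc)) ..
  have huX : ¬ (u ∉ X ∨ u ∈ qs) := by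
    rw [← h.cnt_eq_zero]
    omega
  push Not at huX
  refine ⟨?_, fun v hv => ?_, fun v => ?_, fun v hv => List.mem_append_left _ (h.target v hv),
    fun v hv hvq hp => ?_, fun v hv hvq hp => ?_, fun j hj => ?_, fun e' he' => ?_⟩
  · rw [List.nodup_append]
    refine ⟨h.nodup, List.nodup_singleton u, ?_⟩
    intro a ha b hb hab
    rw [List.mem_singleton] at hb
    exact huX.2 (hb ▸ hab ▸ ha)
  · rcases List.mem_append.1 hv with hv | hv
    · exact h.mem_X v hv
    · rw [List.mem_singleton.1 hv]
      exact huX.1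
  · by_cases hv : v = u
    · subst hv
      simp
    · rw [hupd v hv, h.cnt_eq_zero]
      simp [hv]
  · rw [List.mem_append, not_or, List.mem_singleton] at hvq
    obtain ⟨h1, h2⟩ := h.own v hv hvq.1 hp
    refine ⟨by rw [hupd v hvq.2, h1], fun e' he' => ?_⟩
    rcases Finset.mem_insert.1 he' with rfl | he'
    · rw [hsrc]
      exact fun hc => hvq.2 (Fin.ext hc.symm)
    · exact h2 e' he'
  · rw [List.mem_append, not_or, List.mem_singleton] at hvq
    have h1 := outDegree_insert (src := src) (v := v) he hD hX
    rw [if_neg (by rw [hsrc]; exact fun hc => hvq.2 (Fin.ext hc.symm)), add_zero] at h1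
    rw [hupd v hvq.2, h1]
    exact h.opponent v hv hvq.1 hp
  · rcases Nat.lt_or_ge j qs.length with hlt | hge
    · rw [List.getElem_append_left hlt, List.take_append_of_le_length hlt.le]
      exact h.rank j hlt
    · have hj' : j = qs.length := by
        simp at hj
        omega
      subst hj'
      simp only [List.getElem_concat_length, List.take_left']
      refine fun _ => ⟨fun hp => ⟨x, hx, (hE.mem_iff u x).2 ⟨e, he, hsrc, hdst⟩⟩,
        fun hp y hy hyE => ?_⟩
      -- The edge `e` is the last edge from `u` to `X` that is examined.
      obtain ⟨e', he', hs', hd'⟩ := (hE.mem_iff u y).1 hyE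
      have hcard := h.opponent u huX.1 huX.2 hp
      rw [hu, outDegree] at hcard
      obtain ⟨e₀, he₀⟩ := Finset.card_eq_one.1 hcard.symm
      have h1 : e = e₀ := by
        rw [← Finset.mem_singleton, ← he₀, Finset.mem_filter]
        exact ⟨Finset.mem_range.2 he, hD, hsrc, hX⟩
      by_cases hD' : e' ∈ D
      · obtain ⟨z, hz, hzd⟩ := (h.examined e' hD').2
        rwa [Fin.ext (hd'.symm.trans hzd)]
      · have h2 : e' = e₀ := by
          rw [← Finset.mem_singleton, ← he₀, Finset.mem_filter]
          exact ⟨Finset.mem_range.2 he', hD', hs', hd' ▸ inSet_val.2 hy⟩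
        have : y = x := Fin.ext (by rw [← hd', ← hdst, h1, h2])
        rwa [this]
  · rcases Finset.mem_insert.1 he' with rfl | he'
    · exact ⟨he, x, List.mem_append_left _ hx, hdst⟩
    · obtain ⟨h1, y, hy, h2⟩ := h.examined e' he'
      exact ⟨h1, y, List.mem_append_left _ hy, h2⟩

/-- When all edges into the set of the positions found have been examined, this set is the
attractor. -/
theorem SearchState.isAttractor (hE : IsEdgeTable A.E m src dst start)
    (hX : X ⊆ A.V) (hXA : (A.restrict X).IsArena)
    (h : SearchState A σ X T m src dst D cnt qs) (hD : ∀ e < m, ∀ y ∈ qs, dst e = y → e ∈ D) :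
    (A.restrict X).IsAttractor σ T qs.toFinset := by
  classical
  refine ⟨fun v hv => List.mem_toFinset.2 (h.target v hv), fun v hv => ?_,
    ⟨fun v => qs.idxOf v, fun u hu hT => ?_⟩, fun u hu huY y hy hyY => ?_, fun u hu huY => ?_⟩
  · have := h.mem_X v (List.mem_toFinset.1 hv)
    rw [PseudoArena.V_restrict]
    exact Finset.mem_inter.2 ⟨hX this, this⟩
  · rw [List.mem_toFinset] at hu
    have hlt := List.idxOf_lt_length_of_mem hu
    have hget : qs[qs.idxOf u] = u := List.getElem_idxOf hlt
    have htake : ∀ y ∈ qs.take (qs.idxOf u), y ∈ qs.toFinset ∧ qs.idxOf y < qs.idxOf u := by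
      intro y hy
      obtain ⟨j, hj, hjy⟩ := List.mem_iff_getElem.1 hy
      rw [List.length_take] at hj
      rw [List.getElem_take] at hjy
      refine ⟨List.mem_toFinset.2 (List.mem_of_mem_take hy), ?_⟩
      rw [← hjy, h.nodup.idxOf_getElem]
      omega
    have hr := h.rank _ hlt (by rwa [hget])
    rw [hget] at hr
    have huX := h.mem_X u hu
    refine ⟨fun hp => ?_, fun hp y hy => ?_⟩
    · obtain ⟨y, hy, hyE⟩ := hr.1 (PseudoArena.mem_pos_restrict.1 hp).1
      have hyq := htake y hy
      exact ⟨y, hyq.1, PseudoArena.mem_E_restrict.2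
        ⟨hyE, huX, h.mem_X y (List.mem_toFinset.1 hyq.1)⟩, hyq.2⟩
    · have hpn : u ∉ A.pos σ := fun hc =>
        hXA.notMem_opponent (PseudoArena.mem_pos_restrict.2 ⟨hc, huX⟩) hp
      rw [PseudoArena.mem_E_restrict] at hy
      exact htake y (hr.2 hpn y hy.2.2 hy.1)
  · rw [PseudoArena.mem_pos_restrict] at hu
    rw [List.mem_toFinset] at huY hyY
    obtain ⟨e, he, hs, hd⟩ := (hE.mem_iff u y).1 (PseudoArena.mem_E_restrict.1 hy).1
    exact (h.own u hu.2 huY hu.1).2 e (hD e he y hyY hd) hs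
  · have hpn : u ∉ A.pos σ := fun hc => hXA.notMem_opponent
      (PseudoArena.mem_pos_restrict.2 ⟨hc, (PseudoArena.mem_pos_restrict.1 hu).2⟩) hu
    rw [PseudoArena.mem_pos_restrict] at hu
    rw [List.mem_toFinset] at huY
    have hc := h.opponent u hu.2 huY hpn
    have h0 : cnt u ≠ 0 := by
      rw [Ne, h.cnt_eq_zero]
      tauto
    rw [hc, outDegree] at h0
    obtain ⟨e, he⟩ := Finset.card_pos.1 (Nat.pos_of_ne_zero h0)
    simp only [Finset.mem_filter, Finset.mem_range] at he
    obtain ⟨hem, heD, hs, y, hyX, hyd⟩ := he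
    refine ⟨y, PseudoArena.mem_E_restrict.2
      ⟨(hE.mem_iff u y).2 ⟨e, hem, hs, hyd.symm⟩, hu.2, hyX⟩, fun hyq => ?_⟩
    exact heD (hD e hem y (List.mem_toFinset.1 hyq) hyd.symm)

/-- The search begins with the positions of the target set. -/
theorem SearchState.init (hE : IsEdgeTable A.E m src dst start)
    (hX : X ⊆ A.V) (hXA : (A.restrict X).IsArena) (hT : T ⊆ X) (hq : qs.Nodup)
    (hqT : ∀ v, v ∈ qs ↔ v ∈ T)
    (hcnt : ∀ v : Fin n, cnt v = if v ∈ X then if v ∈ T then 0 else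
      if v ∈ A.pos σ then 1 else outDegree m src dst X ∅ v else 0) :
    SearchState A σ X T m src dst ∅ cnt qs := by
  classical
  refine ⟨hq, fun v hv => hT ((hqT v).1 hv), fun v => ?_, fun v hv => (hqT v).2 hv,
    fun v hv hvq hp => ⟨?_, by simp⟩, fun v hv hvq hp => ?_, fun j hj hjT => ?_, by simp⟩
  · rw [hcnt, hqT]
    by_cases hvX : v ∈ X
    · by_cases hvT : v ∈ T
      · simp [hvT]
      · have hdeg : outDegree m src dst X ∅ v ≠ 0 := by
          obtain ⟨y, hy⟩ := hXA.2.2 v (by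
            rw [PseudoArena.V_restrict]
            exact Finset.mem_inter.2 ⟨hX hvX, hvX⟩)
          rw [PseudoArena.mem_E_restrict] at hy
          obtain ⟨e, he, hs, hd⟩ := (hE.mem_iff v y).1 hy.1
          refine (Finset.card_pos.2 ⟨e, ?_⟩).ne'
          rw [Finset.mem_filter, Finset.mem_range]
          exact ⟨he, by simp, hs, hd ▸ inSet_val.2 hy.2.2⟩
        by_cases hp : v ∈ A.pos σ <;> simp [hvX, hvT, hp, hdeg]
    · simp [hvX]
  · rw [hqT] at hvq
    rw [hcnt, if_pos hv, if_neg hvq, if_pos hp]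
  · rw [hqT] at hvq
    rw [hcnt, if_pos hv, if_neg hvq, if_neg hp]
  · exact absurd ((hqT _).1 (List.getElem_mem hj)) hjT

end Search

/-! ### The attractor program -/

/-- The bounds for the numbers of positions `n`, colours `k` and edges `m`, the capacity `cap` of the
arrays and the space bound `B`. -/
structure Bounds (n k m B cap : ℕ) : Prop where
  pos : 0 < n
  colours : k ≤ n
  header : 3 + 2 * n < cap
  edges : m < cap
  le_edges : n ≤ m
  pow : 2 * 2 ^ n < cap
  space : cap < B

/-- The arrays and variables that describe the game `G` have been set up. -/
structure Env {n k : ℕ} (G : ColouredMullerGame (Fin n) (Fin k)) (m : ℕ) (h : Conf) : Prop where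
  n_eq : h.v .n = n
  k_eq : h.v .k = k
  m_eq : h.v .m = m
  pow_eq : h.v .pow = 2 ^ n
  pw : ∀ i ≤ n, h.a .pw i = 2 ^ i
  owner : ∀ v : Fin n, h.a .input (3 + v) = if v ∈ G.A.pos 1 then 1 else 0
  colour : ∀ v : Fin n, h.a .input (3 + n + v) = G.c v
  fam : ∀ S : Finset (Fin k), h.a .fam (code S) = if S ∈ G.F 0 then 1 else 0
  edges : IsEdgeTable G.A.E m (h.a .src) (h.a .dst) (h.a .start)

theorem Env.frame {n k m : ℕ} {G : ColouredMullerGame (Fin n) (Fin k)} {h h' : Conf}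
    (hE : Env G m h) {xs : List Var} {bs : List Arr} (hF : h.Frame xs bs h')
    (hx : ∀ x ∈ [Var.n, .k, .m, .pow], x ∉ xs)
    (hb : ∀ b ∈ [Arr.pw, .input, .fam, .src, .dst, .start], b ∉ bs) : Env G m h' := by
  have h1 : ∀ x ∈ [Var.n, .k, .m, .pow], h'.v x = h.v x := fun x hx' => hF.var x (hx x hx')
  have h2 : ∀ b ∈ [Arr.pw, .input, .fam, .src, .dst, .start], h'.a b = h.a b :=
    fun b hb' => hF.arr b (hb b hb')
  simp only [List.mem_cons, List.not_mem_nil, or_false, forall_eq_or_imp, forall_eq] at h1 h2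
  obtain ⟨v1, v2, v3, v4⟩ := h1
  obtain ⟨a1, a2, a3, a4, a5, a6⟩ := h2
  refine ⟨?_, ?_, ?_, ?_, ?_, ?_, ?_, ?_, ?_⟩
  · rw [v1, hE.n_eq]
  · rw [v2, hE.k_eq]
  · rw [v3, hE.m_eq]
  · rw [v4, hE.pow_eq]
  · rw [a1]; exact hE.pw
  · rw [a2]; exact hE.owner
  · rw [a2]; exact hE.colour
  · rw [a3]; exact hE.fam
  · rw [a4, a5, a6]; exact hE.edges

/-- The owner of the position with the number in the variable `x`. -/
def ownerEx (x : Var) : Ex := .get .input (.add (.lit 3) (.var x))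

/-- Initialise the counters and the queue of the search for the attractor of `tgt` for the player
`pl`. The owner of a position is compared with `pl` by means of the sum of the two truncated
differences. -/
def initSearch : Cmd :=
  .set .tail (.lit 0) ;; .set .j (.lit 0) ;;
  .loop .j (.var .n) (.ite (.lit 0) (.get .inX (.var .j))
    (.ite (.lit 0) (.get .tgt (.var .j))
      (.put .cnt (.var .j) (.lit 0) ;; .put .queue (.var .tail) (.var .j) ;;
        .set .tail (.add (.var .tail) (.lit 1)))
      (.ite (.lit 0) (.add (.sub (ownerEx .j) (.var .pl)) (.sub (.var .pl) (ownerEx .j)))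
        (.put .cnt (.var .j) (.get .deg (.var .j)))
        (.put .cnt (.var .j) (.lit 1))))
    (.put .cnt (.var .j) (.lit 0)))

/-- Examine the edges with numbers from `e` to `hi`. -/
def examineEdges : Cmd :=
  .loop .e (.var .hi) (.set .u (.get .src (.var .e)) ;;
    .ite (.lit 0) (.get .cnt (.var .u))
      (.put .cnt (.var .u) (.sub (.get .cnt (.var .u)) (.lit 1)) ;;
        .ite (.lit 0) (.get .cnt (.var .u)) .skip
          (.put .queue (.var .tail) (.var .u) ;; .set .tail (.add (.var .tail) (.lit 1))))
      .skip)

/-- Examine the edges into the positions in the queue, one position after the other. -/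
def search : Cmd :=
  .set .i (.lit 0) ;;
  .loop .i (.var .n) (.ite (.var .i) (.var .tail)
    (.set .hi (.get .start (.add (.get .queue (.var .i)) (.lit 1))) ;;
      .set .e (.get .start (.get .queue (.var .i))) ;; examineEdges)
    .skip)

/-- Compute in `res` the number of the complement in `X` of the attractor, for the player `pl`, of
the set with the number `arg`. -/
def attract : Cmd := decode .tgt ;; initSearch ;; search ;; encode .cnt .n

/-- The cells of the array `a` below `tail` contain the list `qs`. -/
def IsQueue {n : ℕ} (a : ℕ → ℕ) (tail : ℕ) (qs : List (Fin n)) : Prop :=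
  tail = qs.length ∧ ∀ j, (hj : j < qs.length) → a j = qs[j]

theorem IsQueue.push {n : ℕ} {a : ℕ → ℕ} {tail : ℕ} {qs : List (Fin n)} (h : IsQueue a tail qs)
    {u : Fin n} : IsQueue (Function.update a tail u) (tail + 1) (qs ++ [u]) := by
  refine ⟨by simp [h.1], fun j hj => ?_⟩
  rcases Nat.lt_or_ge j qs.length with hlt | hge
  · rw [Function.update_of_ne (by have := h.1; omega), h.2 j hlt, List.getElem_append_left hlt]
  · have hj' : j = qs.length := by
      simp at hj
      omega
    subst hj'
    simp [h.1]

section Attract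

variable {n k m B cap : ℕ} {G : ColouredMullerGame (Fin n) (Fin k)} {σ : Fin 2}
  {X T : Finset (Fin n)} {h : Conf}

theorem length_le_of_nodup {qs : List (Fin n)} (h : qs.Nodup) : qs.length ≤ n := by
  simpa using h.length_le_card

theorem wp_initSearch (hB : Bounds n k m B cap) (hE : Env G m h) (hXV : X ⊆ G.A.V)
    (hXA : (G.A.restrict X).IsArena) (hTX : T ⊆ X) (hX : IsBits (h.a .inX) X)
    (hT : IsBits (h.a .tgt) T) (hpl : h.v .pl = σ)
    (hdeg : ∀ v ∈ X, h.a .deg v = outDegree m (h.a .src) (h.a .dst) X ∅ v) :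
    initSearch.wp 15 B cap (fun h' => h.Frame [.tail, .j] [.cnt, .queue] h' ∧
      (∃ qs, IsQueue (h'.a .queue) (h'.v .tail) qs ∧
        SearchState G.A σ X T m (h.a .src) (h.a .dst) ∅ (h'.a .cnt) qs) ∧
      h'.t ≤ h.t + (7 * n + 3)) h := by
  classical
  have hn2 := Nat.lt_two_pow_self (n := n)
  have h1 := hB.pow
  have h2 := hB.space
  have hdr := hB.header
  have hB0 : 0 < B := by omega
  have hB1 : 1 < B := by omega
  have hB3 : 3 < B := by omega
  have hnpos := hB.pos
  refine ⟨hB0, hB0, fun j h' => h.Frame [.tail, .j] [.cnt, .queue] h' ∧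
    (∃ qs : List (Fin n), IsQueue (h'.a .queue) (h'.v .tail) qs ∧ qs.Nodup ∧
      ∀ v, v ∈ qs ↔ v ∈ T ∧ (v : ℕ) < j) ∧
    (∀ v : Fin n, (v : ℕ) < j → h'.a .cnt v = if v ∈ X then if v ∈ T then 0 else
      if v ∈ G.A.pos σ then 1 else outDegree m (h.a .src) (h.a .dst) X ∅ v else 0) ∧
    h'.t ≤ h.t + (7 * j + 2), n, ?_, ?_, ?_, ?_, ?_⟩
  · simp
  · have := h.frame_refl [.tail, .j] [.cnt, .queue]
    simp [this]
    exact ⟨[], by simp [IsQueue], by simp, by simp⟩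
  · intro i h' _ hI _
    exact ⟨trivial, (hI.1.var .n (by simp)).trans hE.n_eq⟩
  · rintro j h' hj ⟨hF, ⟨qs, hq, hnd, hqT⟩, hcnt, ht⟩ hvj
    have hpl' : h'.v .pl = σ := (hF.var .pl (by simp)).trans hpl
    have hXj := hX ⟨j, hj⟩
    have hTj := hT ⟨j, hj⟩
    have how := hE.owner ⟨j, hj⟩
    rw [← hF.arr .inX (by simp)] at hXj
    rw [← hF.arr .tgt (by simp)] at hTj
    rw [← hF.arr .input (by simp)] at how
    simp only at hXj hTj how
    have hjc : j < cap := by omega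
    have hj3 : 3 + j < cap := by omega
    have hj3' : 3 + j < B := by omega
    have hlen := length_le_of_nodup hnd
    have htail := hq.1
    have htc : h'.v .tail < cap := by omega
    have htB : h'.v .tail + 1 < B := by omega
    have hqT' : (⟨j, hj⟩ : Fin n) ∉ T → ∀ v, v ∈ qs ↔ v ∈ T ∧ (v : ℕ) ≤ j := by
      intro hjT v
      rw [hqT]
      refine and_congr_right fun hv => ?_
      have : (v : ℕ) ≠ j := fun hc => hjT (by rwa [← Fin.ext (a := v) (b := ⟨j, hj⟩) hc])
      omega
    have hcnt' : ∀ c : ℕ, (c = if (⟨j, hj⟩ : Fin n) ∈ X then if (⟨j, hj⟩ : Fin n) ∈ T then 0 else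
        if (⟨j, hj⟩ : Fin n) ∈ G.A.pos σ then 1 else outDegree m (h.a .src) (h.a .dst) X ∅ j
        else 0) → ∀ v : Fin n, (v : ℕ) ≤ j → Function.update (h'.a .cnt) j c v =
        if v ∈ X then if v ∈ T then 0 else
          if v ∈ G.A.pos σ then 1 else outDegree m (h.a .src) (h.a .dst) X ∅ v else 0 := by
      intro c hc v hv
      by_cases hvj : (v : ℕ) = j
      · obtain rfl : v = ⟨j, hj⟩ := Fin.ext hvj
        rw [Function.update_self, hc]
      · rw [Function.update_of_ne hvj]
        exact hcnt v (by omega)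
    by_cases hjX : (⟨j, hj⟩ : Fin n) ∈ X
    · rw [if_pos hjX] at hXj
      by_cases hjT : (⟨j, hj⟩ : Fin n) ∈ T
      · rw [if_pos hjT] at hTj
        simp [hvj, hXj, hTj, hF, hB0, hB1, hjc, htc, htB]
        refine ⟨⟨qs ++ [⟨j, hj⟩], hq.push, ?_, fun v => ?_⟩, hcnt' 0 (by simp [hjX, hjT]),
          by omega⟩
        · rw [List.nodup_append]
          refine ⟨hnd, List.nodup_singleton _, ?_⟩
          intro a ha b hb hab
          rw [List.mem_singleton] at hb
          subst hab
          subst hb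
          have := ((hqT _).1 ha).2
          simp at this
        · rw [List.mem_append, hqT, List.mem_singleton]
          constructor
          · rintro (⟨h1, h2⟩ | rfl)
            · exact ⟨h1, by omega⟩
            · exact ⟨hjT, by simp⟩
          · rintro ⟨h1, h2⟩
            by_cases hvj : (v : ℕ) = j
            · exact Or.inr (Fin.ext hvj)
            · exact Or.inl ⟨h1, by omega⟩
      · rw [if_neg hjT] at hTj
        by_cases hp : (⟨j, hj⟩ : Fin n) ∈ G.A.pos σ
        · -- The owner of the position is Player `σ`.
          have howner : h'.a .input (3 + j) = σ := by
            rw [how]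
            have hV := PseudoArena.mem_pos_restrict.2 ⟨hp, hjX⟩
            have hno := hXA.notMem_opponent hV
            rw [PseudoArena.mem_pos_restrict] at hno
            fin_cases σ
            · exact if_neg fun hc => hno ⟨hc, hjX⟩
            · exact if_pos hp
          simp [hvj, hXj, hTj, hF, hB0, hB1, hB3, hjc, hj3, hj3', hpl', howner, ownerEx]
          exact ⟨⟨qs, hq, hnd, hqT' hjT⟩, hcnt' 1 (by simp [hjX, hjT, hp]), by omega⟩
        · have howner : h'.a .input (3 + j) ≤ 1 ∧ (σ : ℕ) ≤ 1 ∧ h'.a .input (3 + j) ≠ σ := by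
            rw [how]
            have hV := hXV hjX
            rw [PseudoArena.mem_V_iff σ] at hV
            have := hV.resolve_left hp
            fin_cases σ
            · have : (⟨j, hj⟩ : Fin n) ∈ G.A.pos 1 := this
              simp [this]
            · have hp : (⟨j, hj⟩ : Fin n) ∉ G.A.pos 1 := hp
              simp [hp]
          have hd : h'.a .deg j = outDegree m (h.a .src) (h.a .dst) X ∅ j := by
            rw [hF.arr .deg (by simp)]
            exact hdeg ⟨j, hj⟩ hjX
          have hlt : h'.a .input (3 + j) < (σ : ℕ) ∨ (σ : ℕ) < h'.a .input (3 + j) := by omega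
          have hlt' : h'.a .input (3 + j) - (σ : ℕ) + ((σ : ℕ) - h'.a .input (3 + j)) < B := by
            omega
          have hlt'' : 0 < h'.a .input (3 + j) - (σ : ℕ) + ((σ : ℕ) - h'.a .input (3 + j)) := by
            omega
          simp [hvj, hXj, hTj, hF, hB0, hB3, hjc, hj3, hj3', hpl', hd, ownerEx, -Nat.add_eq_zero_iff,
            -add_pos_iff, -tsub_pos_iff_lt, hlt', hlt'']
          exact ⟨⟨qs, hq, hnd, hqT' hjT⟩, hcnt' _ (by simp [hjX, hjT, hp]), by omega⟩
    · rw [if_neg hjX] at hXj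
      simp [hvj, hXj, hF, hB0, hjc]
      exact ⟨⟨qs, hq, hnd, hqT' fun hc => hjX (hTX hc)⟩, hcnt' 0 (by simp [hjX]), by omega⟩
  · rintro h' ⟨hF, ⟨qs, hq, hnd, hqT⟩, hcnt, ht⟩ -
    refine ⟨Conf.frame_tick.2 hF, ⟨qs, hq, ?_⟩, by simp; omega⟩
    exact SearchState.init hE.edges hXV hXA hTX hnd (fun v => by rw [hqT]; simp)
      fun v => hcnt v v.2

/-- The running time is amortised: `8` steps are charged to each edge that is newly examined. -/
theorem wp_examineEdges (hB : Bounds n k m B cap) (hE : Env G m h) {qs₀ : List (Fin n)}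
    {i : ℕ} (hi : i < qs₀.length) {D₀ : Finset ℕ} (he : h.v .e = h.a .start qs₀[i])
    (hhi : h.v .hi = h.a .start (qs₀[i] + 1))
    (hq : IsQueue (h.a .queue) (h.v .tail) qs₀)
    (hS : SearchState G.A σ X T m (h.a .src) (h.a .dst) D₀ (h.a .cnt) qs₀)
    (hD : ∀ e < m, e ∈ D₀ ↔ ∃ y ∈ qs₀.take i, h.a .dst e = y) :
    examineEdges.wp 15 B cap (fun h' => h.Frame [.e, .u, .tail] [.cnt, .queue] h' ∧
      (∃ qs D, IsQueue (h'.a .queue) (h'.v .tail) qs ∧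
        SearchState G.A σ X T m (h.a .src) (h.a .dst) D (h'.a .cnt) qs ∧
        (∀ e < m, e ∈ D ↔ ∃ y ∈ qs.take (i + 1), h.a .dst e = y) ∧
        h'.t + 8 * D₀.card ≤ h.t + 8 * D.card + 1)) h := by
  classical
  have hn2 := Nat.lt_two_pow_self (n := n)
  have h1 := hB.pow
  have h2 := hB.space
  have hm := hB.edges
  have hB0 : 0 < B := by omega
  have hB1 : 1 < B := by omega
  have hx := qs₀[i].2
  refine ⟨fun e h' => h.Frame [.e, .u, .tail] [.cnt, .queue] h' ∧
    ∃ qs D, qs₀ <+: qs ∧ IsQueue (h'.a .queue) (h'.v .tail) qs ∧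
      SearchState G.A σ X T m (h.a .src) (h.a .dst) D (h'.a .cnt) qs ∧
      (∀ e' < m, e' ∈ D ↔ (∃ y ∈ qs₀.take i, h.a .dst e' = y) ∨
        (h.a .dst e' = qs₀[i] ∧ e' < e)) ∧
      h.a .start qs₀[i] ≤ e ∧
      h'.t + 8 * D₀.card ≤ h.t + 8 * D.card, h.a .start (qs₀[i] + 1), ?_, ?_, ?_, ?_, ?_⟩
  · rw [he]
    exact hE.edges.start_le _ hx
  · refine ⟨h.frame_refl _ _, qs₀, D₀, List.prefix_rfl, hq, hS, fun e' he' => ?_, he.ge, le_rfl⟩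
    rw [hD e' he', iff_self_or]
    rintro ⟨h3, h4⟩
    have := ((hE.edges.dst_eq_iff e' he' _ hx).1 h3).1
    omega
  · intro e h' _ hI _
    exact ⟨trivial, (hI.1.var .hi (by simp)).trans hhi⟩
  · rintro e h' hlt ⟨hF, qs, D, hpre, hq', hS', hD', hse, ht⟩ hve
    have hem : e < m := hlt.trans_le (hE.edges.start_succ_le _ hx)
    have hdst : h.a .dst e = qs₀[i] := (hE.edges.dst_eq_iff e hem _ hx).2 ⟨hse, hlt⟩
    have hxq : qs₀[i] ∈ qs := hpre.subset (List.getElem_mem hi)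
    have heD : e ∉ D := by
      rw [hD' e hem]
      rintro (⟨y, hy, hyd⟩ | ⟨-, h4⟩)
      · obtain ⟨j, hj, hjy⟩ := List.mem_iff_getElem.1 hy
        rw [List.length_take] at hj
        rw [List.getElem_take] at hjy
        have : qs₀[j] = qs₀[i] := by
          rw [hjy]
          exact Fin.ext (hyd.symm.trans hdst)
        have := (hS.nodup.getElem_inj_iff).1 this
        omega
      · omega
    have hD'' : ∀ e' < m, e' ∈ insert e D ↔ (∃ y ∈ qs₀.take i, h.a .dst e' = y) ∨
        (h.a .dst e' = qs₀[i] ∧ e' ≤ e) := by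
      intro e' he'
      rw [Finset.mem_insert, hD' e' he']
      constructor
      · rintro (rfl | h3 | ⟨h3, h4⟩)
        · exact Or.inr ⟨hdst, by omega⟩
        · exact Or.inl h3
        · exact Or.inr ⟨h3, by omega⟩
      · rintro (h3 | ⟨h3, h4⟩)
        · exact Or.inr (Or.inl h3)
        · rcases Nat.lt_or_eq_of_le h4 with h5 | h5
          · exact Or.inr (Or.inr ⟨h3, h5⟩)
          · exact Or.inl h5
    have hcard : (insert e D).card = D.card + 1 := Finset.card_insert_of_notMem heD
    obtain ⟨u, hu⟩ : ∃ u : Fin n, h.a .src e = u := ⟨⟨_, hE.edges.src_lt e hem⟩, rfl⟩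
    have hu' : h'.a .src e = u := by rw [hF.arr .src (by simp), hu]
    have huc : (u : ℕ) < cap := by omega
    have hec : e < cap := by omega
    have hlen := length_le_of_nodup hS'.nodup
    have htail := hq'.1
    have htc : h'.v .tail < cap := by omega
    have htB : h'.v .tail + 1 < B := by omega
    by_cases h0 : h'.a .cnt u = 0
    · simp [hve, hu', hF, hB0, hec, huc, h0]
      exact ⟨qs, hpre, hq', _, hS'.skip hem heD hxq hdst hu h0, hD'', by omega, by omega⟩
    · have hpos : 0 < h'.a .cnt u := Nat.pos_of_ne_zero h0
      by_cases h1 : h'.a .cnt u = 1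
      · simp [hve, hu', hF, hB0, hB1, hec, huc, h1, htc, htB]
        exact ⟨_, hpre.trans (List.prefix_append _ _), hq'.push,
          _, hS'.push hE.edges hem heD hxq hdst hu h1, hD'', by omega, by omega⟩
      · have h1' : 1 < h'.a .cnt u := by omega
        simp [hve, hu', hF, hB0, hB1, hec, huc, hpos, h1']
        exact ⟨qs, hpre, hq', _, hS'.decrement hem heD hxq hdst hu h1', hD'', by omega, by omega⟩
  · rintro h' ⟨hF, qs, D, hpre, hq', hS', hD', hse, ht⟩ -
    refine ⟨Conf.frame_tick.2 hF, qs, D, hq', hS', fun e hem => ?_, by simp; omega⟩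
    rw [hD' e hem]
    obtain ⟨r, rfl⟩ := hpre
    rw [List.take_append_of_le_length hi, List.take_succ_eq_append_getElem hi]
    simp only [List.mem_append, List.mem_singleton]
    constructor
    · rintro (⟨y, hy, hyd⟩ | ⟨hd, -⟩)
      · exact ⟨y, Or.inl hy, hyd⟩
      · exact ⟨_, Or.inr rfl, hd⟩
    · rintro ⟨y, hy | rfl, hyd⟩
      · exact Or.inl ⟨y, hy, hyd⟩
      · exact Or.inr ⟨hyd, ((hE.edges.dst_eq_iff e hem _ hx).1 hyd).2⟩

theorem wp_search (hB : Bounds n k m B cap) (hE : Env G m h) {qs₀ : List (Fin n)}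
    (hq : IsQueue (h.a .queue) (h.v .tail) qs₀)
    (hS : SearchState G.A σ X T m (h.a .src) (h.a .dst) ∅ (h.a .cnt) qs₀) :
    search.wp 15 B cap (fun h' => h.Frame [.i, .hi, .e, .u, .tail] [.cnt, .queue] h' ∧
      (∃ qs D, SearchState G.A σ X T m (h.a .src) (h.a .dst) D (h'.a .cnt) qs ∧
        ∀ e < m, ∀ y ∈ qs, h.a .dst e = y → e ∈ D) ∧
      h'.t ≤ h.t + (7 * n + 8 * m + 2)) h := by
  have hn2 := Nat.lt_two_pow_self (n := n)
  have h1 := hB.pow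
  have h2 := hB.space
  have hm := hB.edges
  have hB0 : 0 < B := by omega
  have hB1 : 1 < B := by omega
  refine ⟨hB0, fun i h' => h.Frame [.i, .hi, .e, .u, .tail] [.cnt, .queue] h' ∧
    ∃ qs D, IsQueue (h'.a .queue) (h'.v .tail) qs ∧
      SearchState G.A σ X T m (h.a .src) (h.a .dst) D (h'.a .cnt) qs ∧
      (∀ e < m, e ∈ D ↔ ∃ y ∈ qs.take i, h.a .dst e = y) ∧
      h'.t ≤ h.t + (7 * i + 8 * D.card + 1), n, ?_, ?_, ?_, ?_, ?_⟩
  · simp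
  · have := h.frame_refl [.i, .hi, .e, .u, .tail] [.cnt, .queue]
    simp [this]
    exact ⟨qs₀, hq, ∅, hS, by simp⟩
  · intro i h' _ hI _
    exact ⟨trivial, (hI.1.var .n (by simp)).trans hE.n_eq⟩
  · rintro i h' hi ⟨hF, qs, D, hq', hS', hD, ht⟩ hvi
    have hE' := hE.frame hF (by decide) (by decide)
    by_cases hlt : i < qs.length
    · have htail := hq'.1
      have hqi := hq'.2 i hlt
      have hx := qs[i].2
      have hs1 : h'.a .start = h.a .start := hF.arr .start (by simp)
      have hs2 : h'.a .src = h.a .src := hF.arr .src (by simp)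
      have hs3 : h'.a .dst = h.a .dst := hF.arr .dst (by simp)
      have hic : i < cap := by omega
      have hxc : (qs[i] : ℕ) + 1 < cap := by omega
      have hxc' : (qs[i] : ℕ) < cap := by omega
      have hxB : (qs[i] : ℕ) + 1 < B := by omega
      have hlt' : i < h'.v .tail := by omega
      simp only [Cmd.wp_ite, Cmd.wp_seq, Cmd.wp_set, Ex.Safe, Ex.eval, hvi, hlt', true_and,
        not_true_eq_false, false_imp_iff, and_true, forall_true_left, Conf.tick_v, Conf.tick_a,
        Conf.setV_a, hqi, hic, hxc, hxc', hxB, hB1, Arr.ctorIdx_lt, ne_eq, reduceCtorEq,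
        not_false_eq_true, Conf.setV_of_ne]
      set h'' := (h'.tick.setV Var.hi (h'.a Arr.start (qs[i] + 1))).setV Var.e
        (h'.a Arr.start qs[i]) with hh
      have hF2 : h'.Frame [.i, .hi, .e, .u, .tail] [.cnt, .queue] h'' := by
        simp [hh, h'.frame_refl]
      refine Cmd.wp_mono ?_ (wp_examineEdges (σ := σ) (X := X) (T := T) (D₀ := D) hB
        (hE'.frame hF2 (by decide) (by decide)) hlt (by simp [hh]) (by simp [hh])
        (by simpa [hh] using hq') (by simpa [hh, hs2, hs3] using hS')
        (by simpa [hh, hs3] using hD))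
      rintro h3 ⟨hF3, qs', D', hq3, hS3, hD3, ht3⟩
      have hF4 := hF.trans (hF2.trans (hF3.mono (by simp) (by simp)))
      refine ⟨?_, by simpa using hF4, qs', D', by simpa using hq3,
        by simpa [hh, hs2, hs3] using hS3, by simpa [hh, hs3] using hD3, ?_⟩
      · rw [hF3.var .i (by simp)]
        simp [hh, hvi]
      · simp [hh] at ht3 ⊢
        omega
    · have hlt' : ¬ i < h'.v .tail := by rw [hq'.1]; exact hlt
      simp [hvi, hlt', hF]
      refine ⟨qs, hq', D, hS', fun e he => ?_, by omega⟩
      rw [hD e he, List.take_of_length_le (by omega), List.take_of_length_le (by omega)]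
  · rintro h' ⟨hF, qs, D, hq', hS', hD, ht⟩ -
    have hlen := length_le_of_nodup hS'.nodup
    refine ⟨Conf.frame_tick.2 hF, ⟨qs, D, hS', fun e he y hy hd => ?_⟩, ?_⟩
    · rw [hD e he, List.take_of_length_le hlen]
      exact ⟨y, hy, hd⟩
    · have : D.card ≤ m := by
        have := Finset.card_le_card (show D ⊆ Finset.range m from
          fun e he => Finset.mem_range.2 (hS'.examined e he).1)
        simpa using this
      simp
      omega

theorem wp_attract (hB : Bounds n k m B cap) (hE : Env G m h) (hXV : X ⊆ G.A.V)
    (hXA : (G.A.restrict X).IsArena) (hTX : T ⊆ X) (hX : IsBits (h.a .inX) X)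
    (harg : h.v .arg = code T) (hpl : h.v .pl = σ)
    (hdeg : ∀ v ∈ X, h.a .deg v = outDegree m (h.a .src) (h.a .dst) X ∅ v) :
    attract.wp 15 B cap (fun h' =>
      h.Frame [.j, .arg, .tail, .i, .hi, .e, .u, .res] [.tgt, .cnt, .queue] h' ∧
      (∃ Y, (G.A.restrict X).IsAttractor σ T Y ∧ h'.v .res = code (X \ Y)) ∧
      h'.t ≤ h.t + (21 * n + 8 * m + 10)) h := by
  have hn2 := Nat.lt_two_pow_self (n := n)
  have h1 := hB.pow
  have h2 := hB.space
  have hnpos := hB.pos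
  refine Cmd.wp_seq_of (wp_decode (by decide) hE.n_eq (fun i hi => hE.pw i hi.le) harg
    (by omega) (by omega)) ?_
  rintro h₁ ⟨hF1, hT1, ht1⟩
  have hE1 := hE.frame hF1 (by decide) (by decide)
  have es1 : h₁.a .src = h.a .src := hF1.arr .src (by decide)
  have ed1 : h₁.a .dst = h.a .dst := hF1.arr .dst (by decide)
  refine Cmd.wp_seq_of (wp_initSearch (σ := σ) hB hE1 hXV hXA hTX
    (by rwa [hF1.arr .inX (by decide)]) hT1 (by rw [hF1.var .pl (by decide), hpl])
    (by rw [hF1.arr .deg (by decide), es1, ed1]; exact hdeg)) ?_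
  rintro h₂ ⟨hF2, ⟨qs, hq, hS⟩, ht2⟩
  have hE2 := hE1.frame hF2 (by decide) (by decide)
  have es2 : h₂.a .src = h₁.a .src := hF2.arr .src (by decide)
  have ed2 : h₂.a .dst = h₁.a .dst := hF2.arr .dst (by decide)
  rw [← es2, ← ed2] at hS
  refine Cmd.wp_seq_of (wp_search hB hE2 hq hS) ?_
  rintro h₃ ⟨hF3, ⟨qs', D, hS3, hD⟩, ht3⟩
  have hE3 := hE2.frame hF3 (by decide) (by decide)
  have hY := hS3.isAttractor hE2.edges hXV hXA hD
  refine Cmd.wp_mono ?_ (wp_encode (X := X \ qs'.toFinset) (by decide) hE3.n_eq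
    (fun i hi => hE3.pw i hi.le) (fun v => ?_) (by omega) (by omega))
  · rintro h₄ ⟨hF4, hres, ht4⟩
    refine ⟨?_, ⟨_, hY, hres⟩, by omega⟩
    exact (hF1.mono (by simp) (by simp)).trans ((hF2.mono (by simp) (by simp)).trans
      ((hF3.mono (by simp) (by simp)).trans (hF4.mono (by simp) (by simp))))
  · rw [Nat.pos_iff_ne_zero, Ne, hS3.cnt_eq_zero, Finset.mem_sdiff, List.mem_toFinset]
    tauto

end Attract

/-! ### Recognition of subarenas, and colours of subgames -/

/-- Compute the numbers of the successors inside `inX`, and test in `ok` whether all of them are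
positive. -/
def degrees : Cmd :=
  .set .j (.lit 0) ;; .loop .j (.var .n) (.put .deg (.var .j) (.lit 0)) ;;
  .set .e (.lit 0) ;;
  .loop .e (.var .m) (.ite (.lit 0) (.get .inX (.get .src (.var .e)))
    (.ite (.lit 0) (.get .inX (.get .dst (.var .e)))
      (.put .deg (.get .src (.var .e)) (.add (.get .deg (.get .src (.var .e))) (.lit 1)))
      .skip)
    .skip) ;;
  .set .ok (.lit 1) ;; .set .j (.lit 0) ;;
  .loop .j (.var .n) (.ite (.lit 0) (.get .inX (.var .j))
    (.ite (.lit 0) (.get .deg (.var .j)) .skip (.set .ok (.lit 0))) .skip)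

/-- Compute in `pl` the player who likes the set of the colours of `inX`, and the offsets of the
two players in the table of the winning regions. -/
def favourite : Cmd :=
  .set .j (.lit 0) ;; .loop .j (.var .k) (.put .seen (.var .j) (.lit 0)) ;;
  .set .j (.lit 0) ;;
  .loop .j (.var .n) (.ite (.lit 0) (.get .inX (.var .j))
    (.put .seen (.get .input (.add (.add (.lit 3) (.var .n)) (.var .j))) (.lit 1)) .skip) ;;
  encode .seen .k ;;
  .ite (.lit 0) (.get .fam (.var .res))
    (.set .pl (.lit 0) ;; .set .ownOff (.lit 0) ;; .set .oppOff (.var .pow))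
    (.set .pl (.lit 1) ;; .set .ownOff (.var .pow) ;; .set .oppOff (.lit 0))

section Step

variable {n k m B cap : ℕ} {G : ColouredMullerGame (Fin n) (Fin k)} {X : Finset (Fin n)}
  {h : Conf}

theorem outDegree_succ {src dst : ℕ → ℕ} {e v : ℕ} :
    outDegree (e + 1) src dst X ∅ v = outDegree e src dst X ∅ v +
      open Classical in if src e = v ∧ InSet X (dst e) then 1 else 0 := by
  classical
  unfold outDegree
  rw [Finset.range_add_one, Finset.filter_insert]
  simp only [Finset.notMem_empty, not_false_eq_true, true_and]
  split_ifs
  · rw [Finset.card_insert_of_notMem (by simp)]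
  · rfl

theorem outDegree_le {src dst : ℕ → ℕ} {D : Finset ℕ} {v : ℕ} :
    outDegree m src dst X D v ≤ m := by
  classical
  exact (Finset.card_filter_le _ _).trans (Finset.card_range m).le

theorem isArena_restrict_iff (hA : G.A.IsArena) (hV : G.A.V = Finset.univ)
    {src dst start : ℕ → ℕ} (hE : IsEdgeTable G.A.E m src dst start) :
    (G.A.restrict X).IsArena ↔ ∀ v ∈ X, 0 < outDegree m src dst X ∅ v := by
  classical
  have key : ∀ v : Fin n, 0 < outDegree m src dst X ∅ v ↔ ∃ y ∈ X, (v, y) ∈ G.A.E := by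
    intro v
    rw [outDegree, Finset.card_pos]
    constructor
    · rintro ⟨e, he⟩
      rw [Finset.mem_filter, Finset.mem_range] at he
      obtain ⟨hem, -, hs, y, hy, hd⟩ := he
      exact ⟨y, hy, (hE.mem_iff v y).2 ⟨e, hem, hs, hd.symm⟩⟩
    · rintro ⟨y, hy, he⟩
      obtain ⟨e, hem, hs, hd⟩ := (hE.mem_iff v y).1 he
      refine ⟨e, ?_⟩
      rw [Finset.mem_filter, Finset.mem_range]
      exact ⟨hem, by simp, hs, y, hy, hd.symm⟩
  simp only [key]
  constructor
  · intro hX v hv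
    obtain ⟨y, hy⟩ := hX.2.2 v (by rw [PseudoArena.V_restrict, hV]; simpa using hv)
    rw [PseudoArena.mem_E_restrict] at hy
    exact ⟨y, hy.2.2, hy.1⟩
  · exact fun h => hA.restrict fun v _ hv => h v hv

theorem wp_degrees (hB : Bounds n k m B cap) (hE : Env G m h) (hA : G.A.IsArena)
    (hV : G.A.V = Finset.univ) (hX : IsBits (h.a .inX) X) :
    degrees.wp 15 B cap (fun h' => h.Frame [.j, .e, .ok] [.deg] h' ∧
      (∀ v ∈ X, h'.a .deg v = outDegree m (h.a .src) (h.a .dst) X ∅ v) ∧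
      (0 < h'.v .ok ↔ (G.A.restrict X).IsArena) ∧
      h'.t ≤ h.t + (6 * n + 5 * m + 9)) h := by
  have hn2 := Nat.lt_two_pow_self (n := n)
  have h1 := hB.pow
  have h2 := hB.space
  have hm := hB.edges
  have hB0 : 0 < B := by omega
  have hB1 : 1 < B := by omega
  have hbit : ∀ v : Fin n, 0 < h.a .inX v ↔ v ∈ X := fun v => by rw [hX v]; split_ifs <;> simp_all
  have hF0 := h.frame_refl [.j, .e, .ok] [.deg]
  refine Cmd.wp_seq_of (R := fun h' => h' = h.setV .j 0) ⟨hB0, rfl⟩ ?_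
  rintro _ rfl
  refine Cmd.wp_seq_of (R := fun h' => h.Frame [.j, .e, .ok] [.deg] h' ∧
    (∀ v : Fin n, h'.a .deg v = 0) ∧ h'.t ≤ h.t + (2 * n + 2)) ?_ ?_
  · refine ⟨fun j h' => h.Frame [.j, .e, .ok] [.deg] h' ∧
      (∀ v : Fin n, (v : ℕ) < j → h'.a .deg v = 0) ∧ h'.t ≤ h.t + (2 * j + 1),
      n, by simp, by simp [hF0], ?_, ?_, ?_⟩
    · intro i h' _ hI _
      exact ⟨trivial, (hI.1.var .n (by simp)).trans hE.n_eq⟩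
    · rintro j h' hj ⟨hF, hd, ht⟩ hvj
      have hjc : j < cap := by omega
      simp [hvj, hF, hB0, hjc]
      refine ⟨fun v hv => ?_, by omega⟩
      rw [Function.update_apply]
      split_ifs with hc
      · rfl
      · exact hd v (by omega)
    · rintro h' ⟨hF, hd, ht⟩ -
      exact ⟨Conf.frame_tick.2 hF, fun v => hd v v.2, by simp; omega⟩
  rintro h₁ ⟨hF1, hd1, ht1⟩
  refine Cmd.wp_seq_of (R := fun h' => h' = h₁.setV .e 0) ⟨hB0, rfl⟩ ?_
  rintro _ rfl
  refine Cmd.wp_seq_of (R := fun h' => h.Frame [.j, .e, .ok] [.deg] h' ∧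
    (∀ v ∈ X, h'.a .deg v = outDegree m (h.a .src) (h.a .dst) X ∅ v) ∧
    h'.t ≤ h.t + (2 * n + 5 * m + 4)) ?_ ?_
  · refine ⟨fun e h' => h.Frame [.j, .e, .ok] [.deg] h' ∧
      (∀ v ∈ X, h'.a .deg v = outDegree e (h.a .src) (h.a .dst) X ∅ v) ∧
      h'.t ≤ h.t + (2 * n + 5 * e + 3), m, by simp, ?_, ?_, ?_, ?_⟩
    · simp [hF1]
      exact ⟨fun v hv => by simp [hd1, outDegree], by omega⟩
    · intro i h' _ hI _
      exact ⟨trivial, (hI.1.var .m (by simp)).trans hE.m_eq⟩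
    · rintro e h' he ⟨hF, hd, ht⟩ hve
      have hec : e < cap := by omega
      obtain ⟨u, hu⟩ : ∃ u : Fin n, h.a .src e = u := ⟨⟨_, hE.edges.src_lt e he⟩, rfl⟩
      obtain ⟨w, hw⟩ : ∃ w : Fin n, h.a .dst e = w := ⟨⟨_, hE.edges.dst_lt e he⟩, rfl⟩
      have hu' : h'.a .src e = u := by rw [hF.arr .src (by simp), hu]
      have hw' : h'.a .dst e = w := by rw [hF.arr .dst (by simp), hw]
      have hinX : h'.a .inX = h.a .inX := hF.arr .inX (by simp)
      have huc : (u : ℕ) < cap := by omega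
      have hwc : (w : ℕ) < cap := by omega
      have hsucc := fun v : ℕ => outDegree_succ (X := X) (src := h.a .src) (dst := h.a .dst)
        (e := e) (v := v)
      simp only [hu, hw, inSet_val] at hsucc
      by_cases hXu : u ∈ X
      · have hXu' := (hbit u).2 hXu
        by_cases hXw : w ∈ X
        · have hXw' := (hbit w).2 hXw
          have hdu := hd u hXu
          have hle : outDegree e (h.a .src) (h.a .dst) X ∅ u ≤ e := outDegree_le
          have hlt : outDegree e (h.a .src) (h.a .dst) X ∅ u + 1 < B := by omega
          simp [hve, hF, hB0, hB1, hec, huc, hwc, hu', hw', hinX, hXu', hXw', hdu, hlt]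
          refine ⟨fun v hv => ?_, by omega⟩
          rw [hsucc]
          by_cases hvu : v = u
          · subst hvu
            simp [hXw]
          · have hvu' : (v : ℕ) ≠ u := fun hc => hvu (Fin.ext hc)
            rw [Function.update_of_ne hvu', if_neg (by tauto), hd v hv, add_zero]
        · have hXw' : ¬ 0 < h.a .inX w := by rwa [hbit]
          simp [hve, hF, hB0, hec, huc, hwc, hu', hw', hinX, hXu', hXw']
          refine ⟨fun v hv => ?_, by omega⟩
          rw [hsucc, if_neg (by tauto), hd v hv, add_zero]
      · have hXu' : ¬ 0 < h.a .inX u := by rwa [hbit]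
        simp [hve, hF, hB0, hec, huc, hu', hinX, hXu']
        refine ⟨fun v hv => ?_, by omega⟩
        rw [hsucc, if_neg ?_, hd v hv, add_zero]
        rintro ⟨hc, -⟩
        exact hXu (Fin.ext hc ▸ hv)
    · rintro h' ⟨hF, hd, ht⟩ -
      exact ⟨Conf.frame_tick.2 hF, hd, by simp; omega⟩
  rintro h₂ ⟨hF2, hd2, ht2⟩
  refine Cmd.wp_seq_of (R := fun h' => h' = h₂.setV .ok 1) ⟨hB1, rfl⟩ ?_
  rintro _ rfl
  refine Cmd.wp_seq_of (R := fun h' => h' = (h₂.setV .ok 1).setV .j 0) ⟨hB0, rfl⟩ ?_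
  rintro _ rfl
  refine ⟨fun j h' => h.Frame [.j, .e, .ok] [.deg] h' ∧ h'.a .deg = h₂.a .deg ∧
    (0 < h'.v .ok ↔ ∀ v ∈ X, (v : ℕ) < j → 0 < outDegree m (h.a .src) (h.a .dst) X ∅ v) ∧
    h'.t ≤ h.t + (2 * n + 5 * m + 4 * j + 6), n, by simp, ?_, ?_, ?_, ?_⟩
  · simp [hF2]
    omega
  · intro i h' _ hI _
    exact ⟨trivial, (hI.1.var .n (by simp)).trans hE.n_eq⟩
  · rintro j h' hj ⟨hF, hd, hok, ht⟩ hvj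
    have hjc : j < cap := by omega
    have hinX : h'.a .inX = h.a .inX := hF.arr .inX (by simp)
    have hall : (∀ v ∈ X, (v : ℕ) ≤ j → 0 < outDegree m (h.a .src) (h.a .dst) X ∅ v) ↔
        (∀ v ∈ X, (v : ℕ) < j → 0 < outDegree m (h.a .src) (h.a .dst) X ∅ v) ∧
        ((⟨j, hj⟩ : Fin n) ∈ X → 0 < outDegree m (h.a .src) (h.a .dst) X ∅ j) := by
      refine ⟨fun h3 => ⟨fun v hv hlt => h3 v hv hlt.le, fun hv => h3 _ hv le_rfl⟩,
        fun h3 v hv hle => ?_⟩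
      rcases Nat.lt_or_eq_of_le hle with hlt | heq
      · exact h3.1 v hv hlt
      · obtain rfl : v = ⟨j, hj⟩ := Fin.ext heq
        exact h3.2 hv
    have hbj := hbit ⟨j, hj⟩
    simp only at hbj
    by_cases hXj : (⟨j, hj⟩ : Fin n) ∈ X
    · have hXj' := hbj.2 hXj
      have hdj := hd2 ⟨j, hj⟩ hXj
      simp only at hdj
      by_cases hpos : 0 < outDegree m (h.a .src) (h.a .dst) X ∅ j
      · simp [hvj, hF, hB0, hjc, hinX, hXj', hd, hdj, hpos, hall, hok]
        omega
      · simp [hvj, hF, hB0, hjc, hinX, hXj', hd, hdj, hpos]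
        exact ⟨⟨_, hXj, le_rfl, by simpa using hpos⟩, by omega⟩
    · have hXj' : ¬ 0 < h.a .inX j := by rwa [hbj]
      simp [hvj, hF, hB0, hjc, hinX, hXj', hd, hall, hok, hXj]
      omega
  · rintro h' ⟨hF, hd, hok, ht⟩ -
    refine ⟨Conf.frame_tick.2 hF, by simpa [hd] using hd2, ?_, by simp; omega⟩
    rw [isArena_restrict_iff hA hV hE.edges]
    simpa using hok

theorem wp_favourite (hB : Bounds n k m B cap) (hE : Env G m h) (hX : IsBits (h.a .inX) X) :
    favourite.wp 15 B cap (fun h' =>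
      h.Frame [.j, .res, .pl, .ownOff, .oppOff] [.seen] h' ∧
      (∃ σ : Fin 2, X.image G.c ∈ G.F σ ∧ h'.v .pl = σ ∧ h'.v .ownOff = σ * 2 ^ n ∧
        h'.v .oppOff = (1 - σ : Fin 2) * 2 ^ n) ∧
      h'.t ≤ h.t + (8 * n + 11)) h := by
  have hn2 := Nat.lt_two_pow_self (n := n)
  have hk2 := Nat.lt_two_pow_self (n := k)
  have h1 := hB.pow
  have h2 := hB.space
  have hdr := hB.header
  have hkn := hB.colours
  have hpk : 2 ^ k ≤ 2 ^ n := Nat.pow_le_pow_right (by omega) hkn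
  have hB0 : 0 < B := by omega
  have hB1 : 1 < B := by omega
  have hB3 : 3 < B := by omega
  have hbit : ∀ v : Fin n, 0 < h.a .inX v ↔ v ∈ X := fun v => by rw [hX v]; split_ifs <;> simp_all
  have hF0 := h.frame_refl [.j, .res, .pl, .ownOff, .oppOff] [.seen]
  refine Cmd.wp_seq_of (R := fun h' => h' = h.setV .j 0) ⟨hB0, rfl⟩ ?_
  rintro _ rfl
  refine Cmd.wp_seq_of (R := fun h' => h.Frame [.j, .res, .pl, .ownOff, .oppOff] [.seen] h' ∧
    (∀ v : Fin k, h'.a .seen v = 0) ∧ h'.t ≤ h.t + (2 * n + 2)) ?_ ?_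
  · refine ⟨fun j h' => h.Frame [.j, .res, .pl, .ownOff, .oppOff] [.seen] h' ∧
      (∀ v : Fin k, (v : ℕ) < j → h'.a .seen v = 0) ∧ h'.t ≤ h.t + (2 * j + 1),
      k, by simp, by simp [hF0], ?_, ?_, ?_⟩
    · intro i h' _ hI _
      exact ⟨trivial, (hI.1.var .k (by simp)).trans hE.k_eq⟩
    · rintro j h' hj ⟨hF, hd, ht⟩ hvj
      have hjc : j < cap := by omega
      simp [hvj, hF, hB0, hjc]
      refine ⟨fun v hv => ?_, by omega⟩
      rw [Function.update_apply]
      split_ifs with hc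
      · rfl
      · exact hd v (by omega)
    · rintro h' ⟨hF, hd, ht⟩ -
      exact ⟨Conf.frame_tick.2 hF, fun v => hd v v.2, by simp; omega⟩
  rintro h₁ ⟨hF1, hd1, ht1⟩
  refine Cmd.wp_seq_of (R := fun h' => h' = h₁.setV .j 0) ⟨hB0, rfl⟩ ?_
  rintro _ rfl
  refine Cmd.wp_seq_of (R := fun h' => h.Frame [.j, .res, .pl, .ownOff, .oppOff] [.seen] h' ∧
    (∀ q : Fin k, 0 < h'.a .seen q ↔ q ∈ X.image G.c) ∧ h'.t ≤ h.t + (5 * n + 4)) ?_ ?_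
  · refine ⟨fun j h' => h.Frame [.j, .res, .pl, .ownOff, .oppOff] [.seen] h' ∧
      (∀ q : Fin k, 0 < h'.a .seen q ↔ ∃ v ∈ X, (v : ℕ) < j ∧ G.c v = q) ∧
      h'.t ≤ h.t + (2 * n + 3 * j + 3), n, by simp, ?_, ?_, ?_, ?_⟩
    · simp [hF1, hd1]
      omega
    · intro i h' _ hI _
      exact ⟨trivial, (hI.1.var .n (by simp)).trans hE.n_eq⟩
    · rintro j h' hj ⟨hF, hs, ht⟩ hvj
      have hjc : j < cap := by omega
      have hj3 : 3 + n + j < cap := by omega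
      have hj3B : 3 + n + j < B := by omega
      have hn3B : 3 + n < B := by omega
      have hinX : h'.a .inX = h.a .inX := hF.arr .inX (by simp)
      have hn' : h'.v .n = n := (hF.var .n (by simp)).trans hE.n_eq
      have hcol := hE.colour ⟨j, hj⟩
      rw [← hF.arr .input (by simp)] at hcol
      simp only at hcol
      have hclt := (G.c ⟨j, hj⟩).2
      have hcc : (G.c ⟨j, hj⟩ : ℕ) < cap := by omega
      have hbj := hbit ⟨j, hj⟩
      simp only at hbj
      have hex : ∀ q, (∃ v ∈ X, (v : ℕ) ≤ j ∧ G.c v = q) ↔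
          (∃ v ∈ X, (v : ℕ) < j ∧ G.c v = q) ∨ ((⟨j, hj⟩ : Fin n) ∈ X ∧ G.c ⟨j, hj⟩ = q) := by
        intro q
        constructor
        · rintro ⟨v, hv, hle, hc⟩
          rcases Nat.lt_or_eq_of_le hle with hlt | heq
          · exact Or.inl ⟨v, hv, hlt, hc⟩
          · obtain rfl : v = ⟨j, hj⟩ := Fin.ext heq
            exact Or.inr ⟨hv, hc⟩
        · rintro (⟨v, hv, hlt, hc⟩ | ⟨hv, hc⟩)
          · exact ⟨v, hv, hlt.le, hc⟩
          · exact ⟨_, hv, le_rfl, hc⟩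
      by_cases hXj : (⟨j, hj⟩ : Fin n) ∈ X
      · have hXj' := hbj.2 hXj
        simp [hvj, hF, hB0, hB1, hB3, hjc, hj3, hj3B, hn3B, hinX, hn', hXj', hcol, hcc]
        refine ⟨fun q => ?_, by omega⟩
        rw [hex, ← hs]
        by_cases hq : q = G.c ⟨j, hj⟩
        · subst hq
          simp [hXj]
        · have hq' : (q : ℕ) ≠ G.c ⟨j, hj⟩ := fun hc => hq (Fin.ext hc)
          rw [Function.update_of_ne hq']
          simp [hXj, Ne.symm hq]
      · have hXj' : ¬ 0 < h.a .inX j := by rwa [hbj]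
        simp [hvj, hF, hB0, hjc, hinX, hXj']
        refine ⟨fun q => ?_, by omega⟩
        rw [hex, ← hs]
        simp [hXj]
    · rintro h' ⟨hF, hs, ht⟩ -
      refine ⟨Conf.frame_tick.2 hF, fun q => ?_, by simp; omega⟩
      rw [Conf.tick_a, hs, Finset.mem_image]
      simp
  rintro h₂ ⟨hF2, hs2, ht2⟩
  have hE2 := hE.frame hF2 (by decide) (by decide)
  refine Cmd.wp_seq_of (wp_encode (X := X.image G.c) (by decide) hE2.k_eq
    (fun i hi => hE2.pw i (by omega)) hs2 (by omega) (by omega)) ?_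
  rintro h₃ ⟨hF3, hres, ht3⟩
  have hF3' := hF2.trans (hF3.mono (ys := [.j, .res, .pl, .ownOff, .oppOff]) (cs := [.seen])
    (by simp) (by simp))
  have hE3 := hE.frame hF3' (by decide) (by decide)
  have hfam := hE3.fam (X.image G.c)
  have hrc : code (X.image G.c) < cap := by
    have := code_lt (X.image G.c)
    omega
  have hpow := hE3.pow_eq
  by_cases hmem : X.image G.c ∈ G.F 0
  · rw [if_pos hmem] at hfam
    simp [hB0, hres, hfam, hF3', hrc, hpow]
    exact ⟨hmem, by omega⟩
  · rw [if_neg hmem] at hfam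
    simp [hB0, hB1, hres, hfam, hF3', hrc, hpow]
    refine ⟨?_, by omega⟩
    obtain ⟨τ, hτ⟩ := G.exists_mem_F (X.image G.c)
    fin_cases τ
    · exact absurd hτ hmem
    · exact hτ

end Step

/-! ### Solution of a subgame by means of smaller subgames -/

/-- For each position of `inX`, take away its attractor for the player `pl`. The result `goal` is
`0` if the opponent wins nowhere in any of the remaining subgames; otherwise it is the number of
one of the nonempty winning regions of the opponent. -/
def testAll : Cmd :=
  .set .goal (.lit 0) ;; .set .pos (.lit 0) ;;
  .loop .pos (.var .n) (.ite (.lit 0) (.var .goal) .skip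
    (.ite (.lit 0) (.get .inX (.var .pos))
      (.set .arg (.get .pw (.var .pos)) ;; attract ;;
        .set .goal (.get .win (.add (.var .res) (.var .oppOff))))
      .skip))

/-- Compute the winning regions of the subgame with the number `cur` from the result of the
tests. -/
def finish : Cmd :=
  .ite (.lit 0) (.var .goal)
    (.set .arg (.var .goal) ;; .set .pl (.sub (.lit 1) (.var .pl)) ;; attract ;;
      .set .acc (.get .win (.add (.var .res) (.var .ownOff))) ;;
      .put .win (.add (.var .cur) (.var .ownOff)) (.var .acc) ;;
      .put .win (.add (.var .cur) (.var .oppOff)) (.sub (.var .cur) (.var .acc)))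
    (.put .win (.add (.var .cur) (.var .ownOff)) (.var .cur) ;;
      .put .win (.add (.var .cur) (.var .oppOff)) (.lit 0))

/-- For the sets `Z` with numbers below `c` that determine a subarena, the array `a` contains the
numbers of the winning regions of the subgames `G(Z)`. -/
def IsWinTable {n k : ℕ} (G : ColouredMullerGame (Fin n) (Fin k)) (c : ℕ) (a : ℕ → ℕ) : Prop :=
  ∀ Z : Finset (Fin n), code Z < c → (G.restrict Z).A.IsArena →
    ∀ τ : Fin 2, a (code Z + τ * 2 ^ n) = code (G.winSet τ Z)

section Solve

variable {n k m B cap : ℕ} {G : ColouredMullerGame (Fin n) (Fin k)} {σ : Fin 2}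
  {X T Y : Finset (Fin n)} {h : Conf} {a : ℕ → ℕ}

/-- The entries for both players are written to different cells, and they do not affect those of the
other sets. -/
theorem IsWinTable.update (ha : IsWinTable G (code X) a) (σ : Fin 2) :
    IsWinTable G (code X + 1) (Function.update
      (Function.update a (code X + σ * 2 ^ n) (code (G.winSet σ X)))
      (code X + (1 - σ : Fin 2) * 2 ^ n) (code (G.winSet (1 - σ) X))) := by
  intro Z hZ hZA τ
  have hX := code_lt X
  by_cases hc : code Z = code X
  · obtain rfl := code_injective hc
    rcases eq_or_ne τ (1 - σ) with rfl | hτ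
    · rw [Function.update_self]
    · obtain rfl : τ = σ := by
        fin_cases σ <;> fin_cases τ <;> simp_all
      rw [Function.update_of_ne, Function.update_self]
      have := Nat.two_pow_pos n
      fin_cases τ <;> simp
  · have hlt : code Z < code X := by omega
    have hne : ∀ ρ : Fin 2, code Z + τ * 2 ^ n ≠ code X + ρ * 2 ^ n := by
      intro ρ
      fin_cases ρ <;> fin_cases τ <;> simp <;> omega
    rw [Function.update_of_ne (hne _), Function.update_of_ne (hne _), ha Z hlt hZA]

theorem IsWinTable.succ (ha : IsWinTable G (code X) a) (hX : ¬ (G.restrict X).A.IsArena) :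
    IsWinTable G (code X + 1) a := by
  intro Z hZ hZA τ
  refine ha Z ?_ hZA τ
  have : code Z ≠ code X := fun hc => hX (code_injective hc ▸ hZA)
  omega

theorem code_sdiff_lt (hY : Y ⊆ X) (hne : Y.Nonempty) : code (X \ Y) < code X := by
  have h1 := code_sdiff_add hY
  have h2 : code Y ≠ 0 := fun hc => hne.ne_empty (code_eq_zero.1 hc)
  omega

theorem PseudoArena.IsAttractor.subset_of_restrict {A : PseudoArena (Fin n)}
    (hY : (A.restrict X).IsAttractor σ T Y) : Y ⊆ X := by
  have := hY.subset_V
  rw [PseudoArena.V_restrict] at this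
  exact this.trans Finset.inter_subset_right

theorem offset_add_lt (hB : Bounds n k m B cap) (Z : Finset (Fin n)) (τ : Fin 2) :
    code Z + τ * 2 ^ n < cap := by
  have h1 := code_lt Z
  have h2 := hB.pow
  fin_cases τ <;> simp <;> omega

theorem wp_testAll (hB : Bounds n k m B cap) (hE : Env G m h) (hXV : X ⊆ G.A.V)
    (hXA : (G.restrict X).A.IsArena) (hX : IsBits (h.a .inX) X) (hpl : h.v .pl = σ)
    (hopp : h.v .oppOff = (1 - σ : Fin 2) * 2 ^ n) (hwin : IsWinTable G (code X) (h.a .win))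
    (hdeg : ∀ v ∈ X, h.a .deg v = outDegree m (h.a .src) (h.a .dst) X ∅ v) :
    testAll.wp 15 B cap (fun h' =>
      h.Frame [.j, .arg, .tail, .i, .hi, .e, .u, .res, .goal, .pos] [.tgt, .cnt, .queue] h' ∧
      ((h'.v .goal = 0 ∧ ∀ v ∈ X, ∃ Y, (G.restrict X).A.IsAttractor σ {v} Y ∧
          G.winSet (1 - σ) (X \ Y) = ∅) ∨
        (0 < h'.v .goal ∧ ∃ T Y, (G.restrict X).A.IsAttractor σ T Y ∧
          h'.v .goal = code (G.winSet (1 - σ) (X \ Y)))) ∧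
      h'.t ≤ h.t + (n * (21 * n + 8 * m + 15) + 3)) h := by
  have hn2 := Nat.lt_two_pow_self (n := n)
  have h1 := hB.pow
  have h2 := hB.space
  have hB0 : 0 < B := by omega
  have hF0 := h.frame_refl [.j, .arg, .tail, .i, .hi, .e, .u, .res, .goal, .pos]
    [.tgt, .cnt, .queue]
  have hbit : ∀ v : Fin n, 0 < h.a .inX v ↔ v ∈ X := fun v => by rw [hX v]; split_ifs <;> simp_all
  obtain ⟨A, hA⟩ : ∃ A, 21 * n + 8 * m + 10 = A := ⟨_, rfl⟩
  have hA5 : 21 * n + 8 * m + 15 = A + 5 := by omega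
  rw [hA5]
  refine ⟨hB0, hB0, fun i h' =>
    h.Frame [.j, .arg, .tail, .i, .hi, .e, .u, .res, .goal, .pos] [.tgt, .cnt, .queue] h' ∧
      ((h'.v .goal = 0 ∧ ∀ v ∈ X, (v : ℕ) < i → ∃ Y, (G.restrict X).A.IsAttractor σ {v} Y ∧
          G.winSet (1 - σ) (X \ Y) = ∅) ∨
        (0 < h'.v .goal ∧ ∃ T Y, (G.restrict X).A.IsAttractor σ T Y ∧
          h'.v .goal = code (G.winSet (1 - σ) (X \ Y)))) ∧
      h'.t ≤ h.t + (i * (A + 5) + 2), n, ?_, ?_, ?_, ?_, ?_⟩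
  · simp
  · simp [hF0]
  · intro i h' _ hI _
    exact ⟨trivial, (hI.1.var .n (by simp)).trans hE.n_eq⟩
  · rintro i h' hi ⟨hF, hg, ht⟩ hvi
    have hic : i < cap := by omega
    have hinX : h'.a .inX = h.a .inX := hF.arr .inX (by simp)
    have hpw : h'.a .pw i = 2 ^ i := (hE.frame hF (by decide) (by decide)).pw i hi.le
    have hstep := Nat.add_one_mul i (A + 5)
    rcases hg with ⟨hg0, hg⟩ | ⟨hg0, hg⟩
    · have hbi := hbit ⟨i, hi⟩
      simp only at hbi
      have hnext : ((⟨i, hi⟩ : Fin n) ∈ X → ∃ Y, (G.restrict X).A.IsAttractor σ {⟨i, hi⟩} Y ∧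
          G.winSet (1 - σ) (X \ Y) = ∅) → ∀ v ∈ X, (v : ℕ) ≤ i →
          ∃ Y, (G.restrict X).A.IsAttractor σ {v} Y ∧ G.winSet (1 - σ) (X \ Y) = ∅ := by
        intro h3 v hv hle
        rcases Nat.lt_or_eq_of_le hle with hlt | heq
        · exact hg v hv hlt
        · obtain rfl : v = ⟨i, hi⟩ := Fin.ext heq
          exact h3 hv
      by_cases hXi : (⟨i, hi⟩ : Fin n) ∈ X
      · have hXi' := hbi.2 hXi
        simp only [Cmd.wp_ite, Cmd.wp_seq, Cmd.wp_set, Ex.Safe, Ex.eval, hvi, true_and, hB0, hic,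
          not_true_eq_false, false_imp_iff, and_true, forall_true_left, Conf.tick_v, Conf.tick_a,
          hg0, lt_irrefl, not_false_eq_true, hinX, hXi', Arr.ctorIdx_lt, hpw]
        set h'' := h'.tick.tick.setV .arg (2 ^ i) with hh
        have hF2 : h.Frame [.j, .arg, .tail, .i, .hi, .e, .u, .res, .goal, .pos]
            [.tgt, .cnt, .queue] h'' := by
          simp [hh, hF]
        have es : h''.a .src = h.a .src := hF2.arr .src (by simp)
        have ed : h''.a .dst = h.a .dst := hF2.arr .dst (by simp)
        refine Cmd.wp_mono ?_ (wp_attract (σ := σ) (X := X) (T := {⟨i, hi⟩}) hB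
          (hE.frame hF2 (by decide) (by decide)) hXV hXA (by simpa using hXi)
          (by rwa [hF2.arr .inX (by simp)]) (by simp [hh, code_singleton])
          (by rw [hF2.var .pl (by simp), hpl])
          (by rw [hF2.arr .deg (by simp), es, ed]; exact hdeg))
        rintro h3 ⟨hF3, ⟨Y, hY, hres⟩, ht3⟩
        have hF4 := hF2.trans (hF3.mono (ys := [.j, .arg, .tail, .i, .hi, .e, .u, .res, .goal,
          .pos]) (cs := [.tgt, .cnt, .queue]) (by simp) (by simp))
        have hlt := code_sdiff_lt hY.subset_of_restrict ⟨_, hY.subset (Finset.mem_singleton_self _)⟩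
        have hval := hwin _ hlt (G.isArena_restrict_sdiff hXV hXA hY) (1 - σ)
        rw [← hF4.arr .win (by simp), ← hopp, ← hres, ← hF4.var .oppOff (by simp)] at hval
        have hidx := offset_add_lt hB (X \ Y) (1 - σ)
        rw [← hopp, ← hF4.var .oppOff (by simp), ← hres] at hidx
        have hpos3 : h3.v .pos = i := by
          rw [hF3.var .pos (by simp)]
          simp [hh, hvi]
        have ht4 : h3.t ≤ h'.t + 3 + A := by
          simp [hh] at ht3
          omega
        simp [hF4, hval, hidx, hpos3]
        refine ⟨by omega, ?_, by omega⟩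
        by_cases hw : G.winSet (1 - σ) (X \ Y) = ∅
        · rw [hw, code_empty]
          exact Or.inl ⟨rfl, hnext fun _ => ⟨Y, hY, hw⟩⟩
        · refine Or.inr ⟨Nat.pos_of_ne_zero fun hc => hw (code_eq_zero.1 hc), _, Y, hY, rfl⟩
      · have hXi' : ¬ 0 < h.a .inX i := by rwa [hbi]
        simp [hvi, hg0, hF, hB0, hic, hinX, hXi']
        exact ⟨hnext fun hc => absurd hc hXi, by omega⟩
    · simp [hvi, hg0, hF, hB0]
      exact ⟨Or.inr hg, by omega⟩
  · rintro h' ⟨hF, hg, ht⟩ -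
    refine ⟨Conf.frame_tick.2 hF, ?_, by simp; omega⟩
    simpa using hg

theorem wp_finish (hB : Bounds n k m B cap) (hE : Env G m h) (hXV : X ⊆ G.A.V)
    (hXA : (G.restrict X).A.IsArena) (hX : IsBits (h.a .inX) X) (hc : X.image G.c ∈ G.F σ)
    (hpl : h.v .pl = σ) (hown : h.v .ownOff = σ * 2 ^ n)
    (hopp : h.v .oppOff = (1 - σ : Fin 2) * 2 ^ n) (hcur : h.v .cur = code X)
    (hwin : IsWinTable G (code X) (h.a .win))
    (hdeg : ∀ v ∈ X, h.a .deg v = outDegree m (h.a .src) (h.a .dst) X ∅ v)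
    (hgoal : (h.v .goal = 0 ∧ ∀ v ∈ X, ∃ Y, (G.restrict X).A.IsAttractor σ {v} Y ∧
          G.winSet (1 - σ) (X \ Y) = ∅) ∨
        (0 < h.v .goal ∧ ∃ T Y, (G.restrict X).A.IsAttractor σ T Y ∧
          h.v .goal = code (G.winSet (1 - σ) (X \ Y)))) :
    finish.wp 15 B cap (fun h' =>
      h.Frame [.j, .arg, .tail, .i, .hi, .e, .u, .res, .pl, .acc] [.tgt, .cnt, .queue, .win] h' ∧
      IsWinTable G (code X + 1) (h'.a .win) ∧
      h'.t ≤ h.t + (21 * n + 8 * m + 16)) h := by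
  have hn2 := Nat.lt_two_pow_self (n := n)
  have h1 := hB.pow
  have h2 := hB.space
  have hB0 : 0 < B := by omega
  have hB1 : 1 < B := by omega
  have hF0 := h.frame_refl [.j, .arg, .tail, .i, .hi, .e, .u, .res, .pl, .acc]
    [.tgt, .cnt, .queue, .win]
  have hi1 := offset_add_lt hB X σ
  have hi2 := offset_add_lt hB X (1 - σ)
  have hi1B : code X + σ * 2 ^ n < B := by omega
  have hi2B : code X + (1 - σ : Fin 2) * 2 ^ n < B := by omega
  have hupd := hwin.update σ
  have hcodeX := code_lt X
  have hadd := code_sdiff_add (G.winSet_subset (σ := σ) (X := X))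
  rw [← G.winSet_opponent hXV hXA] at hadd
  rcases hgoal with ⟨hg0, hg⟩ | ⟨hg0, T, Y, hY, hg⟩
  · have hfull := G.winSet_eq_self_of_forall hXV hXA hc hg
    rw [hfull] at hadd hupd
    have hz : code (G.winSet (1 - σ) X) = 0 := by omega
    rw [hz] at hupd
    simp [finish, hg0, hcur, hown, hopp, hi1, hi2, hi1B, hi2B, hB0, hF0]
    exact ⟨hupd, by omega⟩
  · have hT : G.winSet (1 - σ) (X \ Y) ⊆ X := G.winSet_subset.trans Finset.sdiff_subset
    have hTne : (G.winSet (1 - σ) (X \ Y)).Nonempty := by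
      rw [Finset.nonempty_iff_ne_empty]
      intro hc
      rw [hg, hc, code_empty] at hg0
      exact lt_irrefl _ hg0
    have hσ : 1 - (σ : ℕ) = ((1 - σ : Fin 2) : ℕ) := by fin_cases σ <;> rfl
    simp only [finish, Cmd.wp_ite, Cmd.wp_seq, Cmd.wp_set, Ex.Safe, Ex.eval, true_and, hB0, hB1,
      not_true_eq_false, false_imp_iff, and_true, forall_true_left, Conf.tick_v, hg0, ne_eq,
      reduceCtorEq, not_false_eq_true, Conf.setV_of_ne, hpl, hσ]
    set h'' := (h.tick.setV .arg (h.v .goal)).setV .pl (1 - σ : Fin 2) with hh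
    have hF2 : h.Frame [.j, .arg, .tail, .i, .hi, .e, .u, .res, .pl, .acc]
        [.tgt, .cnt, .queue, .win] h'' := by
      simp [hh, hF0]
    have es : h''.a .src = h.a .src := hF2.arr .src (by simp)
    have ed : h''.a .dst = h.a .dst := hF2.arr .dst (by simp)
    refine Cmd.wp_mono ?_ (wp_attract (σ := 1 - σ) (X := X) (T := G.winSet (1 - σ) (X \ Y)) hB
      (hE.frame hF2 (by decide) (by decide)) hXV hXA hT
      (by rwa [hF2.arr .inX (by simp)]) (by simp [hh, hg]) (by simp [hh])
      (by rw [hF2.arr .deg (by simp), es, ed]; exact hdeg))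
    rintro h3 ⟨hF3, ⟨Z, hZ, hres⟩, ht3⟩
    have hF4 := hF2.trans (hF3.mono (ys := [.j, .arg, .tail, .i, .hi, .e, .u, .res, .pl, .acc])
      (cs := [.tgt, .cnt, .queue, .win]) (by simp) (by simp))
    have hlt := code_sdiff_lt hZ.subset_of_restrict (hTne.mono hZ.subset)
    have hval := hwin _ hlt (G.isArena_restrict_sdiff hXV hXA hZ) σ
    rw [← G.winSet_eq_sdiff hXV hXA hY hZ] at hval
    have hw3 : h3.a .win = h.a .win := by
      rw [hF3.arr .win (by simp)]
      simp [hh]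
    have hcur3 := (hF4.var .cur (by simp)).trans hcur
    have hown3 := (hF4.var .ownOff (by simp)).trans hown
    have hopp3 := (hF4.var .oppOff (by simp)).trans hopp
    have hidx := offset_add_lt hB (X \ Z) σ
    have hidxB : code (X \ Z) + σ * 2 ^ n < B := by omega
    have ht4 : h3.t ≤ h.t + 3 + (21 * n + 8 * m + 10) := by simpa [hh] using ht3
    have hsub : code X - code (G.winSet σ X) = code (G.winSet (1 - σ) X) := by omega
    simp [hF4, hval, hidx, hidxB, hcur3, hown3, hopp3, hres, hw3, hi1, hi2, hi1B, hi2B, hsub]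
    exact ⟨hupd, by omega⟩

end Solve

/-! ### Solution of all subgames -/

/-- Write to the table whether the subgame with the number `cur` is fully won by Player `0` (value
`0`), by Player `1` (value `1`) or by no player (value `2`). -/
def classify : Cmd :=
  .ite (.lit 0) (.get .win (.add (.var .cur) (.var .pow)))
    (.ite (.lit 0) (.get .win (.var .cur)) (.put .table (.var .cur) (.lit 2))
      (.put .table (.var .cur) (.lit 1)))
    (.put .table (.var .cur) (.lit 0))

/-- Solve the subgame with the number `cur`; the sets that do not determine subarenas get the value
`3` in the table. -/
def solveOne : Cmd :=
  .set .arg (.var .cur) ;; decode .inX ;; degrees ;;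
  .ite (.lit 0) (.var .ok) (favourite ;; testAll ;; finish ;; classify)
    (.put .table (.var .cur) (.lit 3))

/-- Solve all subgames, in the order of their numbers, and write the winners of the whole game to
the array `winner`. -/
def solveAll : Cmd :=
  .set .cur (.lit 1) ;; .loop .cur (.var .pow) solveOne ;;
  .set .arg (.get .win (.add (.sub (.var .pow) (.lit 1)) (.var .pow))) ;; decode .winner

/-- The number `c` tells to which of the collections `P 0`, `P 1` and `Q` the set `X` belongs. -/
def IsVerdict {n k : ℕ} (G : ColouredMullerGame (Fin n) (Fin k)) (X : Finset (Fin n)) (c : ℕ) :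
    Prop :=
  (∀ σ : Fin 2, X ∈ G.P σ ↔ c = σ) ∧ (X ∈ G.Q ↔ c = 2)

section SolveAll

variable {n k m B cap : ℕ} {G : ColouredMullerGame (Fin n) (Fin k)} {X : Finset (Fin n)}
  {h : Conf}

theorem isVerdict_three (hXV : X ⊆ G.A.V) (hXA : ¬ (G.restrict X).A.IsArena) :
    IsVerdict G X 3 := by
  refine ⟨fun σ => ?_, ?_⟩
  · rw [G.mem_P_iff hXV]
    fin_cases σ <;> simp [hXA]
  · rw [G.mem_Q_iff hXV]
    simp [hXA]

theorem wp_classify (hB : Bounds n k m B cap) (hE : Env G m h) (hXV : X ⊆ G.A.V)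
    (hXA : (G.restrict X).A.IsArena) (hne : X.Nonempty) (hcur : h.v .cur = code X)
    (hwin : IsWinTable G (code X + 1) (h.a .win)) :
    classify.wp 15 B cap (fun h' => h.Frame [] [.table] h' ∧
      (∃ c, IsVerdict G X c ∧ h'.a .table = Function.update (h.a .table) (code X) c) ∧
      h'.t ≤ h.t + 3) h := by
  have hn2 := Nat.lt_two_pow_self (n := n)
  have h1 := hB.pow
  have h2 := hB.space
  have hpos := hB.pos
  have hB0 : 0 < B := by omega
  have hB1 : 1 < B := by omega
  have hB2 : 2 < B := by omega
  have hcode := code_lt X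
  have hw0 := hwin X (by omega) hXA 0
  have hw1 := hwin X (by omega) hXA 1
  simp only [Fin.val_zero, Fin.val_one, zero_mul, one_mul, add_zero] at hw0 hw1
  have hc1 : code X < cap := by omega
  have hc2 : code X + 2 ^ n < cap := by omega
  have hc3 : code X + 2 ^ n < B := by omega
  have hopp : G.winSet 1 X = X \ G.winSet 0 X := G.winSet_opponent (σ := 0) hXV hXA
  have hsub : G.winSet 0 X ⊆ X := G.winSet_subset
  have hF0 := h.frame_refl [] [.table]
  by_cases he1 : G.winSet 1 X = ∅
  · have he0 : G.winSet 0 X = X :=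
      hsub.antisymm (Finset.sdiff_eq_empty_iff_subset.1 (hopp.symm.trans he1))
    simp [classify, hcur, hE.pow_eq, hw1, he1, code_empty, hB0, hc1, hc2, hc3, hF0]
    refine ⟨0, ⟨fun σ => ?_, ?_⟩, rfl⟩
    · rw [G.mem_P_iff hXV]
      fin_cases σ
      · simp [he0, hXA, hne]
      · simp [he1, hne.ne_empty.symm]
    · rw [G.mem_Q_iff hXV]
      simp [he0, Fin.forall_fin_two]
  · have hp1 : 0 < code (G.winSet 1 X) := Nat.pos_of_ne_zero fun hc => he1 (code_eq_zero.1 hc)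
    have hne0 : G.winSet 0 X ≠ X := fun hc => he1 (by rw [hopp, hc, sdiff_self]; rfl)
    by_cases he0 : G.winSet 0 X = ∅
    · rw [he0, Finset.sdiff_empty] at hopp
      simp [classify, hcur, hE.pow_eq, hw1, hp1, hw0, he0, code_empty, hB0, hB1, hc1, hc2, hc3, hF0]
      refine ⟨1, ⟨fun σ => ?_, ?_⟩, rfl⟩
      · rw [G.mem_P_iff hXV]
        fin_cases σ
        · simp [hne0]
        · simp [hopp, hXA, hne]
      · rw [G.mem_Q_iff hXV]
        simp [hopp, Fin.forall_fin_two]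
    · have hp0 : 0 < code (G.winSet 0 X) := Nat.pos_of_ne_zero fun hc => he0 (code_eq_zero.1 hc)
      have hne1 : G.winSet 1 X ≠ X := fun hc => by
        rw [hc] at hopp
        exact he0 (by rw [← Finset.inter_eq_right.2 hsub, ← Finset.disjoint_iff_inter_eq_empty];
                      exact Finset.sdiff_eq_self_iff_disjoint.1 hopp.symm)
      simp [classify, hcur, hE.pow_eq, hw1, hp1, hw0, hp0, hB0, hB2, hc1, hc2, hc3, hF0]
      refine ⟨2, ⟨fun σ => ?_, ?_⟩, rfl⟩
      · rw [G.mem_P_iff hXV]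
        fin_cases σ <;> simp [hne0, hne1]
      · rw [G.mem_Q_iff hXV]
        simp [hne0, hne1, hXA, hne, Fin.forall_fin_two]

theorem wp_solveOne (hB : Bounds n k m B cap) (hE : Env G m h) (hA : G.A.IsArena)
    (hV : G.A.V = Finset.univ) (hne : X.Nonempty) (hcur : h.v .cur = code X)
    (hwin : IsWinTable G (code X) (h.a .win)) :
    solveOne.wp 15 B cap (fun h' =>
      h.Frame [.j, .e, .ok, .res, .pl, .ownOff, .oppOff, .arg, .tail, .i, .hi, .u, .goal, .pos,
        .acc] [.inX, .deg, .seen, .tgt, .cnt, .queue, .win, .table] h' ∧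
      IsWinTable G (code X + 1) (h'.a .win) ∧
      (∃ c, IsVerdict G X c ∧ h'.a .table = Function.update (h.a .table) (code X) c) ∧
      h'.t ≤ h.t + (n * (21 * n + 8 * m + 15) + 39 * n + 13 * m + 46)) h := by
  have hn2 := Nat.lt_two_pow_self (n := n)
  have h1 := hB.pow
  have h2 := hB.space
  have hpos := hB.pos
  have hB0 : 0 < B := by omega
  have hB3 : 3 < B := by omega
  have hcode := code_lt X
  have hXV : X ⊆ G.A.V := hV ▸ Finset.subset_univ X
  obtain ⟨A, hAt⟩ : ∃ A, n * (21 * n + 8 * m + 15) = A := ⟨_, rfl⟩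
  have hF0 := h.frame_refl [.arg] []
  refine Cmd.wp_seq_of (R := fun h' => h' = h.setV .arg (code X)) ⟨trivial, by simp [hcur]⟩ ?_
  rintro _ rfl
  have hF1 : h.Frame [.arg] [] (h.setV .arg (code X)) := by simp [hF0]
  have hE1 := hE.frame hF1 (by decide) (by decide)
  refine Cmd.wp_seq_of (wp_decode (X := X) (by decide) hE1.n_eq (fun i hi => hE1.pw i hi.le)
    (by simp) (by omega) (by omega)) ?_
  rintro h₂ ⟨hF2, hX2, ht2⟩
  have hE2 := hE1.frame hF2 (by decide) (by decide)
  refine Cmd.wp_seq_of (wp_degrees hB hE2 hA hV hX2) ?_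
  rintro h₃ ⟨hF3, hdeg3, hok3, ht3⟩
  have hE3 := hE2.frame hF3 (by decide) (by decide)
  rw [← hF3.arr .src (by decide), ← hF3.arr .dst (by decide)] at hdeg3
  have hX3 : IsBits (h₃.a .inX) X := by rwa [hF3.arr .inX (by decide)]
  have hF03 : h.Frame [.j, .e, .ok, .arg] [.inX, .deg] h₃ :=
    (hF1.mono (by simp) (by simp)).trans ((hF2.mono (by simp) (by simp)).trans
      (hF3.mono (by simp) (by simp)))
  have hcur3 := (hF03.var .cur (by decide)).trans hcur
  have hwin3 : IsWinTable G (code X) (h₃.a .win) := by rwa [hF03.arr .win (by decide)]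
  have ht03 : h₃.t ≤ h.t + (10 * n + 5 * m + 12) := by simp at ht2; omega
  by_cases hXA : (G.A.restrict X).IsArena
  · refine ⟨hB0, trivial, fun _ => ?_, fun hc => absurd (hok3.2 hXA) hc⟩
    have hE3t : Env G m h₃.tick := hE3.frame (xs := []) (bs := []) (by simp [h₃.frame_refl])
      (by decide) (by decide)
    refine Cmd.wp_seq_of (wp_favourite hB hE3t hX3) ?_
    rintro h₄ ⟨hF4, ⟨σ, hc, hpl4, hown4, hopp4⟩, ht4⟩
    have hF4' : h₃.Frame [.j, .res, .pl, .ownOff, .oppOff] [.seen] h₄ := ⟨hF4.1, hF4.2⟩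
    have hE4 := hE3.frame hF4' (by decide) (by decide)
    refine Cmd.wp_seq_of (wp_testAll (X := X) hB hE4 hXV hXA
      (by rwa [hF4'.arr .inX (by decide)]) hpl4 hopp4 (by rwa [hF4'.arr .win (by decide)])
      (by rw [hF4'.arr .deg (by decide), hF4'.arr .src (by decide), hF4'.arr .dst (by decide)]
          exact hdeg3)) ?_
    rintro h₅ ⟨hF5, hgoal5, ht5⟩
    have hF35 : h₃.Frame [.j, .res, .pl, .ownOff, .oppOff, .arg, .tail, .i, .hi, .e, .u, .goal,
        .pos] [.seen, .tgt, .cnt, .queue] h₅ :=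
      (hF4'.mono (by simp) (by simp)).trans (hF5.mono (by simp) (by simp))
    have hE5 := hE3.frame hF35 (by decide) (by decide)
    refine Cmd.wp_seq_of (wp_finish hB hE5 hXV hXA (by rwa [hF35.arr .inX (by decide)]) hc
      (by rw [hF5.var .pl (by decide), hpl4]) (by rw [hF5.var .ownOff (by decide), hown4])
      (by rw [hF5.var .oppOff (by decide), hopp4]) (by rw [hF35.var .cur (by decide), hcur3])
      (by rwa [hF35.arr .win (by decide)])
      (by rw [hF35.arr .deg (by decide), hF35.arr .src (by decide), hF35.arr .dst (by decide)]
          exact hdeg3) hgoal5) ?_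
    rintro h₆ ⟨hF6, hwin6, ht6⟩
    have hF36 : h₃.Frame [.j, .res, .pl, .ownOff, .oppOff, .arg, .tail, .i, .hi, .e, .u, .goal,
        .pos, .acc] [.seen, .tgt, .cnt, .queue, .win] h₆ :=
      (hF35.mono (by simp) (by simp)).trans (hF6.mono (by simp) (by simp))
    have hE6 := hE3.frame hF36 (by decide) (by decide)
    refine Cmd.wp_mono ?_ (wp_classify hB hE6 hXV hXA hne
      (by rw [hF36.var .cur (by decide), hcur3]) hwin6)
    rintro h₇ ⟨hF7, ⟨c, hc7, hc7'⟩, ht7⟩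
    refine ⟨(hF03.mono (by simp) (by simp)).trans ((hF36.mono (by simp) (by simp)).trans
      (hF7.mono (by simp) (by simp))), by rwa [hF7.arr .win (by decide)], ⟨c, hc7, ?_⟩, ?_⟩
    · rw [hc7', hF36.arr .table (by decide), hF03.arr .table (by decide)]
    · simp at ht4
      omega
  · have hok : ¬ 0 < h₃.v .ok := fun hc => hXA (hok3.1 hc)
    have hcc : code X < cap := by omega
    have hF := hF03.mono (ys := [.j, .e, .ok, .res, .pl, .ownOff, .oppOff, .arg, .tail, .i, .hi,
      .u, .goal, .pos, .acc]) (cs := [.inX, .deg, .seen, .tgt, .cnt, .queue, .win, .table])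
      (by simp) (by simp)
    simp [hok, hB0, hB3, hcur3, hcc, hF]
    exact ⟨hwin3.succ hXA, ⟨3, isVerdict_three hXV hXA, by rw [hF03.arr .table (by decide)]⟩,
      by omega⟩

theorem wp_solveAll (hB : Bounds n k m B cap) (hE : Env G m h) (hA : G.A.IsArena)
    (hV : G.A.V = Finset.univ) (hw0 : h.a .win 0 = 0) (hw1 : h.a .win (2 ^ n) = 0) :
    solveAll.wp 15 B cap (fun h' => IsBits (h'.a .winner) (G.winSet 1 Finset.univ) ∧
      (∀ X : Finset (Fin n), X.Nonempty → IsVerdict G X (h'.a .table (code X))) ∧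
      h'.t ≤ h.t + 2 ^ n * (n * (21 * n + 8 * m + 15) + 39 * n + 13 * m + 47) + 4 * n + 5) h := by
  have hn2 := Nat.lt_two_pow_self (n := n)
  have h1 := hB.pow
  have h2 := hB.space
  have hpos := hB.pos
  have hB0 : 0 < B := by omega
  have hB1 : 1 < B := by omega
  obtain ⟨S, hS⟩ : ∃ S, n * (21 * n + 8 * m + 15) + 39 * n + 13 * m + 47 = S := ⟨_, rfl⟩
  rw [hS]
  have hF0 := h.frame_refl [.j, .e, .ok, .res, .pl, .ownOff, .oppOff, .arg, .tail, .i, .hi, .u,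
    .goal, .pos, .acc, .cur] [.inX, .deg, .seen, .tgt, .cnt, .queue, .win, .table]
  refine Cmd.wp_seq_of (R := fun h' => h' = h.setV .cur 1) ⟨hB1, rfl⟩ ?_
  rintro _ rfl
  refine Cmd.wp_seq_of (R := fun h' => h.Frame [.j, .e, .ok, .res, .pl, .ownOff, .oppOff, .arg,
      .tail, .i, .hi, .u, .goal, .pos, .acc, .cur]
      [.inX, .deg, .seen, .tgt, .cnt, .queue, .win, .table] h' ∧
    IsWinTable G (2 ^ n) (h'.a .win) ∧
    (∀ X : Finset (Fin n), X.Nonempty → IsVerdict G X (h'.a .table (code X))) ∧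
    h'.t ≤ h.t + (2 ^ n * S + 2)) ?_ ?_
  · refine ⟨fun c h' => h.Frame [.j, .e, .ok, .res, .pl, .ownOff, .oppOff, .arg, .tail, .i, .hi,
        .u, .goal, .pos, .acc, .cur] [.inX, .deg, .seen, .tgt, .cnt, .queue, .win, .table] h' ∧
      0 < c ∧ IsWinTable G c (h'.a .win) ∧
      (∀ X : Finset (Fin n), X.Nonempty → code X < c → IsVerdict G X (h'.a .table (code X))) ∧
      h'.t ≤ h.t + (c * S + 1), 2 ^ n, ?_, ?_, ?_, ?_, ?_⟩
    · simp
      omega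
    -- The entries for the empty set, whose winning regions are empty, are `0` initially.
    · simp [hF0]
      refine ⟨fun Z hZ _ τ => ?_, fun X hX hX0 => absurd (code_eq_zero.1 hX0) hX.ne_empty⟩
      obtain rfl : Z = ∅ := code_eq_zero.1 (by omega)
      rw [G.winSet_empty, code_empty]
      fin_cases τ
      · simpa using hw0
      · simpa using hw1
    · intro i h' _ hI _
      exact ⟨trivial, (hI.1.var .pow (by simp)).trans hE.pow_eq⟩
    · rintro c h' hc ⟨hF, hc0, hw, hv, ht⟩ hcur
      obtain ⟨X, rfl⟩ := exists_code_eq hc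
      have hne : X.Nonempty := by
        rw [Finset.nonempty_iff_ne_empty]
        rintro rfl
        exact lt_irrefl _ hc0
      refine Cmd.wp_mono ?_ (wp_solveOne hB (hE.frame hF (by decide) (by decide)) hA hV hne hcur hw)
      rintro h₁ ⟨hF1, hw1, ⟨c, hc, hc'⟩, ht1⟩
      have hstep := Nat.add_one_mul (code X) S
      refine ⟨by rw [hF1.var .cur (by decide), hcur], ?_, by omega, hw1, fun Z hZ hlt => ?_, ?_⟩
      · rw [Conf.frame_setV (by simp)]
        exact hF.trans (hF1.mono (by simp) (by simp))
      · rw [Conf.setV_a, hc', Function.update_apply]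
        split_ifs with heq
        · rwa [code_injective heq]
        · exact hv Z hZ (by omega)
      · rw [Conf.setV_t]
        omega
    · rintro h' ⟨hF, -, hw, hv, ht⟩ -
      exact ⟨Conf.frame_tick.2 hF, hw, fun X hX => hv X hX (code_lt X), by simp at ht ⊢; omega⟩
  rintro h₁ ⟨hF1, hw, hv, ht1⟩
  have hE1 := hE.frame hF1 (by decide) (by decide)
  have hcu : code (Finset.univ : Finset (Fin n)) = 2 ^ n - 1 := code_univ
  have hwu := hw Finset.univ (by omega) (by rw [← hV, G.restrict_V hA]; exact hA) 1
  rw [hcu, Fin.val_one, one_mul] at hwu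
  have hidx : 2 ^ n - 1 + 2 ^ n < cap := by omega
  have hidxB : 2 ^ n - 1 + 2 ^ n < B := by omega
  refine Cmd.wp_seq_of (R := fun h' => h' = h₁.setV .arg (code (G.winSet 1 Finset.univ))) ?_ ?_
  · simp [hE1.pow_eq, hB1, hidx, hidxB, hwu]
  rintro _ rfl
  refine Cmd.wp_mono ?_ (wp_decode (X := G.winSet 1 Finset.univ) (by decide)
    (by simpa using hE1.n_eq) (fun i hi => by simpa using hE1.pw i hi.le) (by simp) (by omega) hB1)
  rintro h₂ ⟨hF2, hb, ht2⟩
  refine ⟨hb, fun X hX => ?_, ?_⟩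
  · rw [hF2.arr .table (by decide)]
    exact hv X hX
  · rw [Conf.setV_t] at ht2
    omega

end SolveAll

/-! ### Reading the presentation of a game -/

/-- The cells `p, p + 1, …` of the array `a` contain the word `l`. -/
def Reads (a : ℕ → ℕ) : ℕ → List ℕ → Prop
  | _, [] => True
  | p, x :: l => a p = x ∧ Reads a (p + 1) l

theorem reads_append {a : ℕ → ℕ} {p : ℕ} {l l' : List ℕ} :
    Reads a p (l ++ l') ↔ Reads a p l ∧ Reads a (p + l.length) l' := by
  induction l generalizing p with
  | nil => simp [Reads]
  | cons x l ih => simp [Reads, ih, and_assoc, add_assoc, add_comm 1]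

theorem Reads.getElem {a : ℕ → ℕ} {p : ℕ} {l : List ℕ} (h : Reads a p l) (i : ℕ)
    (hi : i < l.length) : a (p + i) = l[i] := by
  induction l generalizing p i with
  | nil => simp at hi
  | cons x l ih =>
    cases i with
    | zero => exact h.1
    | succ i =>
      rw [List.getElem_cons_succ, ← ih h.2 i (by simpa using hi)]
      congr 1
      omega

theorem reads_getD (w : List ℕ) : Reads (fun i => w.getD i 0) 0 w := by
  have key : ∀ (l : List ℕ) (a : ℕ → ℕ) (p : ℕ),
      (∀ i, (hi : i < l.length) → a (p + i) = l[i]) → Reads a p l := by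
    intro l
    induction l with
    | nil => exact fun _ _ _ => trivial
    | cons x l ih =>
      refine fun a p h => ⟨h 0 (by simp), ih a (p + 1) fun i hi => ?_⟩
      rw [← List.getElem_cons_succ x l i (by simpa using hi), ← h]
      congr 1
      omega
  exact key w _ 0 fun i hi => by simp [hi]

/-- The array `a` contains a presentation of the game `G` with `m` edges, in which `L` is the list
of the members of `F 0`. -/
structure IsInput {n k : ℕ} (G : ColouredMullerGame (Fin n) (Fin k)) (m cap : ℕ)
    (L : List (List (Fin k))) (a : ℕ → ℕ) : Prop where
  owner : ∀ v : Fin n, a (3 + v) = if v ∈ G.A.pos 1 then 1 else 0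
  colour : ∀ v : Fin n, a (3 + n + v) = G.c v
  src_lt : ∀ e < m, a (3 + (n + n) + (e + e)) < n
  dst_lt : ∀ e < m, a (4 + (n + n) + (e + e)) < n
  edges : ∀ u v : Fin n, (u, v) ∈ G.A.E ↔
    ∃ e < m, a (3 + (n + n) + (e + e)) = u ∧ a (4 + (n + n) + (e + e)) = v
  lists : ListsFamily L (G.F 0)
  family : Reads a (3 + (n + n) + (m + m)) (familyWord L)
  length : 3 + (n + n) + (m + m) + (familyWord L).length ≤ cap

/-- Tabulate the powers of `2`. -/
def tabulatePowers : Cmd :=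
  .put .pw (.lit 0) (.lit 1) ;; .set .i (.lit 0) ;;
  .loop .i (.var .n) (.put .pw (.add (.var .i) (.lit 1))
    (.add (.get .pw (.var .i)) (.get .pw (.var .i))))

/-- The source (for `c = 3`) or the target (for `c = 4`) of the edge number `e` of the input. -/
def edgeEx (c : ℕ) : Ex :=
  .get .input (.add (.add (.lit c) (.add (.var .n) (.var .n))) (.add (.var .e) (.var .e)))

/-- Sort the edges by their targets. -/
def sortEdges : Cmd :=
  .set .pos (.lit 0) ;; .put .start (.lit 0) (.lit 0) ;; .set .j (.lit 0) ;;
  .loop .j (.var .n) (.set .e (.lit 0) ;;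
    .loop .e (.var .m) (.ite (edgeEx 4) (.var .j) .skip (.ite (.var .j) (edgeEx 4) .skip
      (.put .src (.var .pos) (edgeEx 3) ;; .put .dst (.var .pos) (.var .j) ;;
        .set .pos (.add (.var .pos) (.lit 1))))) ;;
    .put .start (.add (.var .j) (.lit 1)) (.var .pos))

/-- Tabulate the characteristic function of `F 0`. -/
def tabulateFamily : Cmd :=
  .set .p (.add (.add (.lit 3) (.add (.var .n) (.var .n))) (.add (.var .m) (.var .m))) ;;
  .set .hi (.get .input (.var .p)) ;; .set .p (.add (.var .p) (.lit 1)) ;; .set .i (.lit 0) ;;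
  .loop .i (.var .hi) (.set .sz (.get .input (.var .p)) ;; .set .p (.add (.var .p) (.lit 1)) ;;
    .set .res (.lit 0) ;; .set .j (.lit 0) ;;
    .loop .j (.var .sz) (.set .res (.add (.var .res) (.get .pw (.get .input (.var .p)))) ;;
      .set .p (.add (.var .p) (.lit 1))) ;;
    .put .fam (.var .res) (.lit 1))

/-- Part of the list of the edges, whose sources and targets are given by `s` and `d`, has been
sorted by targets into `src` and `dst`: all edges with targets below `j`, and those with target `j`
and numbers below `i`. -/
structure SortState (m : ℕ) (s d : ℕ → ℕ) (j i pos : ℕ) (src dst start : ℕ → ℕ) : Prop where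
  pos_eq : pos = ((Finset.range m).filter fun i' => d i' < j ∨ d i' = j ∧ i' < i).card
  mem_iff : ∀ u v, (∃ i' < m, s i' = u ∧ d i' = v ∧ (v < j ∨ v = j ∧ i' < i)) ↔
    ∃ e < pos, src e = u ∧ dst e = v
  dst_eq_iff : ∀ v < j, ∀ e < pos, dst e = v ↔ start v ≤ e ∧ e < start (v + 1)
  start_le : ∀ v < j, start v ≤ start (v + 1)
  start_le_pos : ∀ v ≤ j, start v ≤ pos
  last : ∀ e < pos, dst e = j ↔ start j ≤ e

section EdgeSort

variable {m : ℕ} {s d : ℕ → ℕ} {j i pos : ℕ} {src dst start : ℕ → ℕ}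

/-- The edge number `i` has the target `j` and is appended. -/
theorem SortState.push (h : SortState m s d j i pos src dst start) (hi : i < m) (hd : d i = j) :
    pos < m ∧ SortState m s d j (i + 1) (pos + 1) (Function.update src pos (s i))
      (Function.update dst pos j) start := by
  have hsub : (Finset.range m).filter (fun i' => d i' < j ∨ d i' = j ∧ i' < i + 1) =
      insert i ((Finset.range m).filter fun i' => d i' < j ∨ d i' = j ∧ i' < i) := by
    ext i'
    simp only [Finset.mem_filter, Finset.mem_range, Finset.mem_insert]
    constructor
    · rintro ⟨h1, h2⟩
      by_cases hc : i' = i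
      · exact Or.inl hc
      · exact Or.inr ⟨h1, by omega⟩
    · rintro (rfl | ⟨h1, h2⟩)
      · exact ⟨hi, by omega⟩
      · exact ⟨h1, by omega⟩
  have hcard : pos + 1 =
      ((Finset.range m).filter fun i' => d i' < j ∨ d i' = j ∧ i' < i + 1).card := by
    rw [hsub, Finset.card_insert_of_notMem (by simp [hd]), ← h.pos_eq]
  have hpos : pos < m := by
    have := Finset.card_filter_le (Finset.range m) fun i' => d i' < j ∨ d i' = j ∧ i' < i + 1
    rw [Finset.card_range] at this
    omega
  refine ⟨hpos, hcard, fun u v => ?_, fun v hv e he => ?_, h.start_le,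
    fun v hv => (h.start_le_pos v hv).trans (by omega), fun e he => ?_⟩
  · constructor
    · rintro ⟨i', hi', hs, hd', hc⟩
      by_cases hii : i' = i
      · subst hii
        exact ⟨pos, by omega, by simpa using hs, by simp; omega⟩
      · obtain ⟨e, he, h1, h2⟩ := (h.mem_iff u v).1 ⟨i', hi', hs, hd', by omega⟩
        refine ⟨e, by omega, ?_, ?_⟩
        · rwa [Function.update_of_ne (by omega)]
        · rwa [Function.update_of_ne (by omega)]
    · rintro ⟨e, he, h1, h2⟩
      by_cases hep : e = pos
      · subst hep
        rw [Function.update_self] at h1 h2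
        exact ⟨i, hi, h1, by omega, by omega⟩
      · rw [Function.update_of_ne hep] at h1 h2
        obtain ⟨i', hi', hs, hd', hc⟩ := (h.mem_iff u v).2 ⟨e, by omega, h1, h2⟩
        exact ⟨i', hi', hs, hd', by omega⟩
  · by_cases hep : e = pos
    · subst hep
      have := h.start_le_pos (v + 1) hv
      rw [Function.update_self]
      omega
    · rw [Function.update_of_ne hep]
      exact h.dst_eq_iff v hv e (by omega)
  · by_cases hep : e = pos
    · subst hep
      have := h.start_le_pos j le_rfl
      simpa using this
    · rw [Function.update_of_ne hep]
      exact h.last e (by omega)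

/-- The edge number `i` does not have the target `j`. -/
theorem SortState.skip (h : SortState m s d j i pos src dst start) (hd : d i ≠ j) :
    SortState m s d j (i + 1) pos src dst start := by
  have key : ∀ i', (d i' < j ∨ d i' = j ∧ i' < i + 1) ↔ (d i' < j ∨ d i' = j ∧ i' < i) := by
    intro i'
    by_cases hc : i' = i
    · subst hc
      omega
    · omega
  refine ⟨by simp only [key]; exact h.pos_eq, fun u v => ?_, h.dst_eq_iff, h.start_le,
    h.start_le_pos, h.last⟩
  rw [← h.mem_iff]
  constructor
  · rintro ⟨i', hi', hs, rfl, hc⟩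
    exact ⟨i', hi', hs, rfl, (key i').1 hc⟩
  · rintro ⟨i', hi', hs, rfl, hc⟩
    exact ⟨i', hi', hs, rfl, (key i').2 hc⟩

/-- All edges with target `j` have been appended. -/
theorem SortState.next (h : SortState m s d j m pos src dst start) :
    SortState m s d (j + 1) 0 pos src dst (Function.update start (j + 1) pos) := by
  have key : ∀ i' < m, (d i' < j + 1 ∨ d i' = j + 1 ∧ i' < 0) ↔ (d i' < j ∨ d i' = j ∧ i' < m) := by
    intro i' hi'
    omega
  have hle : ∀ e < pos, dst e ≤ j := by
    intro e he
    obtain ⟨i', -, -, -, hc⟩ := (h.mem_iff _ _).2 ⟨e, he, rfl, rfl⟩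
    omega
  refine ⟨?_, fun u v => ?_, fun v hv e he => ?_, fun v hv => ?_, fun v hv => ?_, fun e he => ?_⟩
  · rw [h.pos_eq]
    congr 1
    refine Finset.filter_congr fun i' hi' => ?_
    rw [key i' (Finset.mem_range.1 hi')]
  · rw [← h.mem_iff]
    constructor
    · rintro ⟨i', hi', hs, rfl, hc⟩
      exact ⟨i', hi', hs, rfl, (key i' hi').1 hc⟩
    · rintro ⟨i', hi', hs, rfl, hc⟩
      exact ⟨i', hi', hs, rfl, (key i' hi').2 hc⟩
  · rw [Function.update_of_ne (by omega)]
    by_cases hvj : v = j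
    · subst hvj
      rw [Function.update_self, h.last e he]
      omega
    · rw [Function.update_of_ne (by omega)]
      exact h.dst_eq_iff v (by omega) e he
  · rw [Function.update_of_ne (by omega)]
    by_cases hvj : v = j
    · subst hvj
      rw [Function.update_self]
      exact h.start_le_pos v le_rfl
    · rw [Function.update_of_ne (by omega)]
      exact h.start_le v (by omega)
  · by_cases hvj : v = j + 1
    · subst hvj
      rw [Function.update_self]
    · rw [Function.update_of_ne hvj]
      exact h.start_le_pos v (by omega)
  · rw [Function.update_self]
    have := hle e he
    omega

theorem SortState.isEdgeTable {n : ℕ} {E : Finset (Fin n × Fin n)}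
    (h : SortState m s d n 0 pos src dst start) (hs : ∀ i < m, s i < n) (hd : ∀ i < m, d i < n)
    (hE : ∀ u v : Fin n, (u, v) ∈ E ↔ ∃ i < m, s i = u ∧ d i = v) :
    IsEdgeTable E m src dst start := by
  have hpos : pos = m := by
    rw [h.pos_eq, Finset.filter_true_of_mem, Finset.card_range]
    exact fun i hi => Or.inl (hd i (Finset.mem_range.1 hi))
  subst hpos
  refine ⟨fun e he => ?_, fun e he => ?_, fun u v => ?_, fun e he v hv => h.dst_eq_iff v hv e he,
    h.start_le, fun v hv => h.start_le_pos _ hv⟩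
  · obtain ⟨i, hi, h1, -⟩ := (h.mem_iff _ _).2 ⟨e, he, rfl, rfl⟩
    rw [← h1]
    exact hs i hi
  · obtain ⟨i, hi, -, h1, -⟩ := (h.mem_iff _ _).2 ⟨e, he, rfl, rfl⟩
    rw [← h1]
    exact hd i hi
  · rw [hE, ← h.mem_iff]
    have := v.2
    constructor
    · rintro ⟨i, hi, h1, h2⟩
      exact ⟨i, hi, h1, h2, by omega⟩
    · rintro ⟨i, hi, h1, h2, -⟩
      exact ⟨i, hi, h1, h2⟩

end EdgeSort

section Prepare

variable {n k m B cap : ℕ} {G : ColouredMullerGame (Fin n) (Fin k)} {L : List (List (Fin k))}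
  {h : Conf}

theorem wp_tabulatePowers (hB : Bounds n k m B cap) (hn : h.v .n = n) :
    tabulatePowers.wp 15 B cap (fun h' => h.Frame [.i] [.pw] h' ∧
      (∀ i ≤ n, h'.a .pw i = 2 ^ i) ∧ h'.t ≤ h.t + (2 * n + 3)) h := by
  have hn2 := Nat.lt_two_pow_self (n := n)
  have h1 := hB.pow
  have h2 := hB.space
  have hB0 : 0 < B := by omega
  have hB1 : 1 < B := by omega
  have hc0 : 0 < cap := by omega
  have hF0 := h.frame_refl [.i] [.pw]
  refine ⟨hB0, hB1, by simp, hc0, hB0, fun i h' => h.Frame [.i] [.pw] h' ∧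
    (∀ i' ≤ i, h'.a .pw i' = 2 ^ i') ∧ h'.t ≤ h.t + (2 * i + 2), n, ?_, ?_, ?_, ?_, ?_⟩
  · simp
  · simp [hF0]
  · intro i h' _ hI _
    exact ⟨trivial, (hI.1.var .n (by simp)).trans hn⟩
  · rintro i h' hi ⟨hF, hp, ht⟩ hvi
    have hpi := hp i le_rfl
    have hle : 2 ^ (i + 1) ≤ 2 ^ n := Nat.pow_le_pow_right (by omega) hi
    have hic : i < cap := by omega
    have hic' : i + 1 < cap := by omega
    have hiB : i + 1 < B := by omega
    have hpB : 2 ^ i + 2 ^ i < B := by rw [pow_succ] at hle; omega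
    simp [hvi, hpi, hF, hB1, hic, hic', hiB, hpB]
    refine ⟨fun i' hi' => ?_, by omega⟩
    rw [Function.update_apply]
    split_ifs with hc
    · rw [hc, pow_succ]
      omega
    · exact hp i' (by omega)
  · rintro h' ⟨hF, hp, ht⟩ -
    exact ⟨Conf.frame_tick.2 hF, by simpa using hp, by simp; omega⟩

theorem wp_sortEdges (hB : Bounds n k m B cap) (hn : h.v .n = n) (hm : h.v .m = m)
    (hI : IsInput G m cap L (h.a .input)) :
    sortEdges.wp 15 B cap (fun h' => h.Frame [.pos, .j, .e] [.start, .src, .dst] h' ∧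
      IsEdgeTable G.A.E m (h'.a .src) (h'.a .dst) (h'.a .start) ∧
      h'.t ≤ h.t + (n * (6 * m + 4) + 4)) h := by
  have hn2 := Nat.lt_two_pow_self (n := n)
  have h1 := hB.pow
  have h2 := hB.space
  have hlen := hI.length
  have hB0 : 0 < B := by omega
  have hB1 : 1 < B := by omega
  have hc0 : 0 < cap := by omega
  have hF0 := h.frame_refl [.pos, .j, .e] [.start, .src, .dst]
  set s : ℕ → ℕ := fun e => h.a .input (3 + (n + n) + (e + e)) with hs
  set d : ℕ → ℕ := fun e => h.a .input (4 + (n + n) + (e + e)) with hd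
  obtain ⟨A, hA⟩ : ∃ A, 6 * m = A := ⟨_, rfl⟩
  rw [hA]
  refine ⟨hB0, hB0, hB0, by simp, hc0, hB0, fun j h' =>
    h.Frame [.pos, .j, .e] [.start, .src, .dst] h' ∧
    SortState m s d j 0 (h'.v .pos) (h'.a .src) (h'.a .dst) (h'.a .start) ∧
    h'.t ≤ h.t + (j * (A + 4) + 3), n, ?_, ?_, ?_, ?_, ?_⟩
  · simp
  · simp [hF0]
    exact ⟨by simp, by simp, by simp, by simp, by simp, by simp⟩
  · intro i h' _ hI _
    exact ⟨trivial, (hI.1.var .n (by simp)).trans hn⟩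
  · rintro j h' hj ⟨hF, hS, ht⟩ hvj
    have hstep := Nat.add_one_mul j (A + 4)
    refine Cmd.wp_seq_of (R := fun h' => h' = _) ⟨hB0, rfl⟩ ?_
    rintro _ rfl
    refine Cmd.wp_seq_of (R := fun h'' => h.Frame [.pos, .j, .e] [.start, .src, .dst] h'' ∧
      h''.v .j = j ∧ h''.v .pos ≤ m ∧
      SortState m s d j m (h''.v .pos) (h''.a .src) (h''.a .dst) (h''.a .start) ∧
      h''.t ≤ h'.t + (A + 2)) ?_ ?_
    · refine ⟨fun e h'' => h.Frame [.pos, .j, .e] [.start, .src, .dst] h'' ∧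
        h''.v .j = j ∧ h''.v .pos ≤ m ∧
        SortState m s d j e (h''.v .pos) (h''.a .src) (h''.a .dst) (h''.a .start) ∧
        h''.t ≤ h'.t + (6 * e + 1), m, ?_, ?_, ?_, ?_, ?_⟩
      · simp
      · simp [hF, hvj, hS]
        rw [hS.pos_eq]
        exact (Finset.card_filter_le _ _).trans (Finset.card_range m).le
      · intro i h' _ hI _
        exact ⟨trivial, (hI.1.var .m (by simp)).trans hm⟩
      · rintro e h₁ he ⟨hF1, hj1, hp1, hS1, ht1⟩ hve
        have hn1 : h₁.v .n = n := (hF1.var .n (by simp)).trans hn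
        have hin1 : h₁.a .input = h.a .input := hF1.arr .input (by simp)
        have hs1 : h.a .input (3 + (n + n) + (e + e)) = s e := rfl
        have hd1 : h.a .input (4 + (n + n) + (e + e)) = d e := rfl
        have hc3 : 3 + (n + n) + (e + e) < cap := by omega
        have hc4 : 4 + (n + n) + (e + e) < cap := by omega
        have hb3 : 3 + (n + n) + (e + e) < B := by omega
        have hb4 : 4 + (n + n) + (e + e) < B := by omega
        have hb1 : 3 + (n + n) < B := by omega
        have hb2 : 4 + (n + n) < B := by omega
        have hb5 : n + n < B := by omega
        have hb6 : e + e < B := by omega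
        have hb7 : 3 < B := by omega
        have hb8 : 4 < B := by omega
        have hpc : h₁.v .pos < cap := by omega
        have hpB : h₁.v .pos + 1 < B := by omega
        rcases Nat.lt_trichotomy (d e) j with hlt | heq | hgt
        · simp [edgeEx, hve, hj1, hn1, hin1, hd1, hc4, hb4, hb2, hb5, hb6, hb8, hlt, hF1, hp1]
          exact ⟨hS1.skip hlt.ne, by omega⟩
        · obtain ⟨hpm, hS2⟩ := hS1.push he heq
          simp [edgeEx, hve, hj1, hn1, hin1, hs1, hd1, hc3, hc4, hb3, hb4, hb1, hb2, hb5, hb6, hb7,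
            hb8, heq, hF1, hpc, hpB, hB1]
          exact ⟨hpm, hS2, by omega⟩
        · simp [edgeEx, hve, hj1, hn1, hin1, hd1, hc4, hb4, hb2, hb5, hb6, hb8, hgt, hgt.le, hF1,
            hp1]
          exact ⟨hS1.skip hgt.ne', by omega⟩
      · rintro h₁ ⟨hF1, hj1, hp1, hS1, ht1⟩ -
        exact ⟨Conf.frame_tick.2 hF1, hj1, hp1, hS1, by simp; omega⟩
    rintro h₁ ⟨hF1, hj1, hp1, hS1, ht1⟩
    have hjc : j + 1 < cap := by omega
    have hjB : j + 1 < B := by omega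
    simp [hj1, hB1, hjc, hjB, hF1]
    exact ⟨hS1.next, by omega⟩
  · rintro h' ⟨hF, hS, ht⟩ -
    refine ⟨Conf.frame_tick.2 hF, hS.isEdgeTable hI.src_lt hI.dst_lt hI.edges, ?_⟩
    simp
    omega

theorem code_toFinset_take_succ {S : List (Fin k)} (hS : S.Nodup) {j : ℕ} (hj : j < S.length) :
    code (S.take (j + 1)).toFinset = code (S.take j).toFinset + 2 ^ (S[j] : ℕ) := by
  simp only [code]
  rw [List.sum_toFinset _ (hS.sublist (List.take_sublist _ _)),
    List.sum_toFinset _ (hS.sublist (List.take_sublist _ _)), List.take_succ_eq_append_getElem hj,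
    List.map_append, List.sum_append]
  simp

theorem ListsFamily.length_le {F : Finset (Finset (Fin k))} (hL : ListsFamily L F) :
    L.length ≤ 2 ^ k := by
  have := hL.2.1.length_le_card
  simpa using this

theorem wp_tabulateFamily (hB : Bounds n k m B cap) (hn : h.v .n = n) (hm : h.v .m = m)
    (hI : IsInput G m cap L (h.a .input)) (hpw : ∀ i ≤ n, h.a .pw i = 2 ^ i)
    (hfam : ∀ i < cap, h.a .fam i = 0) :
    tabulateFamily.wp 15 B cap (fun h' => h.Frame [.p, .hi, .i, .sz, .res, .j] [.fam] h' ∧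
      (∀ S : Finset (Fin k), h'.a .fam (code S) = if S ∈ G.F 0 then 1 else 0) ∧
      h'.t ≤ h.t + (2 ^ n * (3 * n + 8) + 5)) h := by
  have hn2 := Nat.lt_two_pow_self (n := n)
  have h1 := hB.pow
  have h2 := hB.space
  have hkn := hB.colours
  have hpk : 2 ^ k ≤ 2 ^ n := Nat.pow_le_pow_right (by omega) hkn
  have hlen := hI.length
  have hB0 : 0 < B := by omega
  have hB1 : 1 < B := by omega
  have hB3 : 3 < B := by omega
  have hF0 := h.frame_refl [.p, .hi, .i, .sz, .res, .j] [.fam]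
  have hLk := hI.lists.length_le
  obtain ⟨hL0, hLr⟩ := hI.family
  rw [familyWord, List.length_cons] at hlen
  obtain ⟨A, hA⟩ : ∃ A, 3 * n + 8 = A := ⟨_, rfl⟩
  rw [hA]
  set P := 3 + (n + n) + (m + m) with hP
  have hPc : P < cap := by omega
  have hPB : P < B := by omega
  have hPB1 : P + 1 < B := by omega
  have hb1 : 3 + (n + n) < B := by omega
  have hb2 : n + n < B := by omega
  have hb3 : m + m < B := by omega
  refine Cmd.wp_seq_of (R := fun h' => h' = h.setV .p P) ?_ ?_
  · simp [hn, hm, hB3, hb1, hb2, hb3, ← hP, hPB]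
  rintro _ rfl
  refine Cmd.wp_seq_of (R := fun h' => h' = (h.setV .p P).setV .hi L.length) ?_ ?_
  · simp [hPc, hL0]
  rintro _ rfl
  refine Cmd.wp_seq_of (R := fun h' => h' = ((h.setV .p P).setV .hi L.length).setV .p (P + 1)) ?_ ?_
  · simp [hB1, hPB1]
  rintro _ rfl
  refine Cmd.wp_seq_of (R := fun h' => h' = _) ⟨hB0, rfl⟩ ?_
  rintro _ rfl
  refine ⟨fun i h' => h.Frame [.p, .hi, .i, .sz, .res, .j] [.fam] h' ∧ h'.v .hi = L.length ∧
    Reads (h.a .input) (h'.v .p) ((L.drop i).flatMap fun S => S.length :: S.map Fin.val) ∧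
    h'.v .p + ((L.drop i).flatMap fun S => S.length :: S.map Fin.val).length ≤ cap ∧
    (∀ S : Finset (Fin k), h'.a .fam (code S) =
      if S ∈ (L.take i).map List.toFinset then 1 else 0) ∧
    h'.t ≤ h.t + (i * A + 4), L.length, ?_, ?_, ?_, ?_, ?_⟩
  · simp
  · simp only [Conf.setV_same]
    refine ⟨by simp [hF0], by simp, by simpa using hLr, by simp at hlen ⊢; omega,
      fun S => ?_, by simp⟩
    have := code_lt S
    simpa using hfam (code S) (by omega)
  · intro i h' _ hI _
    exact ⟨trivial, hI.2.1⟩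
  · rintro i h' hi ⟨hF, hhi, hR, hl, hfm, ht⟩ hvi
    have hstep := Nat.add_one_mul i A
    obtain ⟨S, hS⟩ : ∃ S, L[i] = S := ⟨_, rfl⟩
    obtain ⟨p, hp⟩ : ∃ p, h'.v .p = p := ⟨_, rfl⟩
    have hSn : S.Nodup := hI.lists.1 S (hS ▸ List.getElem_mem hi)
    have hSk : S.length ≤ k := by simpa using hSn.length_le_card
    rw [List.drop_eq_getElem_cons hi, hS, List.flatMap_cons, hp, List.cons_append] at hR hl
    rw [List.length_cons, List.length_append, List.length_map] at hl
    obtain ⟨hRp, hR⟩ := hR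
    rw [reads_append, List.length_map] at hR
    obtain ⟨hRS, hR⟩ := hR
    have hin : h'.a .input = h.a .input := hF.arr .input (by simp)
    have hpc : p < cap := by omega
    have hpB : p + 1 < B := by omega
    refine Cmd.wp_seq_of (R := fun h₁ => h₁ = h'.setV .sz S.length) ?_ ?_
    · simp [hp, hpc, hin, hRp]
    rintro _ rfl
    refine Cmd.wp_seq_of (R := fun h₁ => h₁ = (h'.setV .sz S.length).setV .p (p + 1)) ?_ ?_
    · simp [hp, hpB, hB1]
    rintro _ rfl
    refine Cmd.wp_seq_of (R := fun h₁ => h₁ = _) ⟨hB0, rfl⟩ ?_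
    rintro _ rfl
    refine Cmd.wp_seq_of (R := fun h₁ => h₁ = _) ⟨hB0, rfl⟩ ?_
    rintro _ rfl
    refine Cmd.wp_seq_of (R := fun h₁ => h.Frame [.p, .hi, .i, .sz, .res, .j] [.fam] h₁ ∧
      h₁.v .hi = L.length ∧ h₁.v .i = i ∧ h₁.a .fam = h'.a .fam ∧ h₁.v .p = p + 1 + S.length ∧
      h₁.v .res = code S.toFinset ∧ h₁.t ≤ h'.t + (3 * n + 5)) ?_ ?_
    · refine ⟨fun j h₁ => h.Frame [.p, .hi, .i, .sz, .res, .j] [.fam] h₁ ∧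
        h₁.v .hi = L.length ∧ h₁.v .i = i ∧ h₁.a .fam = h'.a .fam ∧ h₁.v .sz = S.length ∧
        h₁.v .p = p + 1 + j ∧ h₁.v .res = code (S.take j).toFinset ∧
        h₁.t ≤ h'.t + (3 * j + 4), S.length, ?_, ?_, ?_, ?_, ?_⟩
      · simp
      · simp [hF, hhi, hvi, code_empty]
      · intro j h₁ _ hI _
        exact ⟨trivial, hI.2.2.2.2.1⟩
      · rintro j h₁ hj ⟨hF1, hhi1, hi1, hfm1, hsz1, hp1, hres1, ht1⟩ hvj
        have hin1 : h₁.a .input = h.a .input := hF1.arr .input (by simp)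
        have hval : h.a .input (p + 1 + j) = (S[j] : ℕ) := by
          rw [hRS.getElem j (by simpa using hj), List.getElem_map]
        have hSj := S[j].2
        have hpw1 : h₁.a .pw (S[j] : ℕ) = 2 ^ (S[j] : ℕ) := by
          rw [hF1.arr .pw (by simp)]
          exact hpw _ (by omega)
        have hc1 : p + 1 + j < cap := by omega
        have hc2 : (S[j] : ℕ) < cap := by omega
        have hb4 : p + 1 + j + 1 < B := by omega
        have hcode := code_toFinset_take_succ hSn hj
        have hcl := code_lt (S.take (j + 1)).toFinset
        have hb5 : code (S.take j).toFinset + 2 ^ (S[j] : ℕ) < B := by omega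
        simp [hF1, hhi1, hi1, hfm1, hsz1, hp1, hres1, hvj, hin1, hval, hpw1, hc1, hc2, hb4, hb5, hB1,
          hcode]
        omega
      · rintro h₁ ⟨hF1, hhi1, hi1, hfm1, hsz1, hp1, hres1, ht1⟩ -
        rw [List.take_length] at hres1
        exact ⟨Conf.frame_tick.2 hF1, hhi1, hi1, hfm1, hp1, hres1, by simp; omega⟩
    rintro h₁ ⟨hF1, hhi1, hi1, hfm1, hp1, hres1, ht1⟩
    have hcl := code_lt S.toFinset
    have hcc : code S.toFinset < cap := by omega
    simp only [Cmd.wp_put, Ex.Safe, Ex.eval, hres1, hcc, hB1, true_and, Arr.ctorIdx_lt]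
    refine ⟨by simpa using hi1, by simp [hF1], by simpa using hhi1, ?_, ?_, fun T => ?_, ?_⟩
    · simpa [hp1] using hR
    · simp [hp1] at hl ⊢
      omega
    · simp only [List.take_succ_eq_append_getElem hi, hS, List.map_append, List.mem_append,
        List.map_cons, List.map_nil, List.mem_singleton, Conf.setV_a, Conf.setA_same, hfm1]
      by_cases hTS : T = S.toFinset
      · subst hTS
        simp
      · rw [Function.update_of_ne fun hc => hTS (code_injective hc), hfm T]
        simp [hTS]
    · simp
      omega
  · rintro h' ⟨hF, hhi, hR, hl, hfm, ht⟩ -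
    refine ⟨Conf.frame_tick.2 hF, fun S => ?_, ?_⟩
    · simp only [Conf.tick_a, hfm, List.take_length, ← hI.lists.2.2, List.mem_toFinset]
    · have := Nat.mul_le_mul_right A (hLk.trans hpk)
      simp
      omega

end Prepare

/-! ### Sizes of presentations -/

section Presentation

variable {n k : ℕ} {G : ColouredMullerGame (Fin n) (Fin k)}

/-- Each colour belongs to half of the sets of colours. -/
theorem two_mul_sum_card (k : ℕ) : 2 * ∑ S : Finset (Fin k), S.card = k * 2 ^ k := by
  have h1 : ∑ S : Finset (Fin k), Sᶜ.card = ∑ S : Finset (Fin k), S.card :=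
    Equiv.sum_comp (Function.Involutive.toPerm _ (compl_involutive (α := Finset (Fin k))))
      Finset.card
  have h2 : ∑ S : Finset (Fin k), (S.card + Sᶜ.card) = k * 2 ^ k := by
    simp only [Finset.card_add_card_compl, Finset.sum_const, Finset.card_univ, Fintype.card_fin,
      Fintype.card_finset, smul_eq_mul]
    exact mul_comm _ _
  rw [Finset.sum_add_distrib, h1] at h2
  omega

theorem ColouredMullerGame.disjoint_F : Disjoint (G.F 0) (G.F 1) :=
  Finset.disjoint_iff_inter_eq_empty.2 G.inter_eq

theorem ColouredMullerGame.size_eq :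
    G.size = G.A.V.card + G.A.E.card + ∑ S : Finset (Fin k), S.card := by
  rw [size, Fin.sum_univ_two, ← Finset.sum_union G.disjoint_F, G.union_eq]

theorem ListsFamily.length_familyWord {L : List (List (Fin k))} {F : Finset (Finset (Fin k))}
    (hL : ListsFamily L F) : (familyWord L).length = 1 + F.card + ∑ S ∈ F, S.card := by
  obtain ⟨h1, h2, rfl⟩ := hL
  rw [List.toFinset_card_of_nodup h2, List.sum_toFinset _ h2, List.length_map, familyWord,
    List.length_cons, List.map_map]
  clear h2
  induction L with
  | nil => rfl
  | cons S L ih =>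
    have := ih fun T hT => h1 T (List.mem_cons_of_mem _ hT)
    have hS := List.toFinset_card_of_nodup (h1 S List.mem_cons_self)
    simp only [List.flatMap_cons, List.length_append, List.length_cons, List.length_map,
      List.map_cons, List.sum_cons, Function.comp_apply, hS]
    omega

theorem Reads.edge {a : ℕ → ℕ} {p : ℕ} {es : List (Fin n × Fin n)}
    (h : Reads a p (es.flatMap fun e => [(e.1 : ℕ), (e.2 : ℕ)])) (i : ℕ) (hi : i < es.length) :
    a (p + (i + i)) = es[i].1 ∧ a (p + 1 + (i + i)) = es[i].2 := by
  induction es generalizing p i with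
  | nil => simp at hi
  | cons e es ih =>
    obtain ⟨h1, h2, h3⟩ := h
    cases i with
    | zero => exact ⟨h1, h2⟩
    | succ i =>
      obtain ⟨h4, h5⟩ := ih h3 i (by simpa using hi)
      rw [List.getElem_cons_succ, ← h4, ← h5]
      constructor <;> congr 1 <;> omega

/-- A word that presents a game is an input in the sense of the algorithm. -/
theorem IsPresentation.isInput {w : List ℕ} (hw : IsPresentation G w) (hkn : k ≤ n) {cap : ℕ}
    (hcap : cap = 5 + (n + n + (G.A.E.card + G.A.E.card)) + (2 ^ n + 2 ^ n + (2 ^ k + k * 2 ^ k))) :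
    w.length ≤ cap ∧ (∀ x ∈ w, x ≤ n + G.A.E.card + 2 ^ n) ∧
    w.getD 0 0 = n ∧ w.getD 1 0 = k ∧ w.getD 2 0 = G.A.E.card ∧
    ∃ L, IsInput G G.A.E.card cap L fun i => w.getD i 0 := by
  obtain ⟨es, L₀, L₁, hes, hE, hL₀, hL₁, rfl⟩ := hw
  have hm : es.length = G.A.E.card := by rw [← hE, List.toFinset_card_of_nodup hes]
  have hmem : ∀ e, e ∈ G.A.E ↔ e ∈ es := fun e => by rw [← hE, List.mem_toFinset]
  have hlen : (es.flatMap fun e => [(e.1 : ℕ), (e.2 : ℕ)]).length = es.length + es.length := by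
    simp [List.length_flatMap, mul_two]
  have hf₀ := hL₀.length_familyWord
  have hf₁ := hL₁.length_familyWord
  have hsum : ∑ S ∈ G.F 0, S.card + ∑ S ∈ G.F 1, S.card = ∑ S : Finset (Fin k), S.card := by
    rw [← Finset.sum_union G.disjoint_F, G.union_eq]
  have hcard : (G.F 0).card + (G.F 1).card = 2 ^ k := by
    rw [← Finset.card_union_of_disjoint G.disjoint_F, G.union_eq]
    simp
  have hD := two_mul_sum_card k
  have hR := reads_getD ([n, k, es.length] ++
      (List.finRange n).map (fun v => if v ∈ G.A.pos 1 then 1 else 0) ++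
      (List.finRange n).map (fun v => (G.c v : ℕ)) ++
      es.flatMap (fun e : Fin n × Fin n => [(e.1 : ℕ), (e.2 : ℕ)]) ++ familyWord L₀ ++ familyWord L₁)
  have hpk : 2 ^ k ≤ 2 ^ n := Nat.pow_le_pow_right (by omega) hkn
  refine ⟨?_, ?_, rfl, rfl, hm, L₀, ?_⟩
  · simp only [List.length_append, List.length_map, List.length_finRange, hlen, hf₀, hf₁,
      List.length_cons, List.length_nil]
    omega
  · have hn2 := Nat.lt_two_pow_self (n := n)
    have hfw : ∀ (L : List (List (Fin k))) (F : Finset (Finset (Fin k))), ListsFamily L F →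
        ∀ x ∈ familyWord L, x ≤ 2 ^ n := by
      intro L F hL x hx
      have := hL.length_le
      rw [familyWord, List.mem_cons, List.mem_flatMap] at hx
      rcases hx with rfl | ⟨S, hS, hx⟩
      · omega
      · rw [List.mem_cons, List.mem_map] at hx
        rcases hx with rfl | ⟨q, -, rfl⟩
        · have : S.length ≤ k := by simpa using (hL.1 S hS).length_le_card
          omega
        · omega
    intro x hx
    simp only [List.mem_append, List.mem_map, List.mem_flatMap, List.mem_cons, List.not_mem_nil,
      or_false] at hx
    rcases hx with (((((rfl | rfl | rfl) | ⟨v, -, rfl⟩) | ⟨v, -, rfl⟩) | ⟨e, -, rfl | rfl⟩) | hx) |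
      hx
    · omega
    · omega
    · omega
    · split_ifs <;> omega
    · have := (G.c v).2
      omega
    · have := e.1.2
      omega
    · have := e.2.2
      omega
    · have := hfw _ _ hL₀ x hx
      omega
    · have := hfw _ _ hL₁ x hx
      omega
  · simp only [reads_append, List.length_append, List.length_map, List.length_finRange, hlen,
      List.length_cons, List.length_nil, zero_add] at hR
    obtain ⟨⟨⟨⟨⟨-, howner⟩, hcolour⟩, hedges⟩, hfam⟩, -⟩ := hR
    obtain ⟨a, ha⟩ : ∃ a : ℕ → ℕ, (fun i => ([n, k, es.length] ++
      (List.finRange n).map (fun v => if v ∈ G.A.pos 1 then 1 else 0) ++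
      (List.finRange n).map (fun v => (G.c v : ℕ)) ++
      es.flatMap (fun e : Fin n × Fin n => [(e.1 : ℕ), (e.2 : ℕ)]) ++ familyWord L₀ ++
      familyWord L₁).getD i 0) = a := ⟨_, rfl⟩
    rw [ha] at howner hcolour hedges hfam ⊢
    have hs : ∀ e, (he : e < es.length) → a (3 + (n + n) + (e + e)) = es[e].1 ∧
        a (4 + (n + n) + (e + e)) = es[e].2 := by
      intro e he
      obtain ⟨h1, h2⟩ := hedges.edge e he
      rw [← h1, ← h2]
      constructor <;> congr 1 <;> omega
    simp only [hm] at hfam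
    refine ⟨fun v => ?_, fun v => ?_, fun e he => ?_, fun e he => ?_, fun u v => ?_, hL₀, ?_, ?_⟩
    · have := howner.getElem v (by simp)
      simpa using this
    · have := hcolour.getElem v (by simp)
      simpa using this
    · rw [(hs e (hm ▸ he)).1]
      exact Fin.is_lt _
    · rw [(hs e (hm ▸ he)).2]
      exact Fin.is_lt _
    · rw [hmem, List.mem_iff_getElem]
      constructor
      · rintro ⟨e, he, hee⟩
        have := hs e he
        rw [hee] at this
        exact ⟨e, hm ▸ he, this⟩
      · rintro ⟨e, he, h1, h2⟩
        have := hs e (hm ▸ he)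
        rw [h1, h2] at this
        exact ⟨e, hm.symm ▸ he, Prod.ext (Fin.ext this.1.symm) (Fin.ext this.2.symm)⟩
    · convert hfam using 1
      omega
    · omega

end Presentation

/-! ### The complete program -/

/-- Compute the numbers of positions, colours and edges, the number of sets of positions, and a
capacity of the arrays that suffices for the input and for a table indexed by two players and all
sets of positions. Only the array `input` is used. -/
def initialise : Cmd :=
  .set .n (.get .input (.lit 0)) ;; .set .k (.get .input (.lit 1)) ;;
  .set .m (.get .input (.lit 2)) ;;
  .set .pow (.lit 1) ;; .set .j (.lit 0) ;;
  .loop .j (.var .n) (.set .pow (.add (.var .pow) (.var .pow))) ;;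
  .set .sz (.lit 1) ;; .set .j (.lit 0) ;;
  .loop .j (.var .k) (.set .sz (.add (.var .sz) (.var .sz))) ;;
  .set .acc (.lit 0) ;; .set .j (.lit 0) ;;
  .loop .j (.var .k) (.set .acc (.add (.var .acc) (.var .sz))) ;;
  .set .cap (.add (.add (.lit 5) (.add (.add (.var .n) (.var .n)) (.add (.var .m) (.var .m))))
    (.add (.add (.var .pow) (.var .pow)) (.add (.var .sz) (.var .acc))))

theorem wp_initialise {n k m B cap : ℕ} {h : Conf} (hn : h.a .input 0 = n) (hk : h.a .input 1 = k)
    (hm : h.a .input 2 = m)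
    (hcap : cap = 5 + (n + n + (m + m)) + (2 ^ n + 2 ^ n + (2 ^ k + k * 2 ^ k))) (hB : cap < B) :
    initialise.wp 1 B B (fun h' => h'.a = h.a ∧ h'.v .n = n ∧ h'.v .k = k ∧ h'.v .m = m ∧
      h'.v .pow = 2 ^ n ∧ h'.v .cap = cap ∧ h'.t ≤ h.t + (2 * n + 4 * k + 13)) h := by
  have hn0 := Nat.two_pow_pos n
  have hk0 := Nat.two_pow_pos k
  have hB0 : 0 < B := by omega
  have hB1 : 1 < B := by omega
  have hB2 : 2 < B := by omega
  have hin : Arr.input.ctorIdx < 1 := by decide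
  refine Cmd.wp_seq_of (R := fun h' => h' = h.setV .n n) ⟨⟨hB0, hin, hB0⟩, by simp [hn]⟩ ?_
  rintro _ rfl
  refine Cmd.wp_seq_of (R := fun h' => h' = (h.setV .n n).setV .k k) ⟨⟨hB1, hin, hB1⟩,
    by simp [hk]⟩ ?_
  rintro _ rfl
  refine Cmd.wp_seq_of (R := fun h' => h' = ((h.setV .n n).setV .k k).setV .m m)
    ⟨⟨hB2, hin, hB2⟩, by simp [hm]⟩ ?_
  rintro _ rfl
  refine ⟨hB1, hB0, fun j h' => h'.a = h.a ∧ h'.v .n = n ∧ h'.v .k = k ∧ h'.v .m = m ∧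
    h'.v .pow = 2 ^ j ∧ h'.t ≤ h.t + (2 * j + 5), n, ?_, ?_, ?_, ?_, ?_⟩
  · simp
  · simp
  · exact fun i h' _ hI _ => ⟨trivial, hI.2.1⟩
  · rintro j h' hj ⟨h1, h2, h3, h4, h5, h6⟩ hvj
    have hle : 2 ^ (j + 1) ≤ 2 ^ n := Nat.pow_le_pow_right (by omega) hj
    rw [pow_succ] at hle
    have hlt : 2 ^ j + 2 ^ j < B := by omega
    simp [*, pow_succ]
    omega
  rintro h₁ ⟨h1, h2, h3, h4, h5, h6⟩ -
  refine ⟨hB1, hB0, fun j h' => h'.a = h.a ∧ h'.v .n = n ∧ h'.v .k = k ∧ h'.v .m = m ∧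
    h'.v .pow = 2 ^ n ∧ h'.v .sz = 2 ^ j ∧ h'.t ≤ h.t + (2 * n + 2 * j + 8), k, ?_, ?_, ?_, ?_, ?_⟩
  · simp
  · simp [*]
    omega
  · exact fun i h' _ hI _ => ⟨trivial, hI.2.2.1⟩
  · rintro j h' hj ⟨h1, h2, h3, h4, h5, h6, h7⟩ hvj
    have hle : 2 ^ (j + 1) ≤ 2 ^ k := Nat.pow_le_pow_right (by omega) hj
    rw [pow_succ] at hle
    have hlt : 2 ^ j + 2 ^ j < B := by omega
    simp [*, pow_succ]
    omega
  rintro h₂ ⟨h1, h2, h3, h4, h5, h6, h7⟩ -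
  refine ⟨hB0, hB0, fun j h' => h'.a = h.a ∧ h'.v .n = n ∧ h'.v .k = k ∧ h'.v .m = m ∧
    h'.v .pow = 2 ^ n ∧ h'.v .sz = 2 ^ k ∧ h'.v .acc = j * 2 ^ k ∧
    h'.t ≤ h.t + (2 * n + 2 * k + 2 * j + 11), k, ?_, ?_, ?_, ?_, ?_⟩
  · simp
  · simp [*]
    omega
  · exact fun i h' _ hI _ => ⟨trivial, hI.2.2.1⟩
  · rintro j h' hj ⟨h1, h2, h3, h4, h5, h6, h7, h8⟩ hvj
    have hle : (j + 1) * 2 ^ k ≤ k * 2 ^ k := Nat.mul_le_mul_right _ hj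
    rw [Nat.add_one_mul] at hle
    have hlt : j * 2 ^ k + 2 ^ k < B := by omega
    simp [*, Nat.add_one_mul]
    omega
  rintro h₃ ⟨h1, h2, h3, h4, h5, h6, h7, h8⟩ -
  simp only [Cmd.wp_set, Ex.Safe, Ex.eval, Conf.tick_v, Conf.setV_a, Conf.tick_a, h1, h2, h3, h4,
    h5, h6, h7, ← hcap, ne_eq, reduceCtorEq, not_false_eq_true, Conf.setV_of_ne, Conf.setV_same,
    true_and]
  refine ⟨by omega, ?_⟩
  simp
  omega

/-- Store the base addresses of the first `b + 1` arrays. -/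
def setBases : ℕ → Prog
  | 0 => .skip
  | b + 1 => .seq (setBases b) (.add (3 * (b + 1) + 2) (3 * b + 2) (3 * Var.cap.ctorIdx))

theorem exec_setBases {B cap : ℕ} {s : State} (h0 : s.reg 2 = 0)
    (hcap : s.reg (3 * Var.cap.ctorIdx) = cap) (b : ℕ) (hb : b * cap < B) :
    ∃ s', Exec B (setBases b) s s' (b + 1) ∧ s'.mem = s.mem ∧
      (∀ r, r % 3 ≠ 2 → s'.reg r = s.reg r) ∧ ∀ b' ≤ b, s'.reg (3 * b' + 2) = b' * cap := by
  induction b with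
  | zero =>
    refine ⟨s, Exec.skip s, rfl, fun _ _ => rfl, fun b' hb' => ?_⟩
    obtain rfl : b' = 0 := by omega
    simpa using h0
  | succ b ih =>
    rw [Nat.add_one_mul] at hb
    obtain ⟨s', hx, hmem, hreg, hbase⟩ := ih (by omega)
    have h1 : s'.reg (3 * b + 2) = b * cap := hbase b le_rfl
    have h2 : s'.reg (3 * Var.cap.ctorIdx) = cap := by rw [hreg _ (by omega), hcap]
    refine ⟨_, Exec.seq _ _ _ _ _ _ _ hx (Exec.add _ _ _ _ (by rw [h1, h2]; exact hb)), hmem,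
      fun r hr => ?_, fun b' hb' => ?_⟩
    · rw [← hreg r hr]
      exact Function.update_of_ne (by omega) ..
    · by_cases hc : b' = b + 1
      · subst hc
        simp only [Function.update_self, h1, h2]
        rw [Nat.add_one_mul]
      · rw [← hbase b' (by omega)]
        exact Function.update_of_ne (by omega) ..

/-- The program for a memory that is divided into arrays. -/
def solveGame : Cmd := tabulatePowers ;; sortEdges ;; tabulateFamily ;; solveAll

theorem wp_solveGame {n k m B cap : ℕ} {G : ColouredMullerGame (Fin n) (Fin k)}
    {L : List (List (Fin k))} {h : Conf} (hB : Bounds n k m B cap) (hA : G.A.IsArena)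
    (hV : G.A.V = Finset.univ) (hn : h.v .n = n) (hk : h.v .k = k) (hm : h.v .m = m)
    (hpow : h.v .pow = 2 ^ n) (hI : IsInput G m cap L (h.a .input))
    (hfam : ∀ i < cap, h.a .fam i = 0) (hwin : ∀ i < cap, h.a .win i = 0) :
    solveGame.wp 15 B cap (fun h' => IsBits (h'.a .winner) (G.winSet 1 Finset.univ) ∧
      (∀ X : Finset (Fin n), X.Nonempty → IsVerdict G X (h'.a .table (code X))) ∧
      h'.t ≤ h.t + 200 * (2 ^ n * n * m)) h := by
  have hn2 := Nat.lt_two_pow_self (n := n)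
  have h1 := hB.pow
  refine Cmd.wp_seq_of (wp_tabulatePowers hB hn) ?_
  rintro h₁ ⟨hF1, hpw1, ht1⟩
  have hn1 := (hF1.var .n (by decide)).trans hn
  have hm1 := (hF1.var .m (by decide)).trans hm
  have hI1 : IsInput G m cap L (h₁.a .input) := by rwa [hF1.arr .input (by decide)]
  refine Cmd.wp_seq_of (wp_sortEdges hB hn1 hm1 hI1) ?_
  rintro h₂ ⟨hF2, hE2, ht2⟩
  have hF02 : h.Frame [.i, .pos, .j, .e] [.pw, .start, .src, .dst] h₂ :=
    (hF1.mono (by simp) (by simp)).trans (hF2.mono (by simp) (by simp))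
  have hI2 : IsInput G m cap L (h₂.a .input) := by rwa [hF02.arr .input (by decide)]
  have hpw2 : ∀ i ≤ n, h₂.a .pw i = 2 ^ i := by rwa [hF2.arr .pw (by decide)]
  refine Cmd.wp_seq_of (wp_tabulateFamily hB ((hF02.var .n (by decide)).trans hn)
    ((hF02.var .m (by decide)).trans hm) hI2 hpw2 (by rwa [hF02.arr .fam (by decide)])) ?_
  rintro h₃ ⟨hF3, hfam3, ht3⟩
  have hF03 : h.Frame [.i, .pos, .j, .e, .p, .hi, .sz, .res] [.pw, .start, .src, .dst, .fam] h₃ :=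
    (hF02.mono (by simp) (by simp)).trans (hF3.mono (by simp) (by simp))
  have hI3 : IsInput G m cap L (h₃.a .input) := by rwa [hF03.arr .input (by decide)]
  have hE : Env G m h₃ := by
    refine ⟨(hF03.var .n (by decide)).trans hn, (hF03.var .k (by decide)).trans hk,
      (hF03.var .m (by decide)).trans hm, (hF03.var .pow (by decide)).trans hpow, ?_, hI3.owner,
      hI3.colour, hfam3, ?_⟩
    · rwa [hF3.arr .pw (by decide)]
    · rwa [hF3.arr .src (by decide), hF3.arr .dst (by decide), hF3.arr .start (by decide)]
  have hw3 : h₃.a .win = h.a .win := hF03.arr .win (by decide)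
  refine Cmd.wp_mono ?_ (wp_solveAll hB hE hA hV (by rw [hw3]; exact hwin _ (by omega))
    (by rw [hw3]; exact hwin _ (by omega)))
  rintro h₄ ⟨hwinner, htable, ht4⟩
  refine ⟨hwinner, htable, ?_⟩
  -- All summands of the running time are at most a multiple of `2 ^ n * n * m`, as `1 ≤ n ≤ m`.
  have hpos := hB.pos
  have hle := hB.le_edges
  have hn1 : n ≤ n * m := Nat.le_mul_of_pos_right n (by omega)
  have hm1 : m ≤ n * m := Nat.le_mul_of_pos_left m hpos
  have hnn : n * n ≤ n * m := Nat.mul_le_mul_left n hle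
  have hP : n * m ≤ 2 ^ n * (n * m) := Nat.le_mul_of_pos_left _ (Nat.two_pow_pos n)
  have e1 : 2 ^ n * (3 * n + 8) ≤ 2 ^ n * (11 * (n * m)) := Nat.mul_le_mul_left _ (by omega)
  have e2 : 2 ^ n * (n * (21 * n + 8 * m + 15) + 39 * n + 13 * m + 47) ≤
      2 ^ n * (143 * (n * m)) := by
    refine Nat.mul_le_mul_left _ ?_
    have : n * (21 * n + 8 * m + 15) = 21 * (n * n) + 8 * (n * m) + 15 * n := by ring
    omega
  have e3 : n * (6 * m + 4) = 6 * (n * m) + 4 * n := by ring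
  have e4 : 2 ^ n * (11 * (n * m)) = 11 * (2 ^ n * (n * m)) := by ring
  have e5 : 2 ^ n * (143 * (n * m)) = 143 * (2 ^ n * (n * m)) := by ring
  rw [mul_assoc]
  omega

/-- The program of the machine. The registers `11` and `5` hold the base addresses of the arrays
`winner` and `table`. -/
def program : Prog :=
  .seq initialise.compile (.seq (setBases 14) (.seq solveGame.compile
    (.seq (.const 4 0) (.seq (.add 0 11 4) (.add 1 5 4)))))

/-- The factor in the bounds for time and space. The two phases together make less than `250` times
`2 ^ n * n * |E|` steps, each of which needs at most as many instructions as the maximum of the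
costs says, and the memory consists of `15` arrays of length at most `8 * (|G| + 2 ^ n)`. -/
def factor : ℕ := 250 * max initialise.cost solveGame.cost + 250

theorem PseudoArena.IsArena.card_V_le {U : Type} [DecidableEq U] {A : PseudoArena U}
    (hA : A.IsArena) : A.V.card ≤ A.E.card := by
  classical
  have : A.V ⊆ A.E.image Prod.fst := fun v hv => by
    obtain ⟨u, hu⟩ := hA.2.2 v hv
    exact Finset.mem_image.2 ⟨_, hu, rfl⟩
  exact (Finset.card_le_card this).trans Finset.card_image_le

theorem exec_program {n k : ℕ} {G : ColouredMullerGame (Fin n) (Fin k)} (hn : 0 < n) (hkn : k ≤ n)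
    (hA : G.A.IsArena) (hV : G.A.V = Finset.univ) {w : List ℕ} (hw : IsPresentation G w) :
    ∃ s t, Exec (factor * (G.size + 2 ^ n)) program (State.init w) s t ∧
      t ≤ factor * (2 ^ n * n * G.A.E.card) ∧ OutputsWinners G s (s.reg 0) ∧
      OutputsPartition G s (s.reg 1) := by
  obtain ⟨cap, hcap⟩ : ∃ cap, cap = 5 + (n + n + (G.A.E.card + G.A.E.card)) +
    (2 ^ n + 2 ^ n + (2 ^ k + k * 2 ^ k)) := ⟨_, rfl⟩
  obtain ⟨hlen, hle, hw0, hw1, hw2, L, hI⟩ := hw.isInput hkn hcap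
  have hnm := hA.card_V_le
  have hsize := G.size_eq
  rw [hV, Finset.card_univ, Fintype.card_fin] at hnm hsize
  have hD := two_mul_sum_card k
  have hpk : 2 ^ k ≤ 2 ^ n := Nat.pow_le_pow_right (by omega) hkn
  have hn2 := Nat.lt_two_pow_self (n := n)
  have hk0 := Nat.two_pow_pos k
  obtain ⟨c, hc⟩ : ∃ c, max initialise.cost solveGame.cost = c := ⟨_, rfl⟩
  have hc1 : initialise.cost ≤ c := hc ▸ le_max_left _ _
  have hc2 : solveGame.cost ≤ c := hc ▸ le_max_right _ _
  have hfac : factor = 250 * c + 250 := by rw [factor, hc]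
  obtain ⟨B, hB⟩ : ∃ B, factor * (G.size + 2 ^ n) = B := ⟨_, rfl⟩
  rw [hB]
  have hsB : 250 * (G.size + 2 ^ n) ≤ B := by
    rw [← hB]
    exact Nat.mul_le_mul_right _ (by omega)
  set m := G.A.E.card with hm
  have h15 : 15 * cap ≤ B := by omega
  have hget : ∀ i, w.getD i 0 < B := by
    intro i
    rcases Nat.lt_or_ge i w.length with hi | hi
    · rw [List.getD_eq_getElem _ _ hi]
      have := hle _ (List.getElem_mem hi)
      omega
    · rw [List.getD_eq_default _ _ hi]
      omega
  -- In the beginning, the whole memory is regarded as the array `input`.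
  have hs0 : Represents 1 B B ⟨fun _ => 0, fun _ i => w.getD i 0, 0⟩ (State.init w) := by
    have key : ∀ b : Arr, b.ctorIdx < 1 → b.ctorIdx = 0 := fun b hb => by omega
    refine ⟨fun _ => rfl, fun _ => by simp; omega, fun b hb => by simp [State.init, key b hb],
      fun b hb i _ => by simp [State.init, key b hb], fun _ _ i _ => hget i, by omega⟩
  obtain ⟨s₁, t₁, h₁, hx₁, hs₁, ⟨ha₁, hn₁, hk₁, hm₁, hpow₁, hcap₁, ht₁⟩, hte₁⟩ :=
    Cmd.exec_compile hc1 hs0 (wp_initialise hw0 hw1 hw2 hcap (by omega))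
  have hmem₁ : ∀ i < B, s₁.mem i = w.getD i 0 := by
    intro i hi
    have := hs₁.arr_eq .input (by decide) i hi
    rw [ha₁] at this
    simpa [show Arr.input.ctorIdx = 0 from rfl] using this
  obtain ⟨s₂, hx₂, hmem₂, hreg₂, hbase₂⟩ := exec_setBases (B := B) (cap := cap) (s := s₁)
    (by simpa [show Arr.input.ctorIdx = 0 from rfl] using hs₁.base .input (by decide))
    (by rw [hs₁.var_eq, hcap₁]) 14 (by omega)
  -- Now the memory is divided into arrays; only the first one is nonzero.
  have hs₂ : Represents 15 B cap ⟨h₁.v, fun b i => w.getD (b.ctorIdx * cap + i) 0, 0⟩ s₂ := by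
    refine ⟨fun x => ?_, hs₁.var_lt, fun b hb => hbase₂ _ (by omega), fun b hb i hi => ?_,
      fun _ _ i _ => hget _, h15⟩
    · rw [hreg₂ _ (by omega), hs₁.var_eq]
    · have : (b.ctorIdx + 1) * cap ≤ 15 * cap := Nat.mul_le_mul_right _ hb
      rw [Nat.add_one_mul] at this
      rw [hmem₂, hmem₁ _ (by omega)]
  have hzero : ∀ b : Arr, 0 < b.ctorIdx → ∀ i, w.getD (b.ctorIdx * cap + i) 0 = 0 := by
    intro b hb i
    have := Nat.le_mul_of_pos_left cap hb
    exact List.getD_eq_default _ _ (by omega)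
  have hbounds : Bounds n k m B cap :=
    ⟨hn, hkn, by omega, by omega, hnm, by omega, by omega⟩
  obtain ⟨s₃, t₃, h₃, hx₃, hs₃, ⟨hwinner, htable, ht₃⟩, hte₃⟩ :=
    Cmd.exec_compile hc2 hs₂ (wp_solveGame (L := L) hbounds hA hV hn₁ hk₁ hm₁ hpow₁
      (by simpa [show Arr.input.ctorIdx = 0 from rfl] using hI)
      (fun i _ => hzero .fam (by decide) i) fun i _ => hzero .win (by decide) i)
  have hb3 : s₃.reg 11 = 3 * cap := hs₃.base .winner (by decide)
  have hb1 : s₃.reg 5 = 1 * cap := hs₃.base .table (by decide)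
  refine ⟨_, _, Exec.seq _ _ _ _ _ _ _ hx₁ (Exec.seq _ _ _ _ _ _ _ hx₂ (Exec.seq _ _ _ _ _ _ _ hx₃
    (Exec.seq _ _ _ _ _ _ _ (Exec.const _ 4 0 (by omega)) (Exec.seq _ _ _ _ _ _ _
      (Exec.add _ 0 11 4 ?_) (Exec.add _ 1 5 4 ?_))))), ?_, ?_, ?_⟩
  · simp [hb3]
    omega
  · simp [hb1]
    omega
  · -- The running time.
    have hW : 1 ≤ 2 ^ n * n * m := Nat.mul_pos (Nat.mul_pos (Nat.two_pow_pos n) hn) (by omega)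
    have hnW : n ≤ 2 ^ n * n * m :=
      (Nat.le_mul_of_pos_left n (Nat.two_pow_pos n)).trans (Nat.le_mul_of_pos_right _ (by omega))
    have e1 : h₁.t + h₃.t ≤ 219 * (2 ^ n * n * m) := by
      simp at ht₁ ht₃
      omega
    have e2 : c * h₁.t + c * h₃.t ≤ c * (219 * (2 ^ n * n * m)) := by
      rw [← mul_add]
      exact Nat.mul_le_mul_left c e1
    have e3 : factor * (2 ^ n * n * m) = c * (219 * (2 ^ n * n * m)) +
        31 * (c * (2 ^ n * n * m)) + 250 * (2 ^ n * n * m) := by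
      rw [hfac]
      ring
    rw [e3]
    simp only [mul_zero, add_zero] at hte₁ hte₃
    omega
  · intro v
    have hv := v.2
    have hcell : s₃.mem (3 * cap + v) = if v ∈ G.winSet 1 Finset.univ then 1 else 0 := by
      rw [← hwinner v]
      exact hs₃.arr_eq .winner (by decide) v (by omega)
    have hW1 : v ∈ G.winSet 1 Finset.univ ↔ v ∈ G.Win 1 := by
      rw [← Finset.mem_coe, G.coe_winSet, ← hV, G.restrict_V hA]
    have hW0 : v ∈ G.Win 0 ↔ v ∉ G.Win 1 := by
      have : G.Win (1 - 1) = (G.A.V : Set (Fin n)) \ G.Win 1 := G.Win_opponent_eq hA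
      rw [sub_self] at this
      rw [this, hV]
      simp
    simp only [hb3, Function.update_self, ne_eq, OfNat.ofNat_ne_zero, not_false_eq_true,
      Function.update_of_ne, zero_ne_one, add_zero, hcell, Fin.forall_fin_two, hW0, ← hW1,
      show (11 : ℕ) ≠ 4 by decide]
    by_cases hvW : v ∈ G.winSet 1 Finset.univ <;> simp [hvW]
  · intro X hX
    have hcl := code_lt X
    have hcell : s₃.mem (cap + code X) = h₃.a .table (code X) := by
      have := hs₃.arr_eq .table (by decide) (code X) (by omega)
      rwa [show Arr.table.ctorIdx = 1 from rfl, one_mul] at this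
    have := htable X hX
    rw [← hcell] at this
    simpa [hb1, IsVerdict] using this

end RegularGames

theorem mainTheorem2 :
    ∃ (prog : Prog) (K : ℕ), ∀ (n k : ℕ) (G : ColouredMullerGame (Fin n) (Fin k)),
      0 < n → k ≤ n → G.A.IsArena → G.A.V = Finset.univ →
      (∀ w : List ℕ, IsPresentation G w →
        ∃ (s : State) (t : ℕ),
          Exec (K * (G.size + 2 ^ n)) prog (State.init w) s t ∧
          t ≤ K * (2 ^ n * n * G.A.E.card) ∧
          OutputsWinners G s (s.reg 0) ∧
          OutputsPartition G s (s.reg 1)) ∧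
      ((¬ (∃ X ∈ G.P 0, G.A.IsTrap 1 X) ∧ G.Win 0 = ∅ ∧ G.Win 1 = Set.univ) ∨
        ∃ S : Finset (Fin n), IsGreatest {X | X ∈ G.P 0 ∧ G.A.IsTrap 1 X} S ∧
          G.Win 0 = S ∧ G.Win 1 = Set.univ \ (S : Set (Fin n))) := by
  refine ⟨program, factor, fun n k G hn hkn hA hV =>
    ⟨fun w hw => exec_program hn hkn hA hV hw, ?_⟩⟩
  have h := G.exists_isGreatest_trap hA
  rwa [hV, Finset.coe_univ] at h
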